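/- Let $(M,g)$ be a non-empty smooth Riemannian manifold of dimension $n\ge 2$, with Levi-Civita connection $\dot\nabla$. On the total space of $TM$ let $X^V_y, X^H_y$ denote the vertical and ($\dot\nabla$-)horizontal lifts of $X\in T_{\tau(y)}M$ to $T_y(TM)$, and let $t=\frac12 g(y,y)\in[0,\infty)$ be the energy density. Let $a_1,\dots,a_4,b_1,\dots,b_4,c_1,c_2,c_3,d_1,d_2,d_3$ be smooth functions on $[0,\infty)$, and let $J$ and $G$ be the general natural tensor fields on $TM$ $$JX^H_y=a_1(t)X^V_y+b_1(t)g(X,y)y^V_y+a_4(t)X^H_y+b_4(t)g(X,y)y^H_y,$$ $$JX^V_y=a_3(t)X^V_y+b_3(t)g(X,y)y^V_y-a_2(t)X^H_y-b_2(t)g(X,y)y^H_y,$$ $$G(X^H_y,Y^H_y)=c_1(t)g(X,Y)+d_1(t)g(X,y)g(Y,y),\qquad G(X^V_y,Y^V_y)=c_2(t)g(X,Y)+d_2(t)g(X,y)g(Y,y),$$ $$G(X^V_y,Y^H_y)=G(Y^H_y,X^V_y)=c_3(t)g(X,Y)+d_3(t)g(X,y)g(Y,y).$$ Assume that $(G,J)$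 is an almost anti-Hermitian structure on $TM$: $J^2=-\mathrm{Id}$, $G$ is nondegenerate everywhere, and $G(JX,JY)=-G(X,Y)$. Let $\nabla$ be the Levi-Civita connection of $G$, $F(X,Y,Z)=G((\nabla_XJ)Y,Z)$, and let $\Phi(Z)=\operatorname{tr}_G F(\cdot,\cdot,Z)$. The structure is called conformally anti-Kähler (an $\omega_1$-manifold) if for all $X,Y,Z$ $$2nF(X,Y,Z)=G(X,JY)\Phi(JZ)+G(X,JZ)\Phi(JY)+G(X,Y)\Phi(Z)+G(X,Z)\Phi(Y).$$ For a real number $c$, consider the following conditions, required for all $t\ge 0$ (a prime denotes the derivative in $t$). Put $D=a_1-2ta_1'-2cta_2-4ct^2a_2'$. (I) $D\neq0$ and $$b_1=\frac{2c^2ta_2^2+2cta_1a_2'+a_1a_1'-c+3ca_3^2}{D},\quad b_2=\frac{2ta_3'^2-2ta_1'a_2'+ca_2^2+2cta_2a_2'+a_1a_2'}{D},$$ $$b_3=\frac{a_1a_3'+2ca_2a_3+4cta_2'a_3-2cta_2a_3'}{D}.$$ (II) $$d_1=c\,\frac{2a_1a_3c_3-c_1(1+a_3^2)}{a_1^2},\qquad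 d_3=\frac{a_3'c_1-a_1'c_3}{a_1}.$$ Then: 1. $J$ is integrable (its Nijenhuis tensor vanishes) if and only if there is a constant $c$ such that $(M,g)$ has constant sectional curvature $c$ (that is, $R(X,Y)Z=c\,(g(Y,Z)X-g(X,Z)Y)$) and (I) holds. 2. $(TM,G,J)$ is conformally anti-Kähler if and only if there is a constant $c$ such that $(M,g)$ has constant sectional curvature $c$ and both (I) and (II) hold; that is, if and only if $J$ is integrable and $d_1,d_3$ have the form (II) with $c$ the sectional curvature of $M$. -/

import Mathlib

open scoped Manifold ContDiff Matrix

noncomputable section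

namespace NaturalLift

/-! ### Tensor calculus in a coordinate domain

Coordinates are functions `ι → ℝ`. A metric or an endomorphism field is given by its matrix
of components with respect to the coordinate frame. For an endomorphism field `J`, the entry
`J z h i` is the component `J^h_i`, that is, `J (∂_i) = ∑ h, J^h_i ∂_h`. -/

section Coordinates

variable {ι : Type} [Fintype ι] [DecidableEq ι]

/-- The partial derivative `∂f/∂x^i`. -/
def pd (i : ι) (f : (ι → ℝ) → ℝ) (x : ι → ℝ) : ℝ :=
  fderiv ℝ f x (Pi.single i 1)

/-- The Christoffel symbol `Γ^h_{ij}` of the Levi-Civita connection of the (semi-)Riemannian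
metric with components `m`. -/
def christoffel (m : (ι → ℝ) → Matrix ι ι ℝ) (h i j : ι) (x : ι → ℝ) : ℝ :=
  (1 / 2) * ∑ l, (m x)⁻¹ h l *
    (pd i (fun z => m z l j) x + pd j (fun z => m z l i) x - pd l (fun z => m z i j) x)

/-- The component `R^h_{kij}` of the curvature tensor field,
`R(∂_i, ∂_j) ∂_k = ∑ h, R^h_{kij} ∂_h`,
where `R(X, Y) = ∇_X ∇_Y - ∇_Y ∇_X - ∇_{[X, Y]}`. -/
def curvature (m : (ι → ℝ) → Matrix ι ι ℝ) (h k i j : ι) (x : ι → ℝ) : ℝ :=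
  pd i (christoffel m h j k) x - pd j (christoffel m h i k) x
    + ∑ l, (christoffel m h i l x * christoffel m l j k x
        - christoffel m h j l x * christoffel m l i k x)

/-- The component `(∇_i J)^h_j` of the covariant derivative of `J` with respect to the
Levi-Civita connection of `G`. -/
def covDerivEndo (G J : (ι → ℝ) → Matrix ι ι ℝ) (h i j : ι) (z : ι → ℝ) : ℝ :=
  pd i (fun w => J w h j) z
    + ∑ l, (christoffel G h i l z * J z l j - christoffel G l i j z * J z h l)

/-- The component `F(∂_i, ∂_j, ∂_k)` of the tensor `F(X, Y, Z) = G((∇_X J) Y, Z)`. -/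
def tensorF (G J : (ι → ℝ) → Matrix ι ι ℝ) (i j k : ι) (z : ι → ℝ) : ℝ :=
  ∑ h, covDerivEndo G J h i j z * G z h k

/-- The component `Φ(∂_k) = G^{ij} F(∂_i, ∂_j, ∂_k)` of the 1-form associated with `F`. -/
def formPhi (G J : (ι → ℝ) → Matrix ι ι ℝ) (k : ι) (z : ι → ℝ) : ℝ :=
  ∑ i, ∑ j, (G z)⁻¹ i j * tensorF G J i j k z

/-- The component `G(∂_i, J ∂_j)`. -/
def metricJ (G J : (ι → ℝ) → Matrix ι ι ℝ) (i j : ι) (z : ι → ℝ) : ℝ :=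
  ∑ h, G z i h * J z h j

/-- The component `Φ(J ∂_k)`. -/
def formPhiJ (G J : (ι → ℝ) → Matrix ι ι ℝ) (k : ι) (z : ι → ℝ) : ℝ :=
  ∑ h, formPhi G J h z * J z h k

/-- The component `N^h_{ij}` of the Nijenhuis tensor
`N(X, Y) = [JX, JY] - J [JX, Y] - J [X, JY] + J² [X, Y]`. -/
def nijenhuis (J : (ι → ℝ) → Matrix ι ι ℝ) (h i j : ι) (z : ι → ℝ) : ℝ :=
  ∑ l, (J z l i * pd l (fun w => J w h j) z - J z l j * pd l (fun w => J w h i) z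
    - J z h l * (pd i (fun w => J w l j) z - pd j (fun w => J w l i) z))

end Coordinates

/-! ### Natural lifts to the tangent bundle in an induced chart

In the chart of `TM` induced by a chart of `M`, a point is `z = (x, y)`, indexed by
`Fin n ⊕ Fin n`; `inl` indexes the coordinates `x^i` and `inr` the fibre coordinates `y^i`.
A tangent vector `w` of `TM` at `z` has components indexed in the same way, with respect to
`∂/∂x^i` and `∂/∂y^i`. -/

/-- The coefficient functions of a general natural tensor field of type (1,1) on `TM`. -/
structure EndoCoeffs where
  a₁ : ℝ → ℝ
  a₂ : ℝ → ℝ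
  a₃ : ℝ → ℝ
  a₄ : ℝ → ℝ
  b₁ : ℝ → ℝ
  b₂ : ℝ → ℝ
  b₃ : ℝ → ℝ
  b₄ : ℝ → ℝ

/-- The coefficient functions of a general natural symmetric (0,2)-tensor field on `TM`. -/
structure MetricCoeffs where
  c₁ : ℝ → ℝ
  c₂ : ℝ → ℝ
  c₃ : ℝ → ℝ
  d₁ : ℝ → ℝ
  d₂ : ℝ → ℝ
  d₃ : ℝ → ℝ

/-- Smoothness of a function of the energy density `t ∈ [0, ∞)`. -/
def SmoothCoeff (f : ℝ → ℝ) : Prop := ContDiffOn ℝ ∞ f (Set.Ici 0)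

/-- All coefficients are smooth on `[0, ∞)`. -/
def EndoCoeffs.Smooth (A : EndoCoeffs) : Prop :=
  SmoothCoeff A.a₁ ∧ SmoothCoeff A.a₂ ∧ SmoothCoeff A.a₃ ∧ SmoothCoeff A.a₄ ∧
  SmoothCoeff A.b₁ ∧ SmoothCoeff A.b₂ ∧ SmoothCoeff A.b₃ ∧ SmoothCoeff A.b₄

/-- All coefficients are smooth on `[0, ∞)`. -/
def MetricCoeffs.Smooth (C : MetricCoeffs) : Prop :=
  SmoothCoeff C.c₁ ∧ SmoothCoeff C.c₂ ∧ SmoothCoeff C.c₃ ∧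
  SmoothCoeff C.d₁ ∧ SmoothCoeff C.d₂ ∧ SmoothCoeff C.d₃

section Lifts

variable {n : ℕ}

/-- The base coordinates `x` of a point `(x, y)`. -/
def basePt (z : Fin n ⊕ Fin n → ℝ) : Fin n → ℝ := fun i => z (Sum.inl i)

/-- The fibre coordinates `y` of a point `(x, y)`. -/
def fibrePt (z : Fin n ⊕ Fin n → ℝ) : Fin n → ℝ := fun i => z (Sum.inr i)

/-- The scalar product `g_x(u, v)` for the metric with components `m`. -/
def ip (m : (Fin n → ℝ) → Matrix (Fin n) (Fin n) ℝ) (x u v : Fin n → ℝ) : ℝ :=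
  ∑ i, ∑ j, m x i j * u i * v j

/-- The energy density `t = g(y, y) / 2`. -/
def energy (m : (Fin n → ℝ) → Matrix (Fin n) (Fin n) ℝ) (z : Fin n ⊕ Fin n → ℝ) : ℝ :=
  (1 / 2) * ip m (basePt z) (fibrePt z) (fibrePt z)

/-- The vector with components `Γ^h_{0i} X^i = y^k Γ^h_{ki} X^i`. -/
def gammaY (m : (Fin n → ℝ) → Matrix (Fin n) (Fin n) ℝ) (z : Fin n ⊕ Fin n → ℝ)
    (X : Fin n → ℝ) : Fin n → ℝ :=
  fun h => ∑ k, ∑ i, fibrePt z k * christoffel m h k i (basePt z) * X i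

/-- The vertical lift `X^V = X^i ∂/∂y^i`. -/
def vertLift (X : Fin n → ℝ) : Fin n ⊕ Fin n → ℝ := Sum.elim (fun _ => 0) X

/-- The horizontal lift `X^H = X^i δ/δx^i`, where `δ/δx^i = ∂/∂x^i - Γ^h_{0i} ∂/∂y^h`. -/
def horLift (m : (Fin n → ℝ) → Matrix (Fin n) (Fin n) ℝ) (z : Fin n ⊕ Fin n → ℝ)
    (X : Fin n → ℝ) : Fin n ⊕ Fin n → ℝ :=
  Sum.elim X (fun h => -gammaY m z X h)

/-- The vector `X` in the decomposition `w = X^H + Y^V`. -/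
def horPart (w : Fin n ⊕ Fin n → ℝ) : Fin n → ℝ := fun i => w (Sum.inl i)

/-- The vector `Y` in the decomposition `w = X^H + Y^V`. -/
def vertPart (m : (Fin n → ℝ) → Matrix (Fin n) (Fin n) ℝ) (z w : Fin n ⊕ Fin n → ℝ) :
    Fin n → ℝ :=
  fun h => w (Sum.inr h) + gammaY m z (horPart w) h

/-- The splitting of tangent vectors of `TM` into horizontal and vertical lifts. -/
theorem horLift_add_vertLift (m : (Fin n → ℝ) → Matrix (Fin n) (Fin n) ℝ)
    (z w : Fin n ⊕ Fin n → ℝ) :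
    horLift m z (horPart w) + vertLift (vertPart m z w) = w := by
  funext s
  rcases s with i | i <;> simp [horLift, vertLift, horPart, vertPart]

/-- `J X^H = a₁ X^V + b₁ g(X, y) y^V + a₄ X^H + b₄ g(X, y) y^H`. -/
def endoHor (m : (Fin n → ℝ) → Matrix (Fin n) (Fin n) ℝ) (A : EndoCoeffs)
    (z : Fin n ⊕ Fin n → ℝ) (X : Fin n → ℝ) : Fin n ⊕ Fin n → ℝ :=
  let t := energy m z
  let y := fibrePt z
  let p := ip m (basePt z) X y
  A.a₁ t • vertLift X + (A.b₁ t * p) • vertLift y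
    + A.a₄ t • horLift m z X + (A.b₄ t * p) • horLift m z y

/-- `J X^V = a₃ X^V + b₃ g(X, y) y^V - a₂ X^H - b₂ g(X, y) y^H`. -/
def endoVert (m : (Fin n → ℝ) → Matrix (Fin n) (Fin n) ℝ) (A : EndoCoeffs)
    (z : Fin n ⊕ Fin n → ℝ) (X : Fin n → ℝ) : Fin n ⊕ Fin n → ℝ :=
  let t := energy m z
  let y := fibrePt z
  let p := ip m (basePt z) X y
  A.a₃ t • vertLift X + (A.b₃ t * p) • vertLift y
    - A.a₂ t • horLift m z X - (A.b₂ t * p) • horLift m z y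

/-- The matrix of the general natural tensor field `J` in the induced chart. -/
def endoLift (m : (Fin n → ℝ) → Matrix (Fin n) (Fin n) ℝ) (A : EndoCoeffs)
    (z : Fin n ⊕ Fin n → ℝ) : Matrix (Fin n ⊕ Fin n) (Fin n ⊕ Fin n) ℝ :=
  Matrix.of fun r s =>
    (endoHor m A z (horPart (Pi.single s 1)) + endoVert m A z (vertPart m z (Pi.single s 1))) r

/-- The bilinear form `G` with
`G(X^H, Y^H) = c₁ g(X, Y) + d₁ g(X, y) g(Y, y)`,
`G(X^V, Y^V) = c₂ g(X, Y) + d₂ g(X, y) g(Y, y)`,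
`G(X^V, Y^H) = G(Y^H, X^V) = c₃ g(X, Y) + d₃ g(X, y) g(Y, y)`,
evaluated on `v` and `w`. -/
def metricForm (m : (Fin n → ℝ) → Matrix (Fin n) (Fin n) ℝ) (C : MetricCoeffs)
    (z v w : Fin n ⊕ Fin n → ℝ) : ℝ :=
  let t := energy m z
  let y := fibrePt z
  let g := ip m (basePt z)
  let q := fun (c d : ℝ) (X Y : Fin n → ℝ) => c * g X Y + d * g X y * g Y y
  q (C.c₁ t) (C.d₁ t) (horPart v) (horPart w)
    + q (C.c₂ t) (C.d₂ t) (vertPart m z v) (vertPart m z w)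
    + q (C.c₃ t) (C.d₃ t) (vertPart m z v) (horPart w)
    + q (C.c₃ t) (C.d₃ t) (vertPart m z w) (horPart v)

/-- The matrix of the general natural metric `G` in the induced chart. -/
def metricLift (m : (Fin n → ℝ) → Matrix (Fin n) (Fin n) ℝ) (C : MetricCoeffs)
    (z : Fin n ⊕ Fin n → ℝ) : Matrix (Fin n ⊕ Fin n) (Fin n ⊕ Fin n) ℝ :=
  Matrix.of fun r s => metricForm m C z (Pi.single r 1) (Pi.single s 1)

end Lifts

/-! ### Structures on the tangent bundle of a Riemannian manifold -/

section Manifold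

variable {n : ℕ} {M : Type*} [TopologicalSpace M] [ChartedSpace (EuclideanSpace ℝ (Fin n)) M]

/-- The type of smooth Riemannian metrics on `M`. -/
abbrev SmoothMetric (n : ℕ) (M : Type*) [TopologicalSpace M]
    [ChartedSpace (EuclideanSpace ℝ (Fin n)) M]
    [IsManifold 𝓘(ℝ, EuclideanSpace ℝ (Fin n)) ∞ M] :=
  Bundle.ContMDiffRiemannianMetric 𝓘(ℝ, EuclideanSpace ℝ (Fin n)) ∞
    (EuclideanSpace ℝ (Fin n))
    (fun p : M => TangentSpace 𝓘(ℝ, EuclideanSpace ℝ (Fin n)) p)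

/-- The coordinate vector `∂/∂x^i` of the chart `e` at the point with coordinates `x`. -/
def coordVec (e : OpenPartialHomeomorph M (EuclideanSpace ℝ (Fin n)))
    (x : Fin n → ℝ) (i : Fin n) :
    TangentSpace 𝓘(ℝ, EuclideanSpace ℝ (Fin n)) (e.symm (WithLp.toLp 2 x)) :=
  mfderiv 𝓘(ℝ, EuclideanSpace ℝ (Fin n)) 𝓘(ℝ, EuclideanSpace ℝ (Fin n)) e.symm
    (WithLp.toLp 2 x) (EuclideanSpace.single i (1 : ℝ) : EuclideanSpace ℝ (Fin n))

/-- The coordinates of the points in the domain of the chart `e`. -/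
def chartDomain (e : OpenPartialHomeomorph M (EuclideanSpace ℝ (Fin n))) : Set (Fin n → ℝ) :=
  {x | WithLp.toLp 2 x ∈ e.target}

/-- The coordinates of the points in the domain of the chart of `TM` induced by `e`. -/
def inducedDomain (e : OpenPartialHomeomorph M (EuclideanSpace ℝ (Fin n))) :
    Set (Fin n ⊕ Fin n → ℝ) :=
  {z | basePt z ∈ chartDomain e}

variable [IsManifold 𝓘(ℝ, EuclideanSpace ℝ (Fin n)) ∞ M]

/-- The components `g_{ij}` of the metric `g` in the chart `e`. -/
def chartMetric (g : SmoothMetric n M) (e : OpenPartialHomeomorph M (EuclideanSpace ℝ (Fin n)))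
    (x : Fin n → ℝ) : Matrix (Fin n) (Fin n) ℝ :=
  Matrix.of fun i j => g.inner (e.symm (WithLp.toLp 2 x)) (coordVec e x i) (coordVec e x j)

/-- `(M, g)` has constant sectional curvature `c`:
`R^h_{kij} = c (δ^h_i g_{kj} - δ^h_j g_{ki})` in every chart. -/
def HasConstantCurvature (g : SmoothMetric n M) (c : ℝ) : Prop :=
  ∀ e ∈ atlas (EuclideanSpace ℝ (Fin n)) M, ∀ x ∈ chartDomain e, ∀ h k i j : Fin n,
    curvature (chartMetric g e) h k i j x
      = c * ((if h = i then 1 else 0) * chartMetric g e x k j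
        - (if h = j then 1 else 0) * chartMetric g e x k i)

/-- The matrix field of `J` in the chart of `TM` induced by `e`. -/
def chartJ (g : SmoothMetric n M) (A : EndoCoeffs)
    (e : OpenPartialHomeomorph M (EuclideanSpace ℝ (Fin n))) :
    (Fin n ⊕ Fin n → ℝ) → Matrix (Fin n ⊕ Fin n) (Fin n ⊕ Fin n) ℝ :=
  endoLift (chartMetric g e) A

/-- The matrix field of `G` in the chart of `TM` induced by `e`. -/
def chartG (g : SmoothMetric n M) (C : MetricCoeffs)
    (e : OpenPartialHomeomorph M (EuclideanSpace ℝ (Fin n))) :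
    (Fin n ⊕ Fin n → ℝ) → Matrix (Fin n ⊕ Fin n) (Fin n ⊕ Fin n) ℝ :=
  metricLift (chartMetric g e) C

/-- `J² = -1` on `TM`. -/
def IsAlmostComplex (g : SmoothMetric n M) (A : EndoCoeffs) : Prop :=
  ∀ e ∈ atlas (EuclideanSpace ℝ (Fin n)) M, ∀ z ∈ inducedDomain e,
    chartJ g A e z * chartJ g A e z = -1

/-- `G` is nondegenerate at every point of `TM`, that is, a semi-Riemannian metric. -/
def IsSemiRiemannian (g : SmoothMetric n M) (C : MetricCoeffs) : Prop :=
  ∀ e ∈ atlas (EuclideanSpace ℝ (Fin n)) M, ∀ z ∈ inducedDomain e, (chartG g C e z).det ≠ 0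

/-- `G(JX, JY) = -G(X, Y)` on `TM`. -/
def IsAntiHermitian (g : SmoothMetric n M) (A : EndoCoeffs) (C : MetricCoeffs) : Prop :=
  ∀ e ∈ atlas (EuclideanSpace ℝ (Fin n)) M, ∀ z ∈ inducedDomain e,
    (chartJ g A e z)ᵀ * chartG g C e z * chartJ g A e z = -chartG g C e z

/-- `J` is integrable: its Nijenhuis tensor vanishes on `TM`. -/
def IsIntegrable (g : SmoothMetric n M) (A : EndoCoeffs) : Prop :=
  ∀ e ∈ atlas (EuclideanSpace ℝ (Fin n)) M, ∀ z ∈ inducedDomain e,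
    ∀ h i j : Fin n ⊕ Fin n, nijenhuis (chartJ g A e) h i j z = 0

/-- `(TM, G, J)` is conformally anti-Kähler (an `ω₁`-manifold):
`2n F(X, Y, Z) = G(X, JY) Φ(JZ) + G(X, JZ) Φ(JY) + G(X, Y) Φ(Z) + G(X, Z) Φ(Y)`. -/
def IsConformallyAntiKahler (g : SmoothMetric n M) (A : EndoCoeffs) (C : MetricCoeffs) : Prop :=
  ∀ e ∈ atlas (EuclideanSpace ℝ (Fin n)) M, ∀ z ∈ inducedDomain e,
    ∀ i j k : Fin n ⊕ Fin n,
      2 * (n : ℝ) * tensorF (chartG g C e) (chartJ g A e) i j k z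
        = metricJ (chartG g C e) (chartJ g A e) i j z * formPhiJ (chartG g C e) (chartJ g A e) k z
          + metricJ (chartG g C e) (chartJ g A e) i k z
            * formPhiJ (chartG g C e) (chartJ g A e) j z
          + chartG g C e z i j * formPhi (chartG g C e) (chartJ g A e) k z
          + chartG g C e z i k * formPhi (chartG g C e) (chartJ g A e) j z

end Manifold

/-! ### The explicit coefficients -/

/-- The derivative of a function on `[0, ∞)`, one-sided at `0`. -/
def der (f : ℝ → ℝ) (t : ℝ) : ℝ := derivWithin f (Set.Ici 0) t

/-- The common denominator of the expressions of `b₁, b₂, b₃`. -/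
def integrabDenom (A : EndoCoeffs) (c t : ℝ) : ℝ :=
  A.a₁ t - 2 * t * der A.a₁ t - 2 * c * t * A.a₂ t - 4 * c * t ^ 2 * der A.a₂ t

/-- The expressions of `b₁, b₂, b₃` in an integrable structure `J`; the denominator is
required not to vanish. -/
def IntegrabForm (A : EndoCoeffs) (c : ℝ) : Prop :=
  ∀ t : ℝ, 0 ≤ t →
    integrabDenom A c t ≠ 0 ∧
    A.b₁ t = (2 * c ^ 2 * t * A.a₂ t ^ 2 + 2 * c * t * A.a₁ t * der A.a₂ t
      + A.a₁ t * der A.a₁ t - c + 3 * c * A.a₃ t ^ 2) / integrabDenom A c t ∧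
    A.b₂ t = (2 * t * der A.a₃ t ^ 2 - 2 * t * der A.a₁ t * der A.a₂ t + c * A.a₂ t ^ 2
      + 2 * c * t * A.a₂ t * der A.a₂ t + A.a₁ t * der A.a₂ t) / integrabDenom A c t ∧
    A.b₃ t = (A.a₁ t * der A.a₃ t + 2 * c * A.a₂ t * A.a₃ t + 4 * c * t * der A.a₂ t * A.a₃ t
      - 2 * c * t * A.a₂ t * der A.a₃ t) / integrabDenom A c t

/-- The expressions of `d₁` and `d₃` in a conformally anti-Kähler structure. -/
def ConformalForm (A : EndoCoeffs) (C : MetricCoeffs) (c : ℝ) : Prop :=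
  ∀ t : ℝ, 0 ≤ t →
    C.d₁ t = c * (2 * A.a₁ t * A.a₃ t * C.c₃ t - C.c₁ t * (1 + A.a₃ t ^ 2)) / A.a₁ t ^ 2 ∧
    C.d₃ t = (der A.a₃ t * C.c₁ t - der A.a₁ t * C.c₃ t) / A.a₁ t

end NaturalLift

end

open scoped Manifold ContDiff Matrix

noncomputable section

set_option linter.unusedSectionVars false

namespace NaturalLift

/-! Everything is reduced to identities between functions of t. A natural tensor at y is known from
its values on vectors X orthogonal to y, where a block (a, b) acts as a, and on y itself, where it
acts as a + 2tb; the first kind exists because n ≥ 2. Thus J² = -1 becomes a₄ = -a₃, b₄ = -b₃, a₁a₂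
= 1 + a₃², together with the same last relation for aₖ + 2tbₖ (`isComplex_of_sq`). In particular a₂
and a₂ + 2tb₂ have no zeros, so the vertical space V satisfies T(TM) = V ⊕ JV
(`exists_vertLift_add`).

Integrability. Since N(JX, Y) = -J N(X, Y), it suffices to know N on V. There (`nijJet_vertLift`) it
consists of multiples of g(X, y)Y - g(Y, y)X and of the term R(KX, KY)y, where KX = a₂X + b₂g(X, y)y
is invertible. Vanishing of N therefore gives R(V, W)y = κ(t)(g(V, y)W - g(W, y)V), and linearity in
y makes κ constant: the base has constant curvature c = -κ. What remains are the two scalar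
equations `NijenhuisEqs`, linear in b₂, b₃ with determinant -a₂D. Condition (I) is Cramer's rule for
them, with b₁ supplied by J² = -1, once D ≠ 0 is known. For this, let σ and ρ be the complex
functions with X^H ≡ σX^V + ρg(X, y)y^V modulo the -i eigenspace of J, so that σ = (a₃ - i)/a₂. The
equations imply (σ + 2tρ)σ' = ρσ - c (`derC_sigma_eq`), hence σ² + 2ct solves a linear homogeneous
equation; being nonzero at 0 it has no zeros (`kappa_ne_zero`), while D = 0 would force one
(`integrabDenom_ne_zero`).

Conformally anti-Kähler structures. With θ = Φ/n the condition says that the Tachibana operator S(X,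
Y, Z) equals G(Y, Z)θ(X) + G(Y, JZ)θ(JX) (`formJet_iff_tachibanaJet`). S involves first derivatives
of J and G but no Christoffel symbol of G. The condition forces N = 0; conversely, if N = 0, it may
be tested with Y, Z in V. For such Y, Z the operator S has an unwanted part, with coefficients
`tachVertS` and `tachHorS`, and their vanishing is exactly (II) (`conformalForm_iff`). A form θ must
then be found from four equations in two unknowns. Let γ, δ be the coefficients on V of G(Y, Z) -
iG(JY, Z), and Θ the complex number θ(X^V) + iθ(JX^V) divided by g(X, y). The equations become γΘ =
α and δΘ = β; the compatibility αδ = βγ follows by differentiating the equation for σ and the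
relation δ(σ + 2tρ) + γ(σ' + ρ) = 0 (`tachibana_compat`).

Relations found for t > 0 extend to t = 0 by continuity. -/

/-! ### The metric in a chart -/

/-- The components `m` of a smooth Riemannian metric on the coordinate domain `U`. -/
structure IsMetricOn {n : ℕ} (m : (Fin n → ℝ) → Matrix (Fin n) (Fin n) ℝ)
    (U : Set (Fin n → ℝ)) : Prop where
  isOpen : IsOpen U
  symm : ∀ x ∈ U, ∀ i j, m x i j = m x j i
  pos : ∀ x ∈ U, ∀ v : Fin n → ℝ, v ≠ 0 → 0 < ip m x v v
  smooth : ∀ i j, ContDiffOn ℝ ∞ (fun x => m x i j) U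

section Chart

variable {n : ℕ} {M : Type*} [TopologicalSpace M] [ChartedSpace (EuclideanSpace ℝ (Fin n)) M]
  [IsManifold 𝓘(ℝ, EuclideanSpace ℝ (Fin n)) ∞ M]

-- The field is the image of a constant section under the tangent map of `e.symm`, so it inherits
-- the smoothness of that map.
open Bundle in
theorem contMDiffAt_coordVec {e : OpenPartialHomeomorph M (EuclideanSpace ℝ (Fin n))}
    (he : e ∈ atlas (EuclideanSpace ℝ (Fin n)) M) (i : Fin n) {x : Fin n → ℝ}
    (hx : x ∈ chartDomain e) :
    ContMDiffAt 𝓘(ℝ, Fin n → ℝ)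
      (𝓘(ℝ, EuclideanSpace ℝ (Fin n)).prod 𝓘(ℝ, EuclideanSpace ℝ (Fin n))) ∞
      (fun x => TotalSpace.mk' (EuclideanSpace ℝ (Fin n))
        (E := fun p : M => TangentSpace 𝓘(ℝ, EuclideanSpace ℝ (Fin n)) p)
        (e.symm (WithLp.toLp 2 x)) (coordVec e x i)) x := by
  have : IsManifold 𝓘(ℝ, EuclideanSpace ℝ (Fin n)) 1 M := IsManifold.of_le (n := ∞) (by simp)
  have h1 : ContMDiffOn 𝓘(ℝ, EuclideanSpace ℝ (Fin n)) 𝓘(ℝ, EuclideanSpace ℝ (Fin n)) ∞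
      e.symm e.target :=
    contMDiffOn_symm_of_mem_maximalAtlas (IsManifold.subset_maximalAtlas he)
  have h2 := h1.contMDiffOn_tangentMapWithin (m := ∞) (by simp)
    e.open_target.uniqueMDiffOn
  have h3 : ContMDiff 𝓘(ℝ, Fin n → ℝ)
      (𝓘(ℝ, EuclideanSpace ℝ (Fin n)).prod 𝓘(ℝ, EuclideanSpace ℝ (Fin n))) ∞
      (fun x : Fin n → ℝ => TotalSpace.mk' (EuclideanSpace ℝ (Fin n))
        (E := fun p : EuclideanSpace ℝ (Fin n) =>
          TangentSpace 𝓘(ℝ, EuclideanSpace ℝ (Fin n)) p)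
        (WithLp.toLp 2 x) (EuclideanSpace.single i (1 : ℝ))) := by
    intro x
    rw [contMDiffAt_totalSpace]
    refine ⟨?_, ?_⟩
    · exact (EuclideanSpace.equiv (Fin n) ℝ).symm.contDiff.contMDiff.contMDiffAt
    · simp only [TangentBundle.trivializationAt_apply, mfld_simps]
      -- All charts of the model space are the identity, so the trivialization returns the constant
      -- vector itself.
      have hid : ∀ p q : EuclideanSpace ℝ (Fin n),
          ↑(chartAt (EuclideanSpace ℝ (Fin n)) p) ∘ ↑(chartAt (EuclideanSpace ℝ (Fin n)) q).symm
            = (id : EuclideanSpace ℝ (Fin n) → EuclideanSpace ℝ (Fin n)) := fun p q => by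
        simp [chartAt_self_eq]
      simp only [hid, fderivWithin_univ, fderiv_id]
      exact contMDiffAt_const (I := 𝓘(ℝ, Fin n → ℝ)) (I' := 𝓘(ℝ, EuclideanSpace ℝ (Fin n)))
        (c := (EuclideanSpace.single i (1 : ℝ) : EuclideanSpace ℝ (Fin n)))
  have h4 := (h2.contMDiffAt (x := TotalSpace.mk' (EuclideanSpace ℝ (Fin n))
        (E := fun p : EuclideanSpace ℝ (Fin n) =>
          TangentSpace 𝓘(ℝ, EuclideanSpace ℝ (Fin n)) p)
        (WithLp.toLp 2 x) (EuclideanSpace.single i (1 : ℝ)))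
    ((e.open_target.preimage (FiberBundle.continuous_proj _ _)).mem_nhds hx)).comp x h3.contMDiffAt
  refine h4.congr_of_eventuallyEq ?_
  have hopen : IsOpen (chartDomain e) :=
    e.open_target.preimage (PiLp.continuous_toLp 2 (fun _ : Fin n => ℝ))
  filter_upwards [hopen.mem_nhds hx] with y hy
  simp only [Function.comp, tangentMapWithin, coordVec]
  rw [mfderivWithin_of_isOpen e.open_target hy]
  

theorem isMetricOn_chartMetric (g : SmoothMetric n M)
    {e : OpenPartialHomeomorph M (EuclideanSpace ℝ (Fin n))}
    (he : e ∈ atlas (EuclideanSpace ℝ (Fin n)) M) :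
    IsMetricOn (chartMetric g e) (chartDomain e) := by
  have : IsManifold 𝓘(ℝ, EuclideanSpace ℝ (Fin n)) 1 M := IsManifold.of_le (n := ∞) (by simp)
  have hopen : IsOpen (chartDomain e) :=
    e.open_target.preimage (PiLp.continuous_toLp 2 (fun _ : Fin n => ℝ))
  refine ⟨hopen, fun x _ i j => g.symm _ _ _, fun x hx v hv => ?_, fun i j x hx => ?_⟩
  · have key : ip (chartMetric g e) x v v =
        g.inner (e.symm (WithLp.toLp 2 x)) (∑ i, v i • coordVec e x i)
          (∑ i, v i • coordVec e x i) := by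
      simp only [map_sum, map_smul, ip, chartMetric, Matrix.of_apply]
      simp only [sum_apply, smul_apply, smul_eq_mul,
        Finset.mul_sum]
      rw [Finset.sum_comm]
      refine Finset.sum_congr rfl fun i _ => Finset.sum_congr rfl fun j _ => ?_
      ring
    rw [key]
    refine g.pos _ _ fun h0 => hv ?_
    have h1 : mfderiv 𝓘(ℝ, EuclideanSpace ℝ (Fin n)) 𝓘(ℝ, EuclideanSpace ℝ (Fin n)) e.symm
        (WithLp.toLp 2 x) (WithLp.toLp 2 v : EuclideanSpace ℝ (Fin n)) = 0 := by
      rw [← h0]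
      have : (WithLp.toLp 2 v : EuclideanSpace ℝ (Fin n))
          = ∑ i, v i • (EuclideanSpace.single i (1 : ℝ) : EuclideanSpace ℝ (Fin n)) := by
        ext j
        simp [Finset.sum_apply, Pi.single_apply]
      rw [this]
      simp only [coordVec]
      exact (map_sum _ _ _).trans (Finset.sum_congr rfl fun i _ => map_smul _ _ _)
    -- The differential of an inverse chart is injective, which excludes a null combination of the
    -- coordinate vectors.
    have h2 := ((mdifferentiable_of_mem_atlas (I := 𝓘(ℝ, EuclideanSpace ℝ (Fin n)))
      he).symm).mfderiv_injective hx
    have h3 := h2 (h1.trans (map_zero _).symm)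
    exact (WithLp.toLp_injective 2 h3 : v = 0)
  · have hb : ContMDiffAt 𝓘(ℝ, Fin n → ℝ) 𝓘(ℝ, EuclideanSpace ℝ (Fin n)) ∞
        (fun x : Fin n → ℝ => e.symm (WithLp.toLp 2 x)) x := by
      have h := contMDiffAt_coordVec he i hx
      rw [Bundle.contMDiffAt_totalSpace] at h
      exact h.1
    have hg := (g.contMDiff (e.symm (WithLp.toLp 2 x))).comp x hb
    have h := ContMDiffAt.clm_bundle_apply₂ (F₁ := EuclideanSpace ℝ (Fin n))
      (F₂ := EuclideanSpace ℝ (Fin n)) (F₃ := ℝ)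
      (E₁ := fun p : M => TangentSpace 𝓘(ℝ, EuclideanSpace ℝ (Fin n)) p)
      (E₂ := fun p : M => TangentSpace 𝓘(ℝ, EuclideanSpace ℝ (Fin n)) p)
      (E₃ := Bundle.Trivial M ℝ)
      hg (contMDiffAt_coordVec he i hx) (contMDiffAt_coordVec he j hx)
    rw [Bundle.contMDiffAt_totalSpace] at h
    exact h.2.contDiffAt.contDiffWithinAt

end Chart

/-! ### Multilinear forms of the coordinate expressions -/

section Coordinates

variable {ι : Type} [Fintype ι]

/-- The bilinear form with matrix `A`. -/
def bilin (A : Matrix ι ι ℝ) (X Y : ι → ℝ) : ℝ := ∑ i, ∑ j, A i j * X i * Y j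

/-- The Christoffel symbols as a bilinear map. -/
def christoffelMap [DecidableEq ι] (m : (ι → ℝ) → Matrix ι ι ℝ) (x X Y : ι → ℝ) : ι → ℝ :=
  fun h => ∑ k, ∑ i, X k * christoffel m h k i x * Y i

/-- The derivative in the direction `u` of the Christoffel symbols, as a bilinear map. -/
def christoffelDeriv [DecidableEq ι] (m : (ι → ℝ) → Matrix ι ι ℝ) (x u X Y : ι → ℝ) : ι → ℝ :=
  fun h => ∑ k, ∑ i, X k * fderiv ℝ (christoffel m h k i) x u * Y i

theorem bilin_add_left (A : Matrix ι ι ℝ) (X X' Y : ι → ℝ) :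
    bilin A (X + X') Y = bilin A X Y + bilin A X' Y := by
  simp only [bilin, Pi.add_apply, mul_add, add_mul, Finset.sum_add_distrib]

theorem bilin_smul_left (A : Matrix ι ι ℝ) (c : ℝ) (X Y : ι → ℝ) :
    bilin A (c • X) Y = c * bilin A X Y := by
  simp only [bilin, Pi.smul_apply, smul_eq_mul, Finset.mul_sum]
  exact Finset.sum_congr rfl fun i _ => Finset.sum_congr rfl fun j _ => by ring

theorem bilin_add_right (A : Matrix ι ι ℝ) (X Y Y' : ι → ℝ) :
    bilin A X (Y + Y') = bilin A X Y + bilin A X Y' := by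
  simp only [bilin, Pi.add_apply, mul_add, Finset.sum_add_distrib]

theorem bilin_smul_right (A : Matrix ι ι ℝ) (c : ℝ) (X Y : ι → ℝ) :
    bilin A X (c • Y) = c * bilin A X Y := by
  simp only [bilin, Pi.smul_apply, smul_eq_mul, Finset.mul_sum]
  exact Finset.sum_congr rfl fun i _ => Finset.sum_congr rfl fun j _ => by ring

theorem bilin_neg_left (A : Matrix ι ι ℝ) (X Y : ι → ℝ) : bilin A (-X) Y = -bilin A X Y := by
  rw [← neg_one_smul ℝ X, bilin_smul_left, neg_one_mul]

theorem bilin_neg_right (A : Matrix ι ι ℝ) (X Y : ι → ℝ) : bilin A X (-Y) = -bilin A X Y := by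
  rw [← neg_one_smul ℝ Y, bilin_smul_right, neg_one_mul]

theorem bilin_sub_left (A : Matrix ι ι ℝ) (X X' Y : ι → ℝ) :
    bilin A (X - X') Y = bilin A X Y - bilin A X' Y := by
  rw [sub_eq_add_neg, bilin_add_left, bilin_neg_left, sub_eq_add_neg]

theorem bilin_zero_left (A : Matrix ι ι ℝ) (Y : ι → ℝ) : bilin A 0 Y = 0 := by
  simp [bilin]

theorem bilin_zero_right (A : Matrix ι ι ℝ) (X : ι → ℝ) : bilin A X 0 = 0 := by
  simp [bilin]

theorem bilin_comm {A : Matrix ι ι ℝ} (hA : ∀ i j, A i j = A j i) (X Y : ι → ℝ) :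
    bilin A X Y = bilin A Y X := by
  rw [bilin, Finset.sum_comm]
  exact Finset.sum_congr rfl fun i _ => Finset.sum_congr rfl fun j _ => by rw [hA]; ring

theorem bilin_single [DecidableEq ι] (A : Matrix ι ι ℝ) (i j : ι) :
    bilin A (Pi.single i 1) (Pi.single j 1) = A i j := by
  rw [bilin, Finset.sum_eq_single i, Finset.sum_eq_single j] <;>
    simp +contextual [Pi.single_apply]

theorem bilin_mulVec_right (A B : Matrix ι ι ℝ) (X Y : ι → ℝ) :
    bilin A X (B *ᵥ Y) = bilin (A * B) X Y := by
  simp only [bilin, Matrix.mulVec, dotProduct, Matrix.mul_apply, Finset.mul_sum, Finset.sum_mul]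
  refine Finset.sum_congr rfl fun i _ => ?_
  rw [Finset.sum_comm]
  exact Finset.sum_congr rfl fun j _ => Finset.sum_congr rfl fun k _ => by ring

theorem bilin_mulVec_left (A B : Matrix ι ι ℝ) (X Y : ι → ℝ) :
    bilin A (B *ᵥ X) Y = bilin (Bᵀ * A) X Y := by
  simp only [bilin, Matrix.mulVec, dotProduct, Matrix.mul_apply, Finset.mul_sum, Finset.sum_mul,
    Matrix.transpose_apply]
  conv_rhs =>
    enter [2, k]
    rw [Finset.sum_comm]
  conv_rhs => rw [Finset.sum_comm]
  refine Finset.sum_congr rfl fun i _ => ?_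
  rw [Finset.sum_comm]
  exact Finset.sum_congr rfl fun j _ => Finset.sum_congr rfl fun k _ => by ring

variable [DecidableEq ι]

theorem christoffelMap_add_left (m : (ι → ℝ) → Matrix ι ι ℝ) (x X X' Y : ι → ℝ) :
    christoffelMap m x (X + X') Y = christoffelMap m x X Y + christoffelMap m x X' Y := by
  funext h
  simp only [christoffelMap, Pi.add_apply, add_mul, Finset.sum_add_distrib]

theorem christoffelMap_smul_left (m : (ι → ℝ) → Matrix ι ι ℝ) (c : ℝ) (x X Y : ι → ℝ) :
    christoffelMap m x (c • X) Y = c • christoffelMap m x X Y := by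
  funext h
  simp only [christoffelMap, Pi.smul_apply, smul_eq_mul, Finset.mul_sum]
  exact Finset.sum_congr rfl fun i _ => Finset.sum_congr rfl fun j _ => by ring

theorem christoffelMap_add_right (m : (ι → ℝ) → Matrix ι ι ℝ) (x X Y Y' : ι → ℝ) :
    christoffelMap m x X (Y + Y') = christoffelMap m x X Y + christoffelMap m x X Y' := by
  funext h
  simp only [christoffelMap, Pi.add_apply, mul_add, Finset.sum_add_distrib]

theorem christoffelMap_smul_right (m : (ι → ℝ) → Matrix ι ι ℝ) (c : ℝ) (x X Y : ι → ℝ) :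
    christoffelMap m x X (c • Y) = c • christoffelMap m x X Y := by
  funext h
  simp only [christoffelMap, Pi.smul_apply, smul_eq_mul, Finset.mul_sum]
  exact Finset.sum_congr rfl fun i _ => Finset.sum_congr rfl fun j _ => by ring

theorem christoffelMap_neg_left (m : (ι → ℝ) → Matrix ι ι ℝ) (x X Y : ι → ℝ) :
    christoffelMap m x (-X) Y = -christoffelMap m x X Y := by
  rw [← neg_one_smul ℝ X, christoffelMap_smul_left, neg_one_smul]

theorem christoffelMap_neg_right (m : (ι → ℝ) → Matrix ι ι ℝ) (x X Y : ι → ℝ) :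
    christoffelMap m x X (-Y) = -christoffelMap m x X Y := by
  rw [← neg_one_smul ℝ Y, christoffelMap_smul_right, neg_one_smul]

theorem christoffelMap_sub_left (m : (ι → ℝ) → Matrix ι ι ℝ) (x X X' Y : ι → ℝ) :
    christoffelMap m x (X - X') Y = christoffelMap m x X Y - christoffelMap m x X' Y := by
  rw [sub_eq_add_neg, christoffelMap_add_left, christoffelMap_neg_left, sub_eq_add_neg]

theorem fderiv_eq_sum_pd (f : (ι → ℝ) → ℝ) (x u : ι → ℝ) :
    fderiv ℝ f x u = ∑ k, u k * pd k f x := by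
  conv_lhs => rw [pi_eq_sum_univ' u]
  simp only [map_sum, map_smul, smul_eq_mul, pd]

/-! ### Symmetry of the Christoffel symbols and compatibility with the metric -/

section Symmetric

variable {m : (ι → ℝ) → Matrix ι ι ℝ} {x : ι → ℝ}

theorem fderiv_entry_comm {κ : Type} {m : (κ → ℝ) → Matrix κ κ ℝ} {x : κ → ℝ}
    (hm : ∀ᶠ w in nhds x, ∀ i j, m w i j = m w j i) (i j : κ) :
    fderiv ℝ (fun w => m w i j) x = fderiv ℝ (fun w => m w j i) x :=
  Filter.EventuallyEq.fderiv_eq (hm.mono fun _ h => h i j)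

theorem christoffel_comm (hm : ∀ᶠ w in nhds x, ∀ i j, m w i j = m w j i) (h i j : ι) :
    christoffel m h i j x = christoffel m h j i x := by
  simp only [christoffel, pd, fderiv_entry_comm hm i j]
  congr 1
  exact Finset.sum_congr rfl fun l _ => by ring

theorem christoffelMap_comm (hm : ∀ᶠ w in nhds x, ∀ i j, m w i j = m w j i) (X Y : ι → ℝ) :
    christoffelMap m x X Y = christoffelMap m x Y X := by
  funext h
  simp only [christoffelMap]
  rw [Finset.sum_comm]
  exact Finset.sum_congr rfl fun i _ => Finset.sum_congr rfl fun j _ => by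
    rw [christoffel_comm hm]; ring

theorem sum_mul_christoffel (hdet : (m x).det ≠ 0) (p i j : ι) :
    ∑ h, m x p h * christoffel m h i j x = (1 / 2) *
      (pd i (fun z => m z p j) x + pd j (fun z => m z p i) x - pd p (fun z => m z i j) x) := by
  have h1 : m x * (m x)⁻¹ = 1 := Matrix.mul_nonsing_inv _ hdet.isUnit
  have h2 : ∀ l, ∑ h, m x p h * (m x)⁻¹ h l = if p = l then 1 else 0 := fun l => by
    rw [← Matrix.mul_apply, h1, Matrix.one_apply]
  simp only [christoffel, Finset.mul_sum]
  rw [Finset.sum_comm]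
  have h3 : ∀ l, ∑ h, m x p h * (1 / 2 * ((m x)⁻¹ h l *
      (pd i (fun z => m z l j) x + pd j (fun z => m z l i) x - pd l (fun z => m z i j) x)))
      = (if p = l then 1 else 0) * (1 / 2 *
      (pd i (fun z => m z l j) x + pd j (fun z => m z l i) x - pd l (fun z => m z i j) x)) := by
    intro l
    rw [← h2, Finset.sum_mul]
    exact Finset.sum_congr rfl fun h _ => by ring
  simp only [h3, ite_mul, one_mul, zero_mul, Finset.sum_ite_eq, Finset.mem_univ, if_true]

/-- The Levi-Civita connection is compatible with the metric. -/
theorem pd_entry_eq (hdet : (m x).det ≠ 0) (hm : ∀ᶠ w in nhds x, ∀ i j, m w i j = m w j i)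
    (k i j : ι) :
    pd k (fun z => m z i j) x
      = ∑ h, (christoffel m h k i x * m x h j + m x i h * christoffel m h k j x) := by
  rw [Finset.sum_add_distrib, sum_mul_christoffel hdet]
  have h1 : ∀ h, christoffel m h k i x * m x h j = m x j h * christoffel m h k i x := fun h => by
    rw [hm.self_of_nhds h j, mul_comm]
  simp only [h1, sum_mul_christoffel hdet]
  simp only [pd, fderiv_entry_comm hm j i, fderiv_entry_comm hm k i, fderiv_entry_comm hm k j]
  ring

/-- The contracted form of `pd_entry_eq`, that is ∇m = 0. It serves twice: for the base metric in
`hasDerivAt_ip` and for G in `nordenJet`. -/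
theorem bilin_fderiv (hdet : (m x).det ≠ 0) (hm : ∀ᶠ w in nhds x, ∀ i j, m w i j = m w j i)
    (u X Y : ι → ℝ) :
    bilin (Matrix.of fun i j => fderiv ℝ (fun z => m z i j) x u) X Y
      = bilin (m x) (christoffelMap m x u X) Y + bilin (m x) X (christoffelMap m x u Y) := by
  simp only [bilin, Matrix.of_apply, fderiv_eq_sum_pd, pd_entry_eq hdet hm, christoffelMap,
    Finset.mul_sum, Finset.sum_mul, mul_add, add_mul, Finset.sum_add_distrib]
  congr 1
  · rw [Finset.sum_comm' (t' := Finset.univ) (s' := fun _ => Finset.univ) (by simp)]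
    conv_rhs => rw [Finset.sum_comm]
    refine Finset.sum_congr rfl fun j _ => ?_
    conv_rhs =>
      enter [2, h]
      rw [Finset.sum_comm]
    conv_rhs => rw [Finset.sum_comm]
    refine Finset.sum_congr rfl fun i _ => ?_
    rw [Finset.sum_comm]
    exact Finset.sum_congr rfl fun h _ => Finset.sum_congr rfl fun k _ => by ring
  · refine Finset.sum_congr rfl fun i _ => ?_
    conv_rhs =>
      enter [2, h]
      rw [Finset.sum_comm]
    conv_rhs => rw [Finset.sum_comm]
    refine Finset.sum_congr rfl fun j _ => ?_
    rw [Finset.sum_comm]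
    exact Finset.sum_congr rfl fun h _ => Finset.sum_congr rfl fun k _ => by ring

end Symmetric

/-- The curvature tensor field as a trilinear map: `R(U, V) Y`. -/
theorem sum_curvature (m : (ι → ℝ) → Matrix ι ι ℝ) (x U V Y : ι → ℝ) (h : ι) :
    ∑ k, ∑ i, ∑ j, curvature m h k i j x * Y k * U i * V j
      = (christoffelDeriv m x U V Y - christoffelDeriv m x V U Y
        + christoffelMap m x U (christoffelMap m x V Y)
        - christoffelMap m x V (christoffelMap m x U Y)) h := by
  have h1 : ∀ U V : ι → ℝ, christoffelDeriv m x U V Y h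
      = ∑ k, ∑ i, ∑ j, pd i (christoffel m h j k) x * Y k * U i * V j := by
    intro U V
    simp only [christoffelDeriv, fderiv_eq_sum_pd, Finset.mul_sum, Finset.sum_mul]
    rw [Finset.sum_comm]
    refine Finset.sum_congr rfl fun k _ => ?_
    rw [Finset.sum_comm]
    exact Finset.sum_congr rfl fun i _ => Finset.sum_congr rfl fun j _ => by ring
  have h2 : ∀ U V : ι → ℝ, christoffelMap m x U (christoffelMap m x V Y) h
      = ∑ k, ∑ i, ∑ j, (∑ l, christoffel m h i l x * christoffel m l j k x)
        * Y k * U i * V j := by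
    intro U V
    simp only [christoffelMap, Finset.mul_sum, Finset.sum_mul]
    conv_rhs => rw [Finset.sum_comm]
    refine Finset.sum_congr rfl fun i _ => ?_
    conv_rhs => rw [Finset.sum_comm]
    conv_rhs =>
      enter [2, j]
      rw [Finset.sum_comm]
    conv_rhs => rw [Finset.sum_comm]
    refine Finset.sum_congr rfl fun l _ => ?_
    exact Finset.sum_congr rfl fun j _ => Finset.sum_congr rfl fun k _ => by ring
  simp only [Pi.add_apply, Pi.sub_apply]
  have h3 : ∀ F : ι → ι → ι → ℝ, (∑ k, ∑ i, ∑ j, F k i j * Y k * V i * U j)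
      = ∑ k, ∑ i, ∑ j, F k j i * Y k * U i * V j := by
    intro F
    refine Finset.sum_congr rfl fun k _ => ?_
    rw [Finset.sum_comm]
    exact Finset.sum_congr rfl fun i _ => Finset.sum_congr rfl fun j _ => by ring
  rw [h1 U V, h1 V U, h2 U V, h2 V U, h3, h3]
  simp only [← Finset.sum_sub_distrib, ← Finset.sum_add_distrib]
  refine Finset.sum_congr rfl fun k _ => Finset.sum_congr rfl fun i _ =>
    Finset.sum_congr rfl fun j _ => ?_
  simp only [curvature, Finset.sum_sub_distrib]
  ring

end Coordinates

/-! ### Derivatives along lines in an induced chart -/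

section Lines

variable {n : ℕ} {m : (Fin n → ℝ) → Matrix (Fin n) (Fin n) ℝ} {U : Set (Fin n → ℝ)}

theorem ip_eq_bilin (m : (Fin n → ℝ) → Matrix (Fin n) (Fin n) ℝ) (x X Y : Fin n → ℝ) :
    ip m x X Y = bilin (m x) X Y := rfl

theorem gammaY_eq (m : (Fin n → ℝ) → Matrix (Fin n) (Fin n) ℝ) (z : Fin n ⊕ Fin n → ℝ)
    (X : Fin n → ℝ) : gammaY m z X = christoffelMap m (basePt z) (fibrePt z) X := rfl

namespace IsMetricOn

theorem eventually_symm (hm : IsMetricOn m U) {x : Fin n → ℝ} (hx : x ∈ U) :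
    ∀ᶠ w in nhds x, ∀ i j, m w i j = m w j i := by
  filter_upwards [hm.isOpen.mem_nhds hx] with w hw using hm.symm w hw

theorem det_ne_zero (hm : IsMetricOn m U) {x : Fin n → ℝ} (hx : x ∈ U) : (m x).det ≠ 0 := by
  intro h
  obtain ⟨v, hv, hmv⟩ := Matrix.exists_mulVec_eq_zero_iff.mpr h
  have h1 := hm.pos x hx v hv
  have h2 : ip m x v v = v ⬝ᵥ (m x *ᵥ v) := by
    simp only [ip, dotProduct, Matrix.mulVec, Finset.mul_sum]
    exact Finset.sum_congr rfl fun i _ => Finset.sum_congr rfl fun j _ => by ring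
  rw [h2, hmv] at h1
  simp at h1

theorem contDiffAt_entry (hm : IsMetricOn m U) {x : Fin n → ℝ} (hx : x ∈ U) (i j : Fin n) :
    ContDiffAt ℝ ∞ (fun x => m x i j) x :=
  (hm.smooth i j).contDiffAt (hm.isOpen.mem_nhds hx)

theorem contDiffAt_pd {f : (Fin n → ℝ) → ℝ} {x : Fin n → ℝ} (hf : ContDiffAt ℝ ∞ f x)
    (i : Fin n) : ContDiffAt ℝ ∞ (pd i f) x :=
  (hf.fderiv_right (m := ∞) (by simp)).clm_apply contDiffAt_const

theorem contDiffAt_det {A : (Fin n → ℝ) → Matrix (Fin n) (Fin n) ℝ} {x : Fin n → ℝ}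
    (hA : ∀ i j, ContDiffAt ℝ ∞ (fun x => A x i j) x) :
    ContDiffAt ℝ ∞ (fun x => (A x).det) x := by
  simp only [Matrix.det_apply]
  exact ContDiffAt.sum fun σ _ => (contDiffAt_prod fun i _ => hA _ _).const_smul _

theorem contDiffAt_inv (hm : IsMetricOn m U) {x : Fin n → ℝ} (hx : x ∈ U) (i j : Fin n) :
    ContDiffAt ℝ ∞ (fun x => (m x)⁻¹ i j) x := by
  simp only [Matrix.inv_def, Ring.inverse_eq_inv', Matrix.smul_apply, Matrix.adjugate_apply,
    smul_eq_mul]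
  refine ((contDiffAt_det (hm.contDiffAt_entry hx)).inv (hm.det_ne_zero hx)).mul
    (contDiffAt_det fun k l => ?_)
  simp only [Matrix.updateRow_apply]
  split_ifs
  · exact contDiffAt_const
  · exact hm.contDiffAt_entry hx k l

theorem contDiffAt_christoffel (hm : IsMetricOn m U) {x : Fin n → ℝ} (hx : x ∈ U)
    (h i j : Fin n) : ContDiffAt ℝ ∞ (christoffel m h i j) x := by
  unfold christoffel
  refine contDiffAt_const.mul (ContDiffAt.sum fun l _ => (hm.contDiffAt_inv hx h l).mul ?_)
  exact ((contDiffAt_pd (hm.contDiffAt_entry hx l j) i).add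
    (contDiffAt_pd (hm.contDiffAt_entry hx l i) j)).sub
    (contDiffAt_pd (hm.contDiffAt_entry hx i j) l)

theorem ip_comm (hm : IsMetricOn m U) {x : Fin n → ℝ} (hx : x ∈ U) (X Y : Fin n → ℝ) :
    ip m x X Y = ip m x Y X :=
  bilin_comm (hm.symm x hx) X Y

theorem gamma_comm (hm : IsMetricOn m U) {x : Fin n → ℝ} (hx : x ∈ U) (X Y : Fin n → ℝ) :
    christoffelMap m x X Y = christoffelMap m x Y X :=
  christoffelMap_comm (hm.eventually_symm hx) X Y

theorem ip_self_nonneg (hm : IsMetricOn m U) {x : Fin n → ℝ} (hx : x ∈ U) (X : Fin n → ℝ) :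
    0 ≤ ip m x X X := by
  rcases eq_or_ne X 0 with rfl | h
  · simp [ip]
  · exact (hm.pos x hx X h).le

end IsMetricOn

theorem hasDerivAt_line (z w : Fin n ⊕ Fin n → ℝ) :
    HasDerivAt (fun s : ℝ => z + s • w) w 0 := by
  simpa using ((hasDerivAt_id (0 : ℝ)).smul_const w).const_add z

theorem hasDerivAt_basePt (z w : Fin n ⊕ Fin n → ℝ) :
    HasDerivAt (fun s : ℝ => basePt (z + s • w)) (horPart w) 0 :=
  hasDerivAt_pi.2 fun i => hasDerivAt_pi.1 (hasDerivAt_line z w) (Sum.inl i)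

theorem hasDerivAt_fibrePt (z w : Fin n ⊕ Fin n → ℝ) :
    HasDerivAt (fun s : ℝ => fibrePt (z + s • w)) (fibrePt w) 0 :=
  hasDerivAt_pi.2 fun i => hasDerivAt_pi.1 (hasDerivAt_line z w) (Sum.inr i)

/-- Equivalently, the vertical part of w is the covariant derivative of y along z + s w; this turns
coordinate derivatives into invariant ones. -/
theorem fibrePt_eq (m : (Fin n → ℝ) → Matrix (Fin n) (Fin n) ℝ) (z w : Fin n ⊕ Fin n → ℝ) :
    fibrePt w = vertPart m z w - christoffelMap m (basePt z) (fibrePt z) (horPart w) := by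
  funext h
  simp [fibrePt, vertPart, gammaY_eq]

theorem hasDerivAt_comp_basePt {f : (Fin n → ℝ) → ℝ} {z : Fin n ⊕ Fin n → ℝ}
    (hf : DifferentiableAt ℝ f (basePt z)) (w : Fin n ⊕ Fin n → ℝ) :
    HasDerivAt (fun s : ℝ => f (basePt (z + s • w))) (fderiv ℝ f (basePt z) (horPart w)) 0 := by
  have h := hasDerivAt_basePt z w
  have hf' : HasFDerivAt f (fderiv ℝ f (basePt z)) (basePt (z + (0 : ℝ) • w)) := by
    simpa using hf.hasFDerivAt
  exact hf'.comp_hasDerivAt (0 : ℝ) h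

variable {z : Fin n ⊕ Fin n → ℝ}

/-- Each argument is differentiated covariantly: compatibility of the connection absorbs the
derivative of the components of the metric. -/
theorem hasDerivAt_ip (hm : IsMetricOn m U) (hz : basePt z ∈ U) (w : Fin n ⊕ Fin n → ℝ)
    {X Y : ℝ → Fin n → ℝ} {X' Y' : Fin n → ℝ} (hX : HasDerivAt X X' 0) (hY : HasDerivAt Y Y' 0) :
    HasDerivAt (fun s => ip m (basePt (z + s • w)) (X s) (Y s))
      (ip m (basePt z) (christoffelMap m (basePt z) (horPart w) (X 0) + X') (Y 0)
        + ip m (basePt z) (X 0) (christoffelMap m (basePt z) (horPart w) (Y 0) + Y')) 0 := by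
  have h1 : HasDerivAt (fun s => ip m (basePt (z + s • w)) (X s) (Y s))
      (∑ i, ∑ j, ((fderiv ℝ (fun x => m x i j) (basePt z) (horPart w) * X 0 i
        + m (basePt (z + (0 : ℝ) • w)) i j * X' i) * Y 0 j
        + m (basePt (z + (0 : ℝ) • w)) i j * X 0 i * Y' j)) 0 := by
    unfold ip
    refine HasDerivAt.fun_sum fun i _ => HasDerivAt.fun_sum fun j _ => ?_
    exact ((hasDerivAt_comp_basePt ((hm.contDiffAt_entry hz i j).differentiableAt (by simp)) w).mul
      (hasDerivAt_pi.1 hX i)).mul (hasDerivAt_pi.1 hY j)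
  refine h1.congr_deriv ?_
  have h2 := bilin_fderiv (hm.det_ne_zero hz) (hm.eventually_symm hz) (horPart w) (X 0) (Y 0)
  simp only [ip_eq_bilin, bilin_add_left, bilin_add_right, zero_smul, add_zero]
  have h3 : ∀ a b c d : ℝ, a + b + (c + d) = (a + c) + b + d := fun a b c d => by ring
  rw [h3, ← h2]
  symm
  simp only [bilin, Matrix.of_apply, ← Finset.sum_add_distrib]
  exact Finset.sum_congr rfl fun i _ => Finset.sum_congr rfl fun j _ => by ring

theorem hasDerivAt_christoffelMap (hm : IsMetricOn m U) (hz : basePt z ∈ U)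
    (w : Fin n ⊕ Fin n → ℝ) {X Y : ℝ → Fin n → ℝ} {X' Y' : Fin n → ℝ} (hX : HasDerivAt X X' 0)
    (hY : HasDerivAt Y Y' 0) :
    HasDerivAt (fun s => christoffelMap m (basePt (z + s • w)) (X s) (Y s))
      (christoffelDeriv m (basePt z) (horPart w) (X 0) (Y 0)
        + christoffelMap m (basePt z) X' (Y 0) + christoffelMap m (basePt z) (X 0) Y') 0 := by
  refine hasDerivAt_pi.2 fun h => ?_
  have h1 : HasDerivAt (fun s => christoffelMap m (basePt (z + s • w)) (X s) (Y s) h)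
      (∑ k, ∑ i, ((X' k * christoffel m h k i (basePt (z + (0 : ℝ) • w))
        + X 0 k * fderiv ℝ (christoffel m h k i) (basePt z) (horPart w)) * Y 0 i
        + X 0 k * christoffel m h k i (basePt (z + (0 : ℝ) • w)) * Y' i)) 0 := by
    unfold christoffelMap
    refine HasDerivAt.fun_sum fun k _ => HasDerivAt.fun_sum fun i _ => ?_
    exact ((hasDerivAt_pi.1 hX k).mul (hasDerivAt_comp_basePt
      ((hm.contDiffAt_christoffel hz h k i).differentiableAt (by simp)) w)).mul
      (hasDerivAt_pi.1 hY i)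
  refine h1.congr_deriv ?_
  simp only [zero_smul, add_zero, Pi.add_apply, christoffelMap, christoffelDeriv,
    ← Finset.sum_add_distrib]
  exact Finset.sum_congr rfl fun i _ => Finset.sum_congr rfl fun j _ => by ring

theorem hasDerivAt_ip_fibrePt (hm : IsMetricOn m U) (hz : basePt z ∈ U)
    (w : Fin n ⊕ Fin n → ℝ) (X : Fin n → ℝ) :
    HasDerivAt (fun s : ℝ => ip m (basePt (z + s • w)) X (fibrePt (z + s • w)))
      (ip m (basePt z) (christoffelMap m (basePt z) (horPart w) X) (fibrePt z)
        + ip m (basePt z) X (vertPart m z w)) 0 := by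
  refine (hasDerivAt_ip hm hz w (hasDerivAt_const (0 : ℝ) X)
    (hasDerivAt_fibrePt z w)).congr_deriv ?_
  simp only [fibrePt_eq m z w, zero_smul, add_zero, hm.gamma_comm hz (horPart w) (fibrePt z),
    add_sub_cancel]

/-- Parallel transport preserves g(y, y), so only the vertical part of w changes t. -/
theorem hasDerivAt_energy (hm : IsMetricOn m U) (hz : basePt z ∈ U) (w : Fin n ⊕ Fin n → ℝ) :
    HasDerivAt (fun s : ℝ => energy m (z + s • w))
      (ip m (basePt z) (vertPart m z w) (fibrePt z)) 0 := by
  refine ((hasDerivAt_ip hm hz w (hasDerivAt_fibrePt z w)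
    (hasDerivAt_fibrePt z w)).const_mul (1 / 2)).congr_deriv ?_
  simp only [fibrePt_eq m z w, zero_smul, add_zero, hm.gamma_comm hz (horPart w) (fibrePt z),
    add_sub_cancel]
  rw [hm.ip_comm hz (fibrePt z)]
  ring

theorem energy_nonneg (hm : IsMetricOn m U) (hz : basePt z ∈ U) : 0 ≤ energy m z :=
  mul_nonneg (by norm_num) (hm.ip_self_nonneg hz _)

theorem continuous_basePt : Continuous (basePt : (Fin n ⊕ Fin n → ℝ) → Fin n → ℝ) :=
  continuous_pi fun _ => continuous_apply _

theorem eventually_basePt_mem (hm : IsMetricOn m U) (hz : basePt z ∈ U) :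
    ∀ᶠ w in nhds z, basePt w ∈ U :=
  continuous_basePt.continuousAt.eventually_mem (hm.isOpen.mem_nhds hz)

theorem SmoothCoeff.hasDerivWithinAt {f : ℝ → ℝ} (hf : SmoothCoeff f) {t : ℝ} (ht : 0 ≤ t) :
    HasDerivWithinAt f (der f t) (Set.Ici 0) t :=
  ((hf t ht).differentiableWithinAt (by simp)).hasDerivWithinAt

theorem SmoothCoeff.der {f : ℝ → ℝ} (hf : SmoothCoeff f) : SmoothCoeff (der f) :=
  ContDiffOn.derivWithin hf (uniqueDiffOn_Ici 0) (by simp)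

/-- The coefficients are differentiable at 0 only from the right. This is enough for the chain rule
because the energy is nonnegative near z. -/
theorem hasDerivAt_coeff (hm : IsMetricOn m U) (hz : basePt z ∈ U) (w : Fin n ⊕ Fin n → ℝ)
    {f : ℝ → ℝ} (hf : SmoothCoeff f) :
    HasDerivAt (fun s : ℝ => f (energy m (z + s • w)))
      (der f (energy m z) * ip m (basePt z) (vertPart m z w) (fibrePt z)) 0 := by
  have h0 : energy m (z + (0 : ℝ) • w) = energy m z := by simp
  have h1 : HasDerivWithinAt f (NaturalLift.der f (energy m z)) (Set.Ici 0)
      (energy m (z + (0 : ℝ) • w)) := by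
    rw [h0]; exact hf.hasDerivWithinAt (energy_nonneg hm hz)
  refine h1.comp_hasDerivAt 0 (hasDerivAt_energy hm hz w) ?_
  have h2 : Filter.Tendsto (fun s : ℝ => z + s • w) (nhds 0) (nhds z) := by
    have := (hasDerivAt_line z w).continuousAt.tendsto
    simpa using this
  filter_upwards [h2.eventually (eventually_basePt_mem hm hz)] with s hs
  exact energy_nonneg hm hs

end Lines

/-! ### Natural tensors and their derivatives -/

section Natural

variable {n : ℕ} {m : (Fin n → ℝ) → Matrix (Fin n) (Fin n) ℝ} {U : Set (Fin n → ℝ)}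
  {z : Fin n ⊕ Fin n → ℝ}

/-- The endomorphism `X ↦ a(t) X + b(t) g(X, y) y`. -/
def natEndo (m : (Fin n → ℝ) → Matrix (Fin n) (Fin n) ℝ) (a b : ℝ → ℝ)
    (z : Fin n ⊕ Fin n → ℝ) (X : Fin n → ℝ) : Fin n → ℝ :=
  a (energy m z) • X + (b (energy m z) * ip m (basePt z) X (fibrePt z)) • fibrePt z

/-- The derivative of `natEndo` along the fibre in the direction `V`. -/
def natEndoDeriv (m : (Fin n → ℝ) → Matrix (Fin n) (Fin n) ℝ) (a b : ℝ → ℝ)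
    (z : Fin n ⊕ Fin n → ℝ) (V X : Fin n → ℝ) : Fin n → ℝ :=
  (der a (energy m z) * ip m (basePt z) V (fibrePt z)) • X
    + (der b (energy m z) * ip m (basePt z) V (fibrePt z) * ip m (basePt z) X (fibrePt z)
      + b (energy m z) * ip m (basePt z) X V) • fibrePt z
    + (b (energy m z) * ip m (basePt z) X (fibrePt z)) • V

/-- The bilinear form `c(t) g(X, Y) + d(t) g(X, y) g(Y, y)`. -/
def natForm (m : (Fin n → ℝ) → Matrix (Fin n) (Fin n) ℝ) (c d : ℝ → ℝ)
    (z : Fin n ⊕ Fin n → ℝ) (X Y : Fin n → ℝ) : ℝ :=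
  c (energy m z) * ip m (basePt z) X Y
    + d (energy m z) * ip m (basePt z) X (fibrePt z) * ip m (basePt z) Y (fibrePt z)

/-- The derivative of `natForm` along the fibre in the direction `V`. -/
def natFormDeriv (m : (Fin n → ℝ) → Matrix (Fin n) (Fin n) ℝ) (c d : ℝ → ℝ)
    (z : Fin n ⊕ Fin n → ℝ) (V X Y : Fin n → ℝ) : ℝ :=
  der c (energy m z) * ip m (basePt z) V (fibrePt z) * ip m (basePt z) X Y
    + der d (energy m z) * ip m (basePt z) V (fibrePt z) * ip m (basePt z) X (fibrePt z)
      * ip m (basePt z) Y (fibrePt z)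
    + d (energy m z) * (ip m (basePt z) X V * ip m (basePt z) Y (fibrePt z)
      + ip m (basePt z) X (fibrePt z) * ip m (basePt z) Y V)

section Linear

variable (m) (x : Fin n → ℝ)

theorem ip_add_left (X X' Y : Fin n → ℝ) : ip m x (X + X') Y = ip m x X Y + ip m x X' Y :=
  bilin_add_left _ _ _ _

theorem ip_add_right (X Y Y' : Fin n → ℝ) : ip m x X (Y + Y') = ip m x X Y + ip m x X Y' :=
  bilin_add_right _ _ _ _

theorem ip_sub_left (X X' Y : Fin n → ℝ) : ip m x (X - X') Y = ip m x X Y - ip m x X' Y :=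
  bilin_sub_left _ _ _ _

theorem ip_smul_left (c : ℝ) (X Y : Fin n → ℝ) : ip m x (c • X) Y = c * ip m x X Y :=
  bilin_smul_left _ _ _ _

theorem ip_smul_right (c : ℝ) (X Y : Fin n → ℝ) : ip m x X (c • Y) = c * ip m x X Y :=
  bilin_smul_right _ _ _ _

theorem ip_neg_left (X Y : Fin n → ℝ) : ip m x (-X) Y = -ip m x X Y :=
  bilin_neg_left _ _ _

theorem ip_neg_right (X Y : Fin n → ℝ) : ip m x X (-Y) = -ip m x X Y :=
  bilin_neg_right _ _ _

theorem ip_zero_left (Y : Fin n → ℝ) : ip m x 0 Y = 0 := bilin_zero_left _ _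

theorem ip_zero_right (X : Fin n → ℝ) : ip m x X 0 = 0 := bilin_zero_right _ _

end Linear

theorem ip_fibrePt_self (m : (Fin n → ℝ) → Matrix (Fin n) (Fin n) ℝ)
    (z : Fin n ⊕ Fin n → ℝ) :
    ip m (basePt z) (fibrePt z) (fibrePt z) = 2 * energy m z := by
  simp only [energy]; ring

theorem natEndo_add (a b : ℝ → ℝ) (X Y : Fin n → ℝ) :
    natEndo m a b z (X + Y) = natEndo m a b z X + natEndo m a b z Y := by
  simp only [natEndo, ip_add_left]; module

theorem natEndo_smul (a b : ℝ → ℝ) (c : ℝ) (X : Fin n → ℝ) :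
    natEndo m a b z (c • X) = c • natEndo m a b z X := by
  simp only [natEndo, ip_smul_left]; module

theorem natEndo_neg (a b : ℝ → ℝ) (X : Fin n → ℝ) :
    natEndo m a b z (-X) = -natEndo m a b z X := by
  simp only [natEndo, ip_neg_left]; module

theorem natEndo_sub (a b : ℝ → ℝ) (X Y : Fin n → ℝ) :
    natEndo m a b z (X - Y) = natEndo m a b z X - natEndo m a b z Y := by
  simp only [natEndo, ip_sub_left]; module

theorem natEndo_zero (a b : ℝ → ℝ) : natEndo m a b z 0 = 0 := by
  simp [natEndo, ip_zero_left]

/-- Natural tensors are parallel in horizontal directions, so besides the fibre derivative only a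
commutator with the connection matrix appears. -/
theorem hasDerivAt_natEndo (hm : IsMetricOn m U) (hz : basePt z ∈ U) (w : Fin n ⊕ Fin n → ℝ)
    {a b : ℝ → ℝ} (ha : SmoothCoeff a) (hb : SmoothCoeff b) (X : Fin n → ℝ) :
    HasDerivAt (fun s : ℝ => natEndo m a b (z + s • w) X)
      (natEndoDeriv m a b z (vertPart m z w) X
        + (natEndo m a b z (christoffelMap m (basePt z) (horPart w) X)
          - christoffelMap m (basePt z) (horPart w) (natEndo m a b z X))) 0 := by
  unfold natEndo
  refine (((hasDerivAt_coeff hm hz w ha).smul_const X).add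
    (((hasDerivAt_coeff hm hz w hb).mul (hasDerivAt_ip_fibrePt hm hz w X)).smul
      (hasDerivAt_fibrePt z w))).congr_deriv ?_
  simp only [fibrePt_eq m z w, zero_smul, add_zero, natEndoDeriv, Pi.mul_apply, christoffelMap_add_right,
    christoffelMap_smul_right, hm.gamma_comm hz (horPart w) (fibrePt z)]
  module

theorem hasDerivAt_natForm (hm : IsMetricOn m U) (hz : basePt z ∈ U) (w : Fin n ⊕ Fin n → ℝ)
    {c d : ℝ → ℝ} (hc : SmoothCoeff c) (hd : SmoothCoeff d) (X Y : Fin n → ℝ) :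
    HasDerivAt (fun s : ℝ => natForm m c d (z + s • w) X Y)
      (natFormDeriv m c d z (vertPart m z w) X Y
        + (natForm m c d z (christoffelMap m (basePt z) (horPart w) X) Y
          + natForm m c d z X (christoffelMap m (basePt z) (horPart w) Y))) 0 := by
  unfold natForm
  refine (((hasDerivAt_coeff hm hz w hc).mul (hasDerivAt_ip hm hz w (hasDerivAt_const (0 : ℝ) X)
    (hasDerivAt_const (0 : ℝ) Y))).add (((hasDerivAt_coeff hm hz w hd).mul
      (hasDerivAt_ip_fibrePt hm hz w X)).mul (hasDerivAt_ip_fibrePt hm hz w Y))).congr_deriv ?_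
  simp only [zero_smul, add_zero, natFormDeriv, Pi.mul_apply]
  ring

/-! ### Horizontal and vertical parts -/

theorem horPart_horLift (X : Fin n → ℝ) : horPart (horLift m z X) = X := rfl

theorem horPart_vertLift (X : Fin n → ℝ) : horPart (vertLift X) = 0 := rfl

theorem horPart_add (v w : Fin n ⊕ Fin n → ℝ) : horPart (v + w) = horPart v + horPart w := rfl

theorem horPart_sub (v w : Fin n ⊕ Fin n → ℝ) : horPart (v - w) = horPart v - horPart w := rfl

theorem horPart_smul (c : ℝ) (v : Fin n ⊕ Fin n → ℝ) : horPart (c • v) = c • horPart v := rfl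

theorem vertPart_eq (m : (Fin n → ℝ) → Matrix (Fin n) (Fin n) ℝ) (z w : Fin n ⊕ Fin n → ℝ) :
    vertPart m z w
      = fibrePt w + christoffelMap m (basePt z) (fibrePt z) (horPart w) := rfl

theorem vertPart_add (v w : Fin n ⊕ Fin n → ℝ) :
    vertPart m z (v + w) = vertPart m z v + vertPart m z w := by
  simp only [vertPart_eq, horPart_add, christoffelMap_add_right]
  rw [show fibrePt (v + w) = fibrePt v + fibrePt w from rfl]
  abel

theorem vertPart_smul (c : ℝ) (v : Fin n ⊕ Fin n → ℝ) :
    vertPart m z (c • v) = c • vertPart m z v := by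
  simp only [vertPart_eq, horPart_smul, christoffelMap_smul_right]
  rw [show fibrePt (c • v) = c • fibrePt v from rfl, smul_add]

theorem vertPart_sub (v w : Fin n ⊕ Fin n → ℝ) :
    vertPart m z (v - w) = vertPart m z v - vertPart m z w := by
  rw [sub_eq_add_neg, ← neg_one_smul ℝ w, vertPart_add, vertPart_smul]
  module

theorem vertPart_vertLift (X : Fin n → ℝ) : vertPart m z (vertLift X) = X := by
  funext h
  simp [vertPart_eq, horPart, christoffelMap, fibrePt, vertLift]

theorem vertPart_horLift (X : Fin n → ℝ) : vertPart m z (horLift m z X) = 0 := by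
  funext h
  simp [vertPart_eq, horPart, christoffelMap, gammaY_eq, fibrePt, horLift]

theorem ext_parts (m : (Fin n → ℝ) → Matrix (Fin n) (Fin n) ℝ) (z : Fin n ⊕ Fin n → ℝ)
    {v w : Fin n ⊕ Fin n → ℝ} (h1 : horPart v = horPart w)
    (h2 : vertPart m z v = vertPart m z w) : v = w := by
  rw [← horLift_add_vertLift m z v, ← horLift_add_vertLift m z w, h1, h2]

/-- The horizontal space itself varies with the point. The resulting `christoffelDeriv` term is the
source of the curvature of the base in the Nijenhuis tensor. -/
theorem hasDerivAt_lifts (hm : IsMetricOn m U) (hz : basePt z ∈ U) (w : Fin n ⊕ Fin n → ℝ)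
    {X Y : ℝ → Fin n → ℝ} {X' Y' : Fin n → ℝ} (hX : HasDerivAt X X' 0) (hY : HasDerivAt Y Y' 0) :
    HasDerivAt (fun s : ℝ => horLift m (z + s • w) (X s) + vertLift (Y s))
      (horLift m z X' + vertLift (Y' - christoffelDeriv m (basePt z) (horPart w) (fibrePt z) (X 0)
        - christoffelMap m (basePt z) (vertPart m z w
          - christoffelMap m (basePt z) (fibrePt z) (horPart w)) (X 0))) 0 := by
  rw [← fibrePt_eq]
  have h := hasDerivAt_christoffelMap hm hz w (hasDerivAt_fibrePt z w) hX
  simp only [zero_smul, add_zero] at h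
  refine hasDerivAt_pi.2 fun r => ?_
  rcases r with i | i
  · simpa [horLift, vertLift] using hasDerivAt_pi.1 hX i
  · have h2 := (hasDerivAt_pi.1 h i).neg.add (hasDerivAt_pi.1 hY i)
    refine h2.congr_deriv ?_
    simp only [horLift, vertLift, gammaY_eq, Pi.add_apply, Pi.sub_apply, Sum.elim_inr]
    ring

theorem horPart_endoHor (A : EndoCoeffs) (X : Fin n → ℝ) :
    horPart (endoHor m A z X) = natEndo m A.a₄ A.b₄ z X := by
  simp [endoHor, horPart_add, horPart_smul, horPart_horLift, horPart_vertLift, natEndo]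

theorem vertPart_endoHor (A : EndoCoeffs) (X : Fin n → ℝ) :
    vertPart m z (endoHor m A z X) = natEndo m A.a₁ A.b₁ z X := by
  simp [endoHor, vertPart_add, vertPart_smul, vertPart_horLift, vertPart_vertLift, natEndo]

theorem horPart_endoVert (A : EndoCoeffs) (X : Fin n → ℝ) :
    horPart (endoVert m A z X) = -natEndo m A.a₂ A.b₂ z X := by
  simp [endoVert, horPart_add, horPart_sub, horPart_smul, horPart_horLift, horPart_vertLift,
    natEndo]
  module

theorem vertPart_endoVert (A : EndoCoeffs) (X : Fin n → ℝ) :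
    vertPart m z (endoVert m A z X) = natEndo m A.a₃ A.b₃ z X := by
  simp [endoVert, vertPart_add, vertPart_sub, vertPart_smul, vertPart_horLift, vertPart_vertLift,
    natEndo]

theorem endoHor_add (A : EndoCoeffs) (X Y : Fin n → ℝ) :
    endoHor m A z (X + Y) = endoHor m A z X + endoHor m A z Y := by
  apply ext_parts m z <;>
    simp only [horPart_add, vertPart_add, horPart_endoHor, vertPart_endoHor, natEndo_add]

theorem endoHor_smul (A : EndoCoeffs) (c : ℝ) (X : Fin n → ℝ) :
    endoHor m A z (c • X) = c • endoHor m A z X := by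
  apply ext_parts m z <;>
    simp only [horPart_smul, vertPart_smul, horPart_endoHor, vertPart_endoHor, natEndo_smul]

theorem endoVert_add (A : EndoCoeffs) (X Y : Fin n → ℝ) :
    endoVert m A z (X + Y) = endoVert m A z X + endoVert m A z Y := by
  apply ext_parts m z <;>
    simp only [horPart_add, vertPart_add, horPart_endoVert, vertPart_endoVert, natEndo_add,
      neg_add]

theorem endoVert_smul (A : EndoCoeffs) (c : ℝ) (X : Fin n → ℝ) :
    endoVert m A z (c • X) = c • endoVert m A z X := by
  apply ext_parts m z <;>
    simp only [horPart_smul, vertPart_smul, horPart_endoVert, vertPart_endoVert, natEndo_smul,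
      smul_neg]

theorem endoLift_mulVec (A : EndoCoeffs) (w : Fin n ⊕ Fin n → ℝ) :
    endoLift m A z *ᵥ w = endoHor m A z (horPart w) + endoVert m A z (vertPart m z w) := by
  let L : (Fin n ⊕ Fin n → ℝ) →ₗ[ℝ] (Fin n ⊕ Fin n → ℝ) :=
    { toFun := fun w => endoHor m A z (horPart w) + endoVert m A z (vertPart m z w)
      map_add' := fun v w => by
        simp only [horPart_add, vertPart_add, endoHor_add, endoVert_add]; abel
      map_smul' := fun c v => by
        simp only [horPart_smul, vertPart_smul, endoHor_smul, endoVert_smul, RingHom.id_apply,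
          smul_add] }
  have h : endoLift m A z = LinearMap.toMatrix' L := by
    ext r s
    rw [LinearMap.toMatrix'_apply]
    rfl
  rw [h, LinearMap.toMatrix'_mulVec]
  rfl

theorem horPart_endoLift_mulVec (A : EndoCoeffs) (w : Fin n ⊕ Fin n → ℝ) :
    horPart (endoLift m A z *ᵥ w)
      = natEndo m A.a₄ A.b₄ z (horPart w) - natEndo m A.a₂ A.b₂ z (vertPart m z w) := by
  rw [endoLift_mulVec, horPart_add, horPart_endoHor, horPart_endoVert, sub_eq_add_neg]

theorem vertPart_endoLift_mulVec (A : EndoCoeffs) (w : Fin n ⊕ Fin n → ℝ) :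
    vertPart m z (endoLift m A z *ᵥ w)
      = natEndo m A.a₁ A.b₁ z (horPart w) + natEndo m A.a₃ A.b₃ z (vertPart m z w) := by
  rw [endoLift_mulVec, vertPart_add, vertPart_endoHor, vertPart_endoVert]

theorem metricForm_eq (C : MetricCoeffs) (v w : Fin n ⊕ Fin n → ℝ) :
    metricForm m C z v w = natForm m C.c₁ C.d₁ z (horPart v) (horPart w)
      + natForm m C.c₂ C.d₂ z (vertPart m z v) (vertPart m z w)
      + natForm m C.c₃ C.d₃ z (vertPart m z v) (horPart w)
      + natForm m C.c₃ C.d₃ z (vertPart m z w) (horPart v) := rfl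

theorem natForm_add_left (c d : ℝ → ℝ) (X X' Y : Fin n → ℝ) :
    natForm m c d z (X + X') Y = natForm m c d z X Y + natForm m c d z X' Y := by
  simp only [natForm, ip_add_left]; ring

theorem natForm_smul_left (c d : ℝ → ℝ) (r : ℝ) (X Y : Fin n → ℝ) :
    natForm m c d z (r • X) Y = r * natForm m c d z X Y := by
  simp only [natForm, ip_smul_left]; ring

theorem natForm_add_right (c d : ℝ → ℝ) (X Y Y' : Fin n → ℝ) :
    natForm m c d z X (Y + Y') = natForm m c d z X Y + natForm m c d z X Y' := by
  simp only [natForm, ip_add_left, ip_add_right]; ring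

theorem natForm_smul_right (c d : ℝ → ℝ) (r : ℝ) (X Y : Fin n → ℝ) :
    natForm m c d z X (r • Y) = r * natForm m c d z X Y := by
  simp only [natForm, ip_smul_left, ip_smul_right]; ring

theorem natForm_comm (hm : IsMetricOn m U) (hz : basePt z ∈ U) (c d : ℝ → ℝ)
    (X Y : Fin n → ℝ) : natForm m c d z X Y = natForm m c d z Y X := by
  simp only [natForm, hm.ip_comm hz X Y]; ring

theorem bilin_metricLift (C : MetricCoeffs) (v w : Fin n ⊕ Fin n → ℝ) :
    bilin (metricLift m C z) v w = metricForm m C z v w := by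
  let B : (Fin n ⊕ Fin n → ℝ) →ₗ[ℝ] (Fin n ⊕ Fin n → ℝ) →ₗ[ℝ] ℝ :=
    LinearMap.mk₂ ℝ (metricForm m C z)
      (fun v v' w => by
        simp only [metricForm_eq, horPart_add, vertPart_add, natForm_add_left, natForm_add_right]
        ring)
      (fun c v w => by
        simp only [metricForm_eq, horPart_smul, vertPart_smul, natForm_smul_left,
          natForm_smul_right, smul_eq_mul]
        ring)
      (fun v w w' => by
        simp only [metricForm_eq, horPart_add, vertPart_add, natForm_add_left, natForm_add_right]
        ring)
      (fun c v w => by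
        simp only [metricForm_eq, horPart_smul, vertPart_smul, natForm_smul_left,
          natForm_smul_right, smul_eq_mul]
        ring)
  change _ = B v w
  conv_rhs => rw [pi_eq_sum_univ' v, pi_eq_sum_univ' w]
  simp only [map_sum, map_smul, LinearMap.sum_apply, LinearMap.smul_apply, smul_eq_mul,
    Finset.mul_sum, bilin]
  rw [Finset.sum_comm]
  refine Finset.sum_congr rfl fun i _ => Finset.sum_congr rfl fun j _ => ?_
  rw [show metricLift m C z j i = B (Pi.single j 1) (Pi.single i 1) from rfl]
  ring

theorem metricForm_comm (hm : IsMetricOn m U) (hz : basePt z ∈ U) (C : MetricCoeffs)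
    (v w : Fin n ⊕ Fin n → ℝ) : metricForm m C z v w = metricForm m C z w v := by
  simp only [metricForm_eq]
  rw [natForm_comm hm hz C.c₁ C.d₁, natForm_comm hm hz C.c₂ C.d₂]
  ring

end Natural

/-! ### Almost anti-Hermitian structures at a point

`D X Y` is the derivative of the endomorphism field `J` in the direction `X`, applied to `Y`;
`dB X` is the derivative of the metric `B` in the direction `X`; `Γ` is the bilinear map given by
the Christoffel symbols of `B`. -/

section Pointwise

variable {W : Type*} [AddCommGroup W] [Module ℝ W]

/-- The 1-jet of an almost complex structure at a point. -/
structure ComplexJet (J : W →ₗ[ℝ] W) (D : W →ₗ[ℝ] W →ₗ[ℝ] W) : Prop where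
  sq : ∀ X, J (J X) = -X
  deriv_sq : ∀ X Y, D X (J Y) = -J (D X Y)

/-- The 1-jet of an almost anti-Hermitian structure at a point. -/
structure NordenJet (J : W →ₗ[ℝ] W) (D : W →ₗ[ℝ] W →ₗ[ℝ] W) (B : W →ₗ[ℝ] W →ₗ[ℝ] ℝ)
    (dB : W →ₗ[ℝ] W →ₗ[ℝ] W →ₗ[ℝ] ℝ) (Γ : W →ₗ[ℝ] W →ₗ[ℝ] W) : Prop extends ComplexJet J D where
  symm : ∀ X Y, B X Y = B Y X
  nondeg : ∀ X, (∀ Y, B X Y = 0) → X = 0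
  selfAdjoint : ∀ X Y, B (J X) Y = B X (J Y)
  deriv_selfAdjoint : ∀ X Y Z, dB X (J Y) Z + B (D X Y) Z = dB X Y (J Z) + B Y (D X Z)
  torsion : ∀ X Y, Γ X Y = Γ Y X
  compat : ∀ X Y Z, dB X Y Z = B (Γ X Y) Z + B Y (Γ X Z)

/-- The Nijenhuis tensor. -/
def nijJet (J : W →ₗ[ℝ] W) (D : W →ₗ[ℝ] W →ₗ[ℝ] W) (X Y : W) : W :=
  D (J X) Y - D (J Y) X - J (D X Y - D Y X)

/-- The tensor `F(X, Y, Z) = G((∇_X J) Y, Z)`. -/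
def formJet (J : W →ₗ[ℝ] W) (D : W →ₗ[ℝ] W →ₗ[ℝ] W) (B : W →ₗ[ℝ] W →ₗ[ℝ] ℝ)
    (Γ : W →ₗ[ℝ] W →ₗ[ℝ] W) (X Y Z : W) : ℝ :=
  B (D X Y + Γ X (J Y) - J (Γ X Y)) Z

/-- The Tachibana operator applied to the metric:
`(JX) G(Y, Z) - X G(JY, Z) + G((L_Y J) X, Z) + G(Y, (L_Z J) X)`. -/
def tachibanaJet (J : W →ₗ[ℝ] W) (D : W →ₗ[ℝ] W →ₗ[ℝ] W) (B : W →ₗ[ℝ] W →ₗ[ℝ] ℝ)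
    (dB : W →ₗ[ℝ] W →ₗ[ℝ] W →ₗ[ℝ] ℝ) (X Y Z : W) : ℝ :=
  dB (J X) Y Z - (dB X (J Y) Z + B (D X Y) Z) + B (D Y X) Z + B Y (D Z X)

variable {J : W →ₗ[ℝ] W} {D : W →ₗ[ℝ] W →ₗ[ℝ] W} {B : W →ₗ[ℝ] W →ₗ[ℝ] ℝ}
  {dB : W →ₗ[ℝ] W →ₗ[ℝ] W →ₗ[ℝ] ℝ} {Γ : W →ₗ[ℝ] W →ₗ[ℝ] W}

theorem nijJet_swap (X Y : W) : nijJet J D X Y = -nijJet J D Y X := by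
  simp only [nijJet, map_sub]; abel

theorem nijJet_add_left (X X' Y : W) :
    nijJet J D (X + X') Y = nijJet J D X Y + nijJet J D X' Y := by
  simp only [nijJet, map_sub, map_add, LinearMap.add_apply]; abel

theorem nijJet_smul_left (c : ℝ) (X Y : W) : nijJet J D (c • X) Y = c • nijJet J D X Y := by
  simp only [nijJet, map_sub, map_smul, LinearMap.smul_apply, smul_sub]

/-- Differentiating J² = -1 shows that every `D X` anticommutes with `J`; this conjugate linearity
reduces the Nijenhuis tensor to a totally real subspace. -/
theorem ComplexJet.nijJet_left (h : ComplexJet J D) (X Y : W) :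
    nijJet J D (J X) Y = -J (nijJet J D X Y) := by
  simp only [nijJet, map_sub, h.sq, h.deriv_sq, map_neg, LinearMap.neg_apply]; abel

/-- The Nijenhuis tensor vanishes if it vanishes on `P`, where `P` and `J P` span. -/
theorem ComplexJet.nijJet_eq_zero (h : ComplexJet J D) {P : Set W}
    (hP : ∀ X, ∃ X₁ ∈ P, ∃ X₂ ∈ P, X = X₁ + J X₂)
    (hN : ∀ X ∈ P, ∀ Y ∈ P, nijJet J D X Y = 0) (X Y : W) : nijJet J D X Y = 0 := by
  have h1 : ∀ X, ∀ Y ∈ P, nijJet J D X Y = 0 := by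
    intro X Y hY
    obtain ⟨X₁, h₁, X₂, h₂, rfl⟩ := hP X
    rw [nijJet_add_left, h.nijJet_left, hN _ h₁ _ hY, hN _ h₂ _ hY, map_zero, neg_zero, add_zero]
  obtain ⟨Y₁, h₁, Y₂, h₂, rfl⟩ := hP Y
  rw [nijJet_swap, nijJet_add_left, h.nijJet_left, nijJet_swap Y₁, nijJet_swap Y₂,
    h1 _ _ h₁, h1 _ _ h₂]
  simp

namespace NordenJet

/-- The covariant derivative of a self-adjoint endomorphism field is self-adjoint. -/
theorem formJet_comm (h : NordenJet J D B dB Γ) (X Y Z : W) :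
    formJet J D B Γ X Y Z = formJet J D B Γ X Z Y := by
  have h1 := h.deriv_selfAdjoint X Y Z
  have h2 := h.selfAdjoint (Γ X Y) Z
  have h3 := h.selfAdjoint (Γ X Z) Y
  have h4 := h.selfAdjoint Y (Γ X Z)
  have h5 := h.symm Y (D X Z)
  have h6 := h.symm Y (Γ X (J Z))
  have h7 := h.symm (J Y) (Γ X Z)
  have h8 := h.symm (J (Γ X Z)) Y
  rw [h.compat, h.compat] at h1
  simp only [formJet, map_sub, map_add, LinearMap.sub_apply, LinearMap.add_apply]
  linarith

/-- The covariant derivative of J anticommutes with J, and J is self-adjoint. -/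
theorem formJet_J (h : NordenJet J D B dB Γ) (X Y Z : W) :
    formJet J D B Γ X (J Y) Z = -formJet J D B Γ X Y (J Z) := by
  simp only [formJet, h.sq, h.deriv_sq, map_neg, ← h.selfAdjoint, map_sub, map_add,
    LinearMap.sub_apply, LinearMap.add_apply, LinearMap.neg_apply]
  ring

/-- Since `Γ` is symmetric, the derivatives in the Nijenhuis tensor may be replaced by covariant
ones. -/
theorem nijJet_inner (h : NordenJet J D B dB Γ) (X Y Z : W) :
    B (nijJet J D X Y) Z = formJet J D B Γ (J X) Y Z - formJet J D B Γ X Y (J Z)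
      - (formJet J D B Γ (J Y) X Z - formJet J D B Γ Y X (J Z)) := by
  simp only [formJet, nijJet, h.sq, map_neg, ← h.selfAdjoint, map_sub, map_add,
    LinearMap.sub_apply, LinearMap.add_apply, LinearMap.neg_apply]
  rw [h.torsion (J X) Y, h.torsion (J Y) X, h.torsion Y X, h.torsion (J X) (J Y)]
  ring

/-- The Christoffel terms introduced by F cancel by symmetry and compatibility of `Γ`. Together with
`two_formJet_eq`, this lets F be studied without computing the Levi-Civita connection of G. -/
theorem tachibanaJet_eq (h : NordenJet J D B dB Γ) (X Y Z : W) :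
    tachibanaJet J D B dB X Y Z
      = -formJet J D B Γ X Y Z + formJet J D B Γ Y Z X + formJet J D B Γ Z X Y := by
  rw [h.formJet_comm Y Z X]
  simp only [formJet, tachibanaJet, h.compat, map_sub, map_add, LinearMap.sub_apply,
    LinearMap.add_apply, h.selfAdjoint (Γ _ _)]
  rw [h.torsion (J X) Y, h.torsion (J X) Z, h.torsion Y X, h.torsion Z X, h.symm Y (D Z X),
    h.symm Y (Γ Z (J X)), h.symm (J Y) (Γ X Z)]
  ring

theorem two_formJet_eq (h : NordenJet J D B dB Γ) (X Y Z : W) :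
    2 * formJet J D B Γ X Y Z = tachibanaJet J D B dB Y X Z + tachibanaJet J D B dB Z X Y := by
  rw [h.tachibanaJet_eq, h.tachibanaJet_eq, h.formJet_comm Z X Y, h.formJet_comm Y X Z,
    h.formJet_comm X Z Y]
  ring

/-- The conformally anti-Kähler condition with 1-form `n θ`, in terms of the Tachibana operator. -/
theorem formJet_iff_tachibanaJet (h : NordenJet J D B dB Γ) (θ : W →ₗ[ℝ] ℝ) :
    (∀ X Y Z, 2 * formJet J D B Γ X Y Z = B X (J Y) * θ (J Z) + B X (J Z) * θ (J Y)
      + B X Y * θ Z + B X Z * θ Y) ↔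
    ∀ X Y Z, tachibanaJet J D B dB X Y Z = B Y Z * θ X + B Y (J Z) * θ (J X) := by
  constructor
  · intro hF X Y Z
    have h1 := hF X Y Z
    have h2 := hF Y Z X
    have h3 := hF Z X Y
    have e1 := h.symm X Y
    have e2 := h.symm Y Z
    have e3 := h.symm Z X
    have f1 : B X (J Y) = B Y (J X) := by rw [← h.selfAdjoint, h.symm]
    have f2 : B Y (J Z) = B Z (J Y) := by rw [← h.selfAdjoint, h.symm]
    have f3 : B Z (J X) = B X (J Z) := by rw [← h.selfAdjoint, h.symm]
    rw [h.tachibanaJet_eq]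
    rw [e1, f1, ← e3, ← f3] at h1
    rw [← e2, ← f2] at h3
    linarith
  · intro hS X Y Z
    rw [h.two_formJet_eq, hS, hS]
    ring

/-- In `nijJet_inner` the terms of the prescribed F cancel in pairs, because both `B X Y` and `B X
(J Y)` are symmetric. -/
theorem nijJet_eq_zero_of_formJet (h : NordenJet J D B dB Γ) (θ : W →ₗ[ℝ] ℝ)
    (hF : ∀ X Y Z, 2 * formJet J D B Γ X Y Z = B X (J Y) * θ (J Z) + B X (J Z) * θ (J Y)
      + B X Y * θ Z + B X Z * θ Y) (X Y : W) : nijJet J D X Y = 0 := by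
  refine h.nondeg _ fun Z => ?_
  rw [h.nijJet_inner]
  have h1 := hF (J X) Y Z
  have h2 := hF X Y (J Z)
  have h3 := hF (J Y) X Z
  have h4 := hF Y X (J Z)
  simp only [h.selfAdjoint, h.sq, map_neg] at h1 h2 h3 h4
  have e1 := h.symm X Y
  have f1 : B X (J Y) = B Y (J X) := by rw [← h.selfAdjoint, h.symm]
  rw [e1, f1] at h1 h2
  linarith

/-- In general the two sides differ by -G(N(X, Y), Z). -/
theorem tachibanaJet_J (h : NordenJet J D B dB Γ) (hN : ∀ X Y, nijJet J D X Y = 0) (X Y Z : W) :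
    tachibanaJet J D B dB X (J Y) Z = -tachibanaJet J D B dB (J X) Y Z := by
  have h1 := h.nijJet_inner X Y Z
  rw [hN, map_zero, LinearMap.zero_apply] at h1
  rw [h.tachibanaJet_eq, h.tachibanaJet_eq, h.formJet_J X Y Z, h.formJet_J Z X Y,
    h.formJet_comm (J Y) Z X, h.formJet_comm Y Z (J X), h.formJet_J Y X Z]
  linarith

theorem tachibanaJet_comm (h : NordenJet J D B dB Γ) (X Y Z : W) :
    tachibanaJet J D B dB X Y Z = tachibanaJet J D B dB X Z Y := by
  rw [h.tachibanaJet_eq, h.tachibanaJet_eq, h.formJet_comm X Y Z, h.formJet_comm Y Z X,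
    h.formJet_comm Z X Y]
  ring

theorem tachibanaJet_add (X Y Y' Z : W) :
    tachibanaJet J D B dB X (Y + Y') Z
      = tachibanaJet J D B dB X Y Z + tachibanaJet J D B dB X Y' Z := by
  simp only [tachibanaJet, map_add, LinearMap.add_apply]; ring

theorem tachibanaJet_add_left (X X' Y Z : W) :
    tachibanaJet J D B dB (X + X') Y Z
      = tachibanaJet J D B dB X Y Z + tachibanaJet J D B dB X' Y Z := by
  simp only [tachibanaJet, map_add, LinearMap.add_apply]; ring

/-- In an integrable structure it suffices to know the Tachibana operator on a totally real
subspace. -/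
theorem tachibanaJet_eq_of_mem (h : NordenJet J D B dB Γ) (hN : ∀ X Y, nijJet J D X Y = 0)
    (θ : W →ₗ[ℝ] ℝ) {P : Set W} (hP : ∀ X, ∃ X₁ ∈ P, ∃ X₂ ∈ P, X = X₁ + J X₂)
    (hS : ∀ X, ∀ Y ∈ P, ∀ Z ∈ P,
      tachibanaJet J D B dB X Y Z = B Y Z * θ X + B Y (J Z) * θ (J X)) (X Y Z : W) :
    tachibanaJet J D B dB X Y Z = B Y Z * θ X + B Y (J Z) * θ (J X) := by
  have h1 : ∀ X, ∀ Y, ∀ Z ∈ P,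
      tachibanaJet J D B dB X Y Z = B Y Z * θ X + B Y (J Z) * θ (J X) := by
    intro X Y Z hZ
    obtain ⟨Y₁, h₁, Y₂, h₂, rfl⟩ := hP Y
    rw [tachibanaJet_add, h.tachibanaJet_J hN, hS _ _ h₁ _ hZ, hS _ _ h₂ _ hZ]
    simp only [map_add, LinearMap.add_apply, h.sq, map_neg, h.selfAdjoint]
    ring
  obtain ⟨Z₁, h₁, Z₂, h₂, rfl⟩ := hP Z
  rw [h.tachibanaJet_comm, tachibanaJet_add, h.tachibanaJet_J hN, h.tachibanaJet_comm X Z₁,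
    h.tachibanaJet_comm (J X) Z₂, h1 _ _ _ h₁, h1 _ _ _ h₂]
  simp only [map_add, h.sq, map_neg]
  ring

end NordenJet

end Pointwise

/-- Over ℂ the trace is the sum of the eigenvalues. Each eigenvalue has square -1, hence real part
0, while the trace is real. -/
theorem trace_eq_zero_of_sq_eq_neg_one {ι : Type} [Fintype ι] [DecidableEq ι] {A : Matrix ι ι ℝ}
    (hA : A * A = -1) : A.trace = 0 := by
  set A' : Matrix ι ι ℂ := A.map (algebraMap ℝ ℂ) with hA'
  have hsq : A' * A' = -1 := by
    rw [hA', ← Matrix.map_mul, hA]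
    ext i j
    simp [Matrix.one_apply, apply_ite]
  have h1 : A'.trace = (A.trace : ℂ) := by
    simp [hA', Matrix.trace]
  have h2 : A'.trace.re = 0 := by
    rw [Matrix.trace_eq_sum_roots_charpoly]
    have h3 : ∀ μ ∈ A'.charpoly.roots, μ.re = 0 := by
      intro μ hμ
      have h4 := Matrix.mem_spectrum_of_isRoot_charpoly (Polynomial.isRoot_of_mem_roots hμ)
      rw [← Matrix.spectrum_toLin', ← Module.End.hasEigenvalue_iff_mem_spectrum] at h4
      obtain ⟨v, hv⟩ := h4.exists_hasEigenvector
      have h5 : A' *ᵥ v = μ • v := by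
        rw [← Matrix.toLin'_apply]; exact hv.apply_eq_smul
      have h6 : (A' * A') *ᵥ v = (μ * μ) • v := by
        rw [← Matrix.mulVec_mulVec, h5, Matrix.mulVec_smul, h5, smul_smul]
      rw [hsq, Matrix.neg_mulVec, Matrix.one_mulVec] at h6
      have h7 : (μ * μ + 1) • v = 0 := by rw [add_smul, ← h6]; simp
      have h8 : μ * μ + 1 = 0 := (smul_eq_zero.1 h7).resolve_right hv.2
      have h9 := congrArg Complex.re h8
      have h10 := congrArg Complex.im h8
      simp at h9 h10
      by_contra h
      have : μ.im = 0 := by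
        have : μ.re * μ.im = 0 := by linarith
        exact (mul_eq_zero.1 this).resolve_left h
      rw [this] at h9
      nlinarith [mul_self_nonneg μ.re]
    generalize A'.charpoly.roots = s at h3
    induction s using Multiset.induction with
    | empty => simp
    | cons a s ih =>
      rw [Multiset.sum_cons, Complex.add_re, h3 a (Multiset.mem_cons_self a s),
        ih fun μ hμ => h3 μ (Multiset.mem_cons_of_mem hμ), add_zero]
  rw [h1] at h2
  exact h2

/-! ### From components to multilinear maps -/

section Coordinates

variable {ι : Type} [Fintype ι] [DecidableEq ι]

/-- The derivative of a matrix field in the direction `u`. -/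
def matDeriv (A : (ι → ℝ) → Matrix ι ι ℝ) (z u : ι → ℝ) : Matrix ι ι ℝ :=
  Matrix.of fun r s => fderiv ℝ (fun w => A w r s) z u

theorem matDeriv_add (A : (ι → ℝ) → Matrix ι ι ℝ) (z u v : ι → ℝ) :
    matDeriv A z (u + v) = matDeriv A z u + matDeriv A z v := by
  ext r s; simp [matDeriv]

theorem matDeriv_smul (A : (ι → ℝ) → Matrix ι ι ℝ) (z : ι → ℝ) (c : ℝ) (u : ι → ℝ) :
    matDeriv A z (c • u) = c • matDeriv A z u := by
  ext r s; simp [matDeriv]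

/-- The bilinear form of a matrix. -/
def bilinMap (A : Matrix ι ι ℝ) : (ι → ℝ) →ₗ[ℝ] (ι → ℝ) →ₗ[ℝ] ℝ :=
  LinearMap.mk₂ ℝ (bilin A) (bilin_add_left A) (bilin_smul_left A) (bilin_add_right A)
    (fun c X Y => bilin_smul_right A c X Y)

/-- The derivative of a field of endomorphisms. -/
def derivEndo (J : (ι → ℝ) → Matrix ι ι ℝ) (z : ι → ℝ) :
    (ι → ℝ) →ₗ[ℝ] (ι → ℝ) →ₗ[ℝ] (ι → ℝ) :=
  LinearMap.mk₂ ℝ (fun u X => matDeriv J z u *ᵥ X)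
    (fun u v X => by simp only [matDeriv_add, Matrix.add_mulVec])
    (fun c u X => by simp only [matDeriv_smul, Matrix.smul_mulVec])
    (fun u X Y => Matrix.mulVec_add _ _ _) (fun c u X => Matrix.mulVec_smul _ _ _)

/-- The derivative of a field of bilinear forms. -/
def derivForm (G : (ι → ℝ) → Matrix ι ι ℝ) (z : ι → ℝ) :
    (ι → ℝ) →ₗ[ℝ] (ι → ℝ) →ₗ[ℝ] (ι → ℝ) →ₗ[ℝ] ℝ where
  toFun u := bilinMap (matDeriv G z u)
  map_add' u v := by
    ext X Y
    simp [bilinMap, bilin, matDeriv, add_mul, Finset.sum_add_distrib]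
  map_smul' c u := by
    ext X Y
    simp [bilinMap, bilin, matDeriv, Finset.mul_sum, mul_assoc]

/-- The Christoffel symbols as a bilinear map. -/
def gammaMap (G : (ι → ℝ) → Matrix ι ι ℝ) (z : ι → ℝ) :
    (ι → ℝ) →ₗ[ℝ] (ι → ℝ) →ₗ[ℝ] (ι → ℝ) :=
  LinearMap.mk₂ ℝ (christoffelMap G z) (christoffelMap_add_left G z)
    (fun c X Y => christoffelMap_smul_left G c z X Y) (christoffelMap_add_right G z)
    (fun c X Y => christoffelMap_smul_right G c z X Y)

theorem hasDerivAt_mulVec {J : (ι → ℝ) → Matrix ι ι ℝ} {z : ι → ℝ}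
    (hJ : ∀ r s, DifferentiableAt ℝ (fun w => J w r s) z) (u X : ι → ℝ) :
    HasDerivAt (fun s : ℝ => J (z + s • u) *ᵥ X) (derivEndo J z u X) 0 := by
  have hl : HasDerivAt (fun s : ℝ => z + s • u) u 0 := by
    simpa using ((hasDerivAt_id (0 : ℝ)).smul_const u).const_add z
  refine hasDerivAt_pi.2 fun r => ?_
  simp only [Matrix.mulVec, dotProduct]
  refine (HasDerivAt.fun_sum (u := Finset.univ) (A := fun s t => J (z + t • u) r s * X s)
    (A' := fun s => fderiv ℝ (fun w => J w r s) z u * X s) fun s _ => ?_).congr_deriv ?_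
  · have h := (hJ r s).hasFDerivAt
    have h' : HasFDerivAt (fun w => J w r s) (fderiv ℝ (fun w => J w r s) z)
        (z + (0 : ℝ) • u) := by simpa using h
    exact (h'.comp_hasDerivAt (0 : ℝ) hl).mul_const _
  · simp [derivEndo, matDeriv, Matrix.mulVec, dotProduct]

theorem hasDerivAt_bilin {G : (ι → ℝ) → Matrix ι ι ℝ} {z : ι → ℝ}
    (hG : ∀ r s, DifferentiableAt ℝ (fun w => G w r s) z) (u X Y : ι → ℝ) :
    HasDerivAt (fun s : ℝ => bilin (G (z + s • u)) X Y) (derivForm G z u X Y) 0 := by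
  have hl : HasDerivAt (fun s : ℝ => z + s • u) u 0 := by
    simpa using ((hasDerivAt_id (0 : ℝ)).smul_const u).const_add z
  unfold bilin
  refine (HasDerivAt.fun_sum (u := Finset.univ)
    (A := fun r t => ∑ s, G (z + t • u) r s * X r * Y s)
    (A' := fun r => ∑ s, fderiv ℝ (fun w => G w r s) z u * X r * Y s) fun r _ =>
    HasDerivAt.fun_sum fun s _ => ?_).congr_deriv ?_
  · have h' : HasFDerivAt (fun w => G w r s) (fderiv ℝ (fun w => G w r s) z)
        (z + (0 : ℝ) • u) := by simpa using (hG r s).hasFDerivAt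
    exact ((h'.comp_hasDerivAt (0 : ℝ) hl).mul_const _).mul_const _
  · rfl

theorem matDeriv_mul {A B : (ι → ℝ) → Matrix ι ι ℝ} {z : ι → ℝ}
    (hA : ∀ r s, DifferentiableAt ℝ (fun w => A w r s) z)
    (hB : ∀ r s, DifferentiableAt ℝ (fun w => B w r s) z) (u : ι → ℝ) :
    matDeriv (fun w => A w * B w) z u = matDeriv A z u * B z + A z * matDeriv B z u := by
  ext r s
  simp only [matDeriv, Matrix.mul_apply, Matrix.add_apply, Matrix.of_apply]
  rw [fderiv_fun_sum (A := fun k w => A w r k * B w k s) fun k _ => (hA r k).fun_mul (hB k s),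
    sum_apply, ← Finset.sum_add_distrib]
  refine Finset.sum_congr rfl fun k _ => ?_
  rw [fderiv_fun_mul (hA r k) (hB k s)]
  simp only [_root_.add_apply, _root_.smul_apply, smul_eq_mul]
  ring

theorem matDeriv_congr {A B : (ι → ℝ) → Matrix ι ι ℝ} {z : ι → ℝ}
    (h : ∀ᶠ w in nhds z, A w = B w) (u : ι → ℝ) : matDeriv A z u = matDeriv B z u := by
  ext r s
  have h1 : (fun w => A w r s) =ᶠ[nhds z] fun w => B w r s := h.mono fun w hw => by
    simp only [hw]
  simp only [matDeriv, Matrix.of_apply, h1.fderiv_eq]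

/-! ### The component tensors expressed by the pointwise multilinear ones -/

section Jets

variable {J G : (ι → ℝ) → Matrix ι ι ℝ} {z : ι → ℝ}

theorem complexJet_of_sq (hJ : ∀ r s, DifferentiableAt ℝ (fun w => J w r s) z)
    (hsq : ∀ᶠ w in nhds z, J w * J w = -1) : ComplexJet (J z).mulVecLin (derivEndo J z) where
  sq X := by simp [Matrix.mulVec_mulVec, hsq.self_of_nhds, Matrix.neg_mulVec]
  deriv_sq u X := by
    have h1 := matDeriv_mul hJ hJ u
    rw [matDeriv_congr (B := fun _ => -1) hsq u] at h1
    have h2 : matDeriv (fun _ : ι → ℝ => (-1 : Matrix ι ι ℝ)) z u = 0 := by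
      ext r s; simp [matDeriv]
    rw [h2] at h1
    have h3 : matDeriv J z u * J z = -(J z * matDeriv J z u) := by
      rw [eq_neg_iff_add_eq_zero]; exact h1.symm
    simp only [derivEndo, LinearMap.mk₂_apply, Matrix.mulVecLin_apply, Matrix.mulVec_mulVec, h3,
      Matrix.neg_mulVec]

/-- The first-order relations are derivatives at z of the algebraic relations, which therefore have
to hold in a neighbourhood. -/
theorem nordenJet (hJ : ∀ r s, DifferentiableAt ℝ (fun w => J w r s) z)
    (hG : ∀ r s, DifferentiableAt ℝ (fun w => G w r s) z)
    (hsq : ∀ᶠ w in nhds z, J w * J w = -1) (hsymm : ∀ᶠ w in nhds z, ∀ r s, G w r s = G w s r)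
    (hdet : (G z).det ≠ 0) (hGJ : ∀ᶠ w in nhds z, (J w)ᵀ * G w * J w = -G w) :
    NordenJet (J z).mulVecLin (derivEndo J z) (bilinMap (G z)) (derivForm G z) (gammaMap G z) := by
  have hsa : ∀ᶠ w in nhds z, (J w)ᵀ * G w = G w * J w := by
    filter_upwards [hsq, hGJ] with w h1 h2
    have h3 := congrArg (fun A => -(A * J w)) h2
    simp only [Matrix.mul_assoc, h1, Matrix.mul_neg, Matrix.mul_one, neg_neg, Matrix.neg_mul] at h3
    exact h3
  have hsa' : ∀ᶠ w in nhds z, ∀ r s, (G w * J w) r s = (G w * J w) s r := by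
    filter_upwards [hsa, hsymm] with w h1 h2 r s
    have h3 : (G w)ᵀ = G w := by ext i j; exact h2 j i
    have h4 : (G w * J w)ᵀ = G w * J w := by rw [Matrix.transpose_mul, h3, h1]
    conv_lhs => rw [← h4]
    rfl
  refine { complexJet_of_sq hJ hsq with
    symm := bilin_comm hsymm.self_of_nhds
    nondeg := fun X hX => ?_
    selfAdjoint := fun X Y => ?_
    deriv_selfAdjoint := fun u Y Z => ?_
    torsion := christoffelMap_comm hsymm
    compat := bilin_fderiv hdet hsymm }
  · by_contra h
    have h1 : (G z) *ᵥ X = 0 := by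
      funext i
      have h2 := hX (Pi.single i 1)
      rw [bilinMap, LinearMap.mk₂_apply, bilin_comm hsymm.self_of_nhds] at h2
      rw [Pi.zero_apply, ← h2]
      simp only [bilin, Matrix.mulVec, dotProduct]
      symm
      refine (Finset.sum_eq_single i ?_ ?_).trans ?_ <;> simp +contextual
    exact hdet (Matrix.exists_mulVec_eq_zero_iff.1 ⟨X, h, h1⟩)
  · simp only [bilinMap, LinearMap.mk₂_apply, Matrix.mulVecLin_apply, bilin_mulVec_left,
      bilin_mulVec_right, hsa.self_of_nhds]
  -- The matrix G J is symmetric near z, hence so is its derivative; the product rule splits it into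
  -- the required four terms.
  · have h1 : ∀ r s, matDeriv (fun w => G w * J w) z u r s
        = matDeriv (fun w => G w * J w) z u s r := fun r s => by
      simp only [matDeriv, Matrix.of_apply]
      rw [fderiv_entry_comm (m := fun w => G w * J w) hsa' r s]
    have h2 := bilin_comm h1 Z Y
    rw [matDeriv_mul hG hJ] at h2
    have h3 : ∀ A B : Matrix ι ι ℝ, ∀ X Y, bilin (A + B) X Y = bilin A X Y + bilin B X Y := by
      intro A B X Y
      simp only [bilin, Matrix.add_apply, add_mul, Finset.sum_add_distrib]
    rw [h3, h3, ← bilin_mulVec_right, ← bilin_mulVec_right, ← bilin_mulVec_right,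
      ← bilin_mulVec_right] at h2
    have h4 : ∀ r s, matDeriv G z u r s = matDeriv G z u s r := fun r s => by
      simp only [matDeriv, Matrix.of_apply, fderiv_entry_comm hsymm r s]
    change bilin (matDeriv G z u) (J z *ᵥ Y) Z + bilin (G z) (matDeriv J z u *ᵥ Y) Z
      = bilin (matDeriv G z u) Y (J z *ᵥ Z) + bilin (G z) Y (matDeriv J z u *ᵥ Z)
    rw [bilin_comm h4 (J z *ᵥ Y), bilin_comm hsymm.self_of_nhds (matDeriv J z u *ᵥ Y)]
    exact h2

theorem nijenhuis_eq (h i j : ι) :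
    nijenhuis J h i j z
      = nijJet (J z).mulVecLin (derivEndo J z) (Pi.single i 1) (Pi.single j 1) h := by
  have h1 : ∀ i j : ι, (derivEndo J z ((J z).mulVecLin (Pi.single i 1)) (Pi.single j 1)) h
      = ∑ l, J z l i * pd l (fun w => J w h j) z := by
    intro i j
    simp only [derivEndo, LinearMap.mk₂_apply, Matrix.mulVecLin_apply, Matrix.mulVec_single_one,
      Matrix.col_apply, matDeriv, Matrix.of_apply, fderiv_eq_sum_pd]
  have h2 : ∀ i j l : ι, (derivEndo J z (Pi.single i 1) (Pi.single j 1)) l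
      = pd i (fun w => J w l j) z := by
    intro i j l
    simp only [derivEndo, LinearMap.mk₂_apply, Matrix.mulVec_single_one,
      Matrix.col_apply, matDeriv, Matrix.of_apply, pd]
  simp only [nijJet, Pi.sub_apply, h1]
  simp only [Matrix.mulVecLin_apply, Matrix.mulVec, dotProduct, Pi.sub_apply, h2, nijenhuis,
    Finset.sum_sub_distrib]

theorem nijenhuis_eq_zero_iff :
    (∀ h i j, nijenhuis J h i j z = 0) ↔
      ∀ X Y, nijJet (J z).mulVecLin (derivEndo J z) X Y = 0 := by
  constructor
  · intro H
    have h1 : ∀ X Y, nijJet (J z).mulVecLin (derivEndo J z) X Y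
        = ∑ i, X i • nijJet (J z).mulVecLin (derivEndo J z) (Pi.single i 1) Y := by
      intro X Y
      let L : (ι → ℝ) →ₗ[ℝ] (ι → ℝ) :=
        { toFun := fun X => nijJet (J z).mulVecLin (derivEndo J z) X Y
          map_add' := fun X X' => nijJet_add_left X X' Y
          map_smul' := fun c X => nijJet_smul_left c X Y }
      change L X = _
      conv_lhs => rw [pi_eq_sum_univ' X, map_sum]
      exact Finset.sum_congr rfl fun i _ => map_smul L _ _
    intro X Y
    rw [h1]
    refine Finset.sum_eq_zero fun i _ => ?_
    rw [nijJet_swap, h1]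
    have h2 : ∀ j, nijJet (J z).mulVecLin (derivEndo J z) (Pi.single j 1) (Pi.single i 1) = 0 := by
      intro j
      funext h
      rw [← nijenhuis_eq, H, Pi.zero_apply]
    simp [h2]
  · intro H h i j
    rw [nijenhuis_eq, H, Pi.zero_apply]

theorem tensorF_eq (i j k : ι) :
    tensorF G J i j k z = formJet (J z).mulVecLin (derivEndo J z) (bilinMap (G z)) (gammaMap G z)
      (Pi.single i 1) (Pi.single j 1) (Pi.single k 1) := by
  have h2 : ∀ h : ι, (derivEndo J z (Pi.single i 1) (Pi.single j 1)) h
      = pd i (fun w => J w h j) z := by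
    intro h
    simp only [derivEndo, LinearMap.mk₂_apply, Matrix.mulVec_single_one,
      Matrix.col_apply, matDeriv, Matrix.of_apply, pd]
  have h3 : ∀ (X : ι → ℝ) (h : ι), gammaMap G z (Pi.single i 1) X h
      = ∑ l, christoffel G h i l z * X l := by
    intro X h
    simp only [gammaMap, LinearMap.mk₂_apply, christoffelMap]
    rw [Finset.sum_eq_single i] <;> simp +contextual
  have h4 : ∀ h, covDerivEndo G J h i j z = (derivEndo J z (Pi.single i 1) (Pi.single j 1)
      + gammaMap G z (Pi.single i 1) ((J z).mulVecLin (Pi.single j 1))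
      - (J z).mulVecLin (gammaMap G z (Pi.single i 1) (Pi.single j 1))) h := by
    intro h
    simp only [Pi.sub_apply, Pi.add_apply, h2, h3, Matrix.mulVecLin_apply,
      Matrix.mulVec_single_one, Matrix.col_apply, covDerivEndo, Finset.sum_sub_distrib]
    rw [add_sub_assoc]
    congr 2
    simp only [Matrix.mulVec, dotProduct, h3]
    refine Finset.sum_congr rfl fun l _ => ?_
    rw [Finset.sum_eq_single j] <;> simp +contextual [mul_comm]
  simp only [tensorF, formJet, h4]
  generalize (derivEndo J z (Pi.single i 1) (Pi.single j 1)
      + gammaMap G z (Pi.single i 1) ((J z).mulVecLin (Pi.single j 1))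
      - (J z).mulVecLin (gammaMap G z (Pi.single i 1) (Pi.single j 1))) = V
  simp only [bilinMap, LinearMap.mk₂_apply, bilin]
  refine Finset.sum_congr rfl fun h _ => ?_
  rw [Finset.sum_eq_single k] <;> simp +contextual [mul_comm]

end Jets

end Coordinates

/-! ### The trace form Φ and the conformally anti-Kähler condition at a point -/

section Coordinates

variable {ι : Type} [Fintype ι] [DecidableEq ι]

theorem eq_zero_of_isLinearMap {g : (ι → ℝ) → ℝ} (hg : IsLinearMap ℝ g)
    (h : ∀ i, g (Pi.single i 1) = 0) (X : ι → ℝ) : g X = 0 := by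
  have h1 : hg.mk' g = 0 := by
    refine (Pi.basisFun ℝ ι).ext fun i => ?_
    rw [Pi.basisFun_apply]
    exact h i
  exact LinearMap.congr_fun h1 X

/-- The linear form with given components. -/
def linForm (φ : ι → ℝ) : (ι → ℝ) →ₗ[ℝ] ℝ := LinearMap.mk (⟨fun X => ∑ k, X k * φ k, by
  intro X Y; simp [add_mul, Finset.sum_add_distrib]⟩) (by
  intro c X; simp [Finset.mul_sum, mul_assoc])

theorem linForm_apply (φ X : ι → ℝ) : linForm φ X = ∑ k, X k * φ k := rfl

theorem linForm_single (φ : ι → ℝ) (k : ι) : linForm φ (Pi.single k 1) = φ k := by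
  rw [linForm_apply, Finset.sum_eq_single k] <;> simp +contextual

theorem apply_eq_sum (θ : (ι → ℝ) →ₗ[ℝ] ℝ) (X : ι → ℝ) :
    θ X = ∑ k, X k * θ (Pi.single k 1) := by
  conv_lhs => rw [pi_eq_sum_univ' X]
  simp

variable {J G : (ι → ℝ) → Matrix ι ι ℝ} {z : ι → ℝ}

theorem formPhiJ_eq (k : ι) :
    formPhiJ G J k z
      = linForm (fun k => formPhi G J k z) ((J z).mulVecLin (Pi.single k 1)) := by
  rw [linForm_apply, formPhiJ]
  refine Finset.sum_congr rfl fun h _ => ?_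
  rw [Matrix.mulVecLin_apply, Matrix.mulVec_single_one, Matrix.col_apply, mul_comm]

theorem metricJ_eq (i j : ι) :
    metricJ G J i j z
      = bilinMap (G z) (Pi.single i 1) ((J z).mulVecLin (Pi.single j 1)) := by
  rw [Matrix.mulVecLin_apply, bilinMap, LinearMap.mk₂_apply, bilin_mulVec_right, bilin_single,
    metricJ, Matrix.mul_apply]

theorem bilinMap_single (A : Matrix ι ι ℝ) (i j : ι) :
    bilinMap A (Pi.single i 1) (Pi.single j 1) = A i j := bilin_single A i j

/-- The 1-form `Φ` of a conformally anti-Kähler structure with 1-form `n θ`. -/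
theorem formPhi_eq {n : ℕ} (hn : Fintype.card ι = 2 * n)
    (h : NordenJet (J z).mulVecLin (derivEndo J z) (bilinMap (G z)) (derivForm G z) (gammaMap G z))
    (hdet : (G z).det ≠ 0) (hsq : J z * J z = -1) (θ : (ι → ℝ) →ₗ[ℝ] ℝ)
    (hF : ∀ X Y Z, 2 * formJet (J z).mulVecLin (derivEndo J z) (bilinMap (G z)) (gammaMap G z) X Y Z
      = bilinMap (G z) X ((J z).mulVecLin Y) * θ ((J z).mulVecLin Z)
      + bilinMap (G z) X ((J z).mulVecLin Z) * θ ((J z).mulVecLin Y)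
      + bilinMap (G z) X Y * θ Z + bilinMap (G z) X Z * θ Y) (k : ι) :
    formPhi G J k z = n * θ (Pi.single k 1) := by
  have hsymm : ∀ i j, G z i j = G z j i := fun i j => by
    rw [← bilinMap_single (G z), h.symm, bilinMap_single]
  have hsymm' : ∀ i j, metricJ G J i j z = metricJ G J j i z := fun i j => by
    rw [metricJ_eq, metricJ_eq, ← h.selfAdjoint, h.symm]
  have hinv : (G z)⁻¹ * G z = 1 := Matrix.nonsing_inv_mul _ hdet.isUnit
  have hinv' : ∀ i j, ∑ k, (G z)⁻¹ i k * G z k j = if i = j then 1 else 0 := fun i j => by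
    rw [← Matrix.mul_apply, hinv, Matrix.one_apply]
  have hinvs : ∀ i j, (G z)⁻¹ i j = (G z)⁻¹ j i := by
    have h1 : (G z)ᵀ = G z := by ext i j; exact hsymm j i
    have h2 : ((G z)⁻¹)ᵀ = (G z)⁻¹ := by rw [Matrix.transpose_nonsing_inv, h1]
    intro i j
    conv_lhs => rw [← h2]
    rfl
  have hinvJ : ∀ i j, ∑ k, (G z)⁻¹ i k * metricJ G J k j z = J z i j := fun i j => by
    have : ∀ k, metricJ G J k j z = (G z * J z) k j := fun k => rfl
    simp only [this]
    rw [← Matrix.mul_apply, ← Matrix.mul_assoc, hinv, Matrix.one_mul]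
  have e1 : ∑ i, ∑ j, (G z)⁻¹ i j * G z i j = 2 * n := by
    have : ∀ i, ∑ j, (G z)⁻¹ i j * G z i j = 1 := fun i => by
      simp only [hsymm i]; rw [hinv' i i, if_pos rfl]
    simp only [this, Finset.sum_const, Finset.card_univ, hn, nsmul_eq_mul, mul_one]
    push_cast; ring
  have e2 : ∑ i, ∑ j, (G z)⁻¹ i j * metricJ G J i j z = 0 := by
    have : ∀ i, ∑ j, (G z)⁻¹ i j * metricJ G J i j z = J z i i := fun i => by
      simp only [hsymm' i]; exact hinvJ i i
    simp only [this]
    exact trace_eq_zero_of_sq_eq_neg_one hsq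
  have e3 : ∀ φ : ι → ℝ, ∑ i, ∑ j, (G z)⁻¹ i j * (G z i k * φ j) = φ k := fun φ => by
    rw [Finset.sum_comm]
    have : ∀ j, ∑ i, (G z)⁻¹ i j * (G z i k * φ j) = (if j = k then 1 else 0) * φ j := fun j => by
      rw [← hinv', Finset.sum_mul]
      exact Finset.sum_congr rfl fun i _ => by rw [hinvs i j]; ring
    simp [this]
  have e4 : ∀ φ : ι → ℝ, ∑ i, ∑ j, (G z)⁻¹ i j * (metricJ G J i k z * φ j)
      = ∑ j, J z j k * φ j := fun φ => by
    rw [Finset.sum_comm]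
    refine Finset.sum_congr rfl fun j _ => ?_
    rw [← hinvJ, Finset.sum_mul]
    exact Finset.sum_congr rfl fun i _ => by rw [hinvs i j]; ring
  have e5 : ∑ j, J z j k * θ ((J z).mulVecLin (Pi.single j 1)) = -θ (Pi.single k 1) := by
    have h1 := apply_eq_sum (θ ∘ₗ (J z).mulVecLin) ((J z).mulVecLin (Pi.single k 1))
    rw [LinearMap.comp_apply, h.sq, map_neg] at h1
    rw [h1]
    refine Finset.sum_congr rfl fun j _ => ?_
    have h2 : (J z).mulVecLin (Pi.single k 1) j = J z j k := by
      rw [Matrix.mulVecLin_apply, Matrix.mulVec_single_one, Matrix.col_apply]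
    rw [h2, LinearMap.comp_apply]
  -- The four traces are, in this order, (tr J)θ(J∂ₖ) = 0, θ(J²∂ₖ) = -θ(∂ₖ), 2nθ(∂ₖ) and θ(∂ₖ);
  -- their sum is 2nθ(∂ₖ).
  have key : 2 * formPhi G J k z = ∑ i, ∑ j, ((G z)⁻¹ i j * metricJ G J i j z
      * θ ((J z).mulVecLin (Pi.single k 1))
      + (G z)⁻¹ i j * (metricJ G J i k z * θ ((J z).mulVecLin (Pi.single j 1)))
      + (G z)⁻¹ i j * G z i j * θ (Pi.single k 1)
      + (G z)⁻¹ i j * (G z i k * θ (Pi.single j 1))) := by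
    simp only [formPhi, Finset.mul_sum]
    refine Finset.sum_congr rfl fun i _ => Finset.sum_congr rfl fun j _ => ?_
    rw [mul_left_comm, tensorF_eq, hF, metricJ_eq, metricJ_eq, bilinMap_single, bilinMap_single]
    ring
  simp only [Finset.sum_add_distrib, ← Finset.sum_mul] at key
  rw [e1, e2, e3 fun j => θ (Pi.single j 1), e4 fun j => θ ((J z).mulVecLin (Pi.single j 1)),
    e5] at key
  linarith

/-- The conformally anti-Kähler condition at a point. -/
theorem conformal_iff {n : ℕ} (hn : Fintype.card ι = 2 * n) (hn0 : n ≠ 0)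
    (h : NordenJet (J z).mulVecLin (derivEndo J z) (bilinMap (G z)) (derivForm G z) (gammaMap G z))
    (hdet : (G z).det ≠ 0) (hsq : J z * J z = -1) :
    (∀ i j k, 2 * (n : ℝ) * tensorF G J i j k z
        = metricJ G J i j z * formPhiJ G J k z + metricJ G J i k z * formPhiJ G J j z
          + G z i j * formPhi G J k z + G z i k * formPhi G J j z) ↔
    ∃ θ : (ι → ℝ) →ₗ[ℝ] ℝ, ∀ X Y Z,
      2 * formJet (J z).mulVecLin (derivEndo J z) (bilinMap (G z)) (gammaMap G z) X Y Z
      = bilinMap (G z) X ((J z).mulVecLin Y) * θ ((J z).mulVecLin Z)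
      + bilinMap (G z) X ((J z).mulVecLin Z) * θ ((J z).mulVecLin Y)
      + bilinMap (G z) X Y * θ Z + bilinMap (G z) X Z * θ Y := by
  have hn1 : (n : ℝ) ≠ 0 := Nat.cast_ne_zero.2 hn0
  constructor
  · intro H
    set φ := linForm fun k => formPhi G J k z with hφ
    have h0 : ∀ i j k : ι,
        2 * (n : ℝ) * formJet (J z).mulVecLin (derivEndo J z) (bilinMap (G z)) (gammaMap G z)
          (Pi.single i 1) (Pi.single j 1) (Pi.single k 1)
        - (bilinMap (G z) (Pi.single i 1) ((J z).mulVecLin (Pi.single j 1))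
            * φ ((J z).mulVecLin (Pi.single k 1))
          + bilinMap (G z) (Pi.single i 1) ((J z).mulVecLin (Pi.single k 1))
            * φ ((J z).mulVecLin (Pi.single j 1))
          + bilinMap (G z) (Pi.single i 1) (Pi.single j 1) * φ (Pi.single k 1)
          + bilinMap (G z) (Pi.single i 1) (Pi.single k 1) * φ (Pi.single j 1)) = 0 := by
      intro i j k
      rw [← tensorF_eq, H, formPhiJ_eq, formPhiJ_eq, metricJ_eq, metricJ_eq, bilinMap_single,
        bilinMap_single, hφ, linForm_single, linForm_single]
      ring
    -- The identity passes from basis vectors to arbitrary vectors by linearity, one argument at a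
    -- time.
    have h1 : ∀ (i j : ι) (Z : ι → ℝ), _ = (0 : ℝ) := fun i j =>
      eq_zero_of_isLinearMap (g := fun Z =>
        2 * (n : ℝ) * formJet (J z).mulVecLin (derivEndo J z) (bilinMap (G z)) (gammaMap G z)
          (Pi.single i 1) (Pi.single j 1) Z
        - (bilinMap (G z) (Pi.single i 1) ((J z).mulVecLin (Pi.single j 1))
            * φ ((J z).mulVecLin Z)
          + bilinMap (G z) (Pi.single i 1) ((J z).mulVecLin Z)
            * φ ((J z).mulVecLin (Pi.single j 1))
          + bilinMap (G z) (Pi.single i 1) (Pi.single j 1) * φ Z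
          + bilinMap (G z) (Pi.single i 1) Z * φ (Pi.single j 1)))
        ⟨fun X Y => by simp only [formJet, map_add]; ring,
          fun c X => by simp only [formJet, map_smul, smul_eq_mul]; ring⟩ (h0 i j)
    have h2 : ∀ (i : ι) (Z Y : ι → ℝ), _ = (0 : ℝ) := fun i Z =>
      eq_zero_of_isLinearMap (g := fun Y =>
        2 * (n : ℝ) * formJet (J z).mulVecLin (derivEndo J z) (bilinMap (G z)) (gammaMap G z)
          (Pi.single i 1) Y Z
        - (bilinMap (G z) (Pi.single i 1) ((J z).mulVecLin Y) * φ ((J z).mulVecLin Z)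
          + bilinMap (G z) (Pi.single i 1) ((J z).mulVecLin Z) * φ ((J z).mulVecLin Y)
          + bilinMap (G z) (Pi.single i 1) Y * φ Z + bilinMap (G z) (Pi.single i 1) Z * φ Y))
        ⟨fun X Y => by
          simp only [formJet, map_add, map_sub, LinearMap.add_apply, LinearMap.sub_apply]; ring,
          fun c X => by
          simp only [formJet, map_add, map_sub, map_smul, smul_eq_mul, LinearMap.smul_apply,
            LinearMap.add_apply, LinearMap.sub_apply]
          ring⟩
        fun j => h1 i j Z
    have h3 : ∀ (Z Y X : ι → ℝ), _ = (0 : ℝ) := fun Z Y =>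
      eq_zero_of_isLinearMap (g := fun X =>
        2 * (n : ℝ) * formJet (J z).mulVecLin (derivEndo J z) (bilinMap (G z)) (gammaMap G z) X Y Z
        - (bilinMap (G z) X ((J z).mulVecLin Y) * φ ((J z).mulVecLin Z)
          + bilinMap (G z) X ((J z).mulVecLin Z) * φ ((J z).mulVecLin Y)
          + bilinMap (G z) X Y * φ Z + bilinMap (G z) X Z * φ Y))
        ⟨fun X Y => by
          simp only [formJet, map_add, map_sub, LinearMap.add_apply, LinearMap.sub_apply]; ring,
          fun c X => by
          simp only [formJet, map_add, map_sub, map_smul, smul_eq_mul, LinearMap.smul_apply,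
            LinearMap.add_apply, LinearMap.sub_apply]
          ring⟩
        fun i => h2 i Z Y
    -- By `formPhi_eq` no other θ than Φ/n is possible.
    refine ⟨(n : ℝ)⁻¹ • φ, fun X Y Z => ?_⟩
    have h4 := h3 Z Y X
    simp only [LinearMap.smul_apply, smul_eq_mul]
    field_simp
    linear_combination h4
  · rintro ⟨θ, hF⟩ i j k
    have h1 := formPhi_eq hn h hdet hsq θ hF
    have h2 : ∀ X, linForm (fun k => formPhi G J k z) X = n * θ X := fun X => by
      rw [linForm_apply, apply_eq_sum θ X, Finset.mul_sum]
      exact Finset.sum_congr rfl fun k _ => by rw [h1]; ring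
    rw [formPhiJ_eq, formPhiJ_eq, h2, h2, h1, h1, tensorF_eq, metricJ_eq, metricJ_eq,
      ← bilinMap_single (G z), ← bilinMap_single (G z)]
    linear_combination (n : ℝ) * hF (Pi.single i 1) (Pi.single j 1) (Pi.single k 1)

end Coordinates

section Induced

variable {n : ℕ} {m : (Fin n → ℝ) → Matrix (Fin n) (Fin n) ℝ} {U : Set (Fin n → ℝ)}
  {z : Fin n ⊕ Fin n → ℝ}

/-! ### Differentiability in an induced chart -/

theorem differentiableAt_basePt : DifferentiableAt ℝ
    (basePt : (Fin n ⊕ Fin n → ℝ) → Fin n → ℝ) z :=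
  differentiableAt_pi.2 fun i => differentiableAt_apply (Sum.inl i) z

theorem differentiableAt_fibrePt : DifferentiableAt ℝ
    (fibrePt : (Fin n ⊕ Fin n → ℝ) → Fin n → ℝ) z :=
  differentiableAt_pi.2 fun i => differentiableAt_apply (Sum.inr i) z

variable {X Y : (Fin n ⊕ Fin n → ℝ) → Fin n → ℝ}

theorem differentiableAt_ip (hm : IsMetricOn m U) (hz : basePt z ∈ U)
    (hX : DifferentiableAt ℝ X z) (hY : DifferentiableAt ℝ Y z) :
    DifferentiableAt ℝ (fun z => ip m (basePt z) (X z) (Y z)) z := by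
  unfold ip
  refine DifferentiableAt.fun_sum fun i _ => DifferentiableAt.fun_sum fun j _ => ?_
  have h := DifferentiableAt.comp z (g := fun x => m x i j)
    ((hm.contDiffAt_entry hz i j).differentiableAt (by simp)) differentiableAt_basePt
  exact (h.mul (differentiableAt_pi.1 hX i)).mul (differentiableAt_pi.1 hY j)

theorem differentiableAt_christoffelMap (hm : IsMetricOn m U) (hz : basePt z ∈ U)
    (hX : DifferentiableAt ℝ X z) (hY : DifferentiableAt ℝ Y z) :
    DifferentiableAt ℝ (fun z => christoffelMap m (basePt z) (X z) (Y z)) z := by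
  refine differentiableAt_pi.2 fun h => ?_
  unfold christoffelMap
  refine DifferentiableAt.fun_sum fun i _ => DifferentiableAt.fun_sum fun j _ => ?_
  have h := DifferentiableAt.comp z (g := christoffel m h i j)
    ((hm.contDiffAt_christoffel hz h i j).differentiableAt (by simp)) differentiableAt_basePt
  exact ((differentiableAt_pi.1 hX i).mul h).mul (differentiableAt_pi.1 hY j)

theorem differentiableAt_coeff (hm : IsMetricOn m U) (hz : basePt z ∈ U) {f : ℝ → ℝ}
    (hf : SmoothCoeff f) : DifferentiableAt ℝ (fun z => f (energy m z)) z := by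
  have h1 : DifferentiableAt ℝ (energy m) z :=
    (differentiableAt_ip hm hz differentiableAt_fibrePt differentiableAt_fibrePt).const_mul _
  refine ((hf.hasDerivWithinAt (energy_nonneg hm hz)).comp_hasFDerivAt z
    h1.hasFDerivAt ?_).differentiableAt
  filter_upwards [eventually_basePt_mem hm hz] with w hw using energy_nonneg hm hw

theorem differentiableAt_natEndo (hm : IsMetricOn m U) (hz : basePt z ∈ U) {a b : ℝ → ℝ}
    (ha : SmoothCoeff a) (hb : SmoothCoeff b) (hX : DifferentiableAt ℝ X z) :
    DifferentiableAt ℝ (fun z => natEndo m a b z (X z)) z :=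
  ((differentiableAt_coeff hm hz ha).smul hX).add (((differentiableAt_coeff hm hz hb).mul
    (differentiableAt_ip hm hz hX differentiableAt_fibrePt)).smul differentiableAt_fibrePt)

theorem differentiableAt_natForm (hm : IsMetricOn m U) (hz : basePt z ∈ U) {c d : ℝ → ℝ}
    (hc : SmoothCoeff c) (hd : SmoothCoeff d) (hX : DifferentiableAt ℝ X z)
    (hY : DifferentiableAt ℝ Y z) :
    DifferentiableAt ℝ (fun z => natForm m c d z (X z) (Y z)) z :=
  ((differentiableAt_coeff hm hz hc).mul (differentiableAt_ip hm hz hX hY)).add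
    (((differentiableAt_coeff hm hz hd).mul
      (differentiableAt_ip hm hz hX differentiableAt_fibrePt)).mul
      (differentiableAt_ip hm hz hY differentiableAt_fibrePt))

theorem differentiableAt_vertPart (hm : IsMetricOn m U) (hz : basePt z ∈ U)
    (w : Fin n ⊕ Fin n → ℝ) : DifferentiableAt ℝ (fun z => vertPart m z w) z := by
  simp only [vertPart_eq]
  exact (differentiableAt_const _).add (differentiableAt_christoffelMap hm hz
    differentiableAt_fibrePt (differentiableAt_const _))

theorem differentiableAt_endoLift (hm : IsMetricOn m U) (hz : basePt z ∈ U) {A : EndoCoeffs}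
    (hA : A.Smooth) (r s : Fin n ⊕ Fin n) :
    DifferentiableAt ℝ (fun z => endoLift m A z r s) z := by
  obtain ⟨h1, h2, h3, h4, k1, k2, k3, k4⟩ := hA
  have e : ∀ z, endoLift m A z r s = (endoLift m A z *ᵥ Pi.single s 1) r := fun z => by
    rw [Matrix.mulVec_single_one, Matrix.col_apply]
  have hh : DifferentiableAt ℝ (fun z => horPart (endoLift m A z *ᵥ Pi.single s 1)) z := by
    simp only [horPart_endoLift_mulVec]
    exact (differentiableAt_natEndo hm hz h4 k4 (differentiableAt_const _)).sub
      (differentiableAt_natEndo hm hz h2 k2 (differentiableAt_vertPart hm hz _))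
  have hv : DifferentiableAt ℝ (fun z => vertPart m z (endoLift m A z *ᵥ Pi.single s 1)) z := by
    simp only [vertPart_endoLift_mulVec]
    exact (differentiableAt_natEndo hm hz h1 k1 (differentiableAt_const _)).add
      (differentiableAt_natEndo hm hz h3 k3 (differentiableAt_vertPart hm hz _))
  have hf : DifferentiableAt ℝ (fun z => fibrePt (endoLift m A z *ᵥ Pi.single s 1)) z := by
    have := hv.sub (differentiableAt_christoffelMap hm hz differentiableAt_fibrePt hh)
    refine this.congr_of_eventuallyEq (Filter.Eventually.of_forall fun w => ?_)
    exact fibrePt_eq m w _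
  simp only [e]
  rcases r with i | i
  · exact differentiableAt_pi.1 hh i
  · exact differentiableAt_pi.1 hf i

theorem differentiableAt_metricLift (hm : IsMetricOn m U) (hz : basePt z ∈ U) {C : MetricCoeffs}
    (hC : C.Smooth) (r s : Fin n ⊕ Fin n) :
    DifferentiableAt ℝ (fun z => metricLift m C z r s) z := by
  obtain ⟨h1, h2, h3, k1, k2, k3⟩ := hC
  simp only [metricLift, Matrix.of_apply, metricForm_eq]
  have hv := fun w => differentiableAt_vertPart hm hz w
  have hc := fun w : Fin n ⊕ Fin n → ℝ =>
    (differentiableAt_const (horPart w) : DifferentiableAt ℝ (fun _ => horPart w) z)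
  exact (((differentiableAt_natForm hm hz h1 k1 (hc _) (hc _)).add
    (differentiableAt_natForm hm hz h2 k2 (hv _) (hv _))).add
    (differentiableAt_natForm hm hz h3 k3 (hv _) (hc _))).add
    (differentiableAt_natForm hm hz h3 k3 (hv _) (hc _))

/-! ### The derivative of `J` on lifts -/

/-- The vector `vertLift X` is the same at all points, so J applied to it has natural horizontal and
vertical parts along the whole line, and `hasDerivAt_lifts` applies. -/
theorem derivEndo_vertLift (hm : IsMetricOn m U) (hz : basePt z ∈ U) {A : EndoCoeffs}
    (hA : A.Smooth) (w : Fin n ⊕ Fin n → ℝ) (X : Fin n → ℝ) :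
    derivEndo (endoLift m A) z w (vertLift X)
      = horLift m z (-(natEndoDeriv m A.a₂ A.b₂ z (vertPart m z w) X
          + (natEndo m A.a₂ A.b₂ z (christoffelMap m (basePt z) (horPart w) X)
          - christoffelMap m (basePt z) (horPart w) (natEndo m A.a₂ A.b₂ z X))))
      + vertLift (natEndoDeriv m A.a₃ A.b₃ z (vertPart m z w) X
          + (natEndo m A.a₃ A.b₃ z (christoffelMap m (basePt z) (horPart w) X)
          - christoffelMap m (basePt z) (horPart w) (natEndo m A.a₃ A.b₃ z X))
        - christoffelDeriv m (basePt z) (horPart w) (fibrePt z) (-natEndo m A.a₂ A.b₂ z X)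
        - christoffelMap m (basePt z) (vertPart m z w
          - christoffelMap m (basePt z) (fibrePt z) (horPart w)) (-natEndo m A.a₂ A.b₂ z X)) := by
  have h1 := hasDerivAt_mulVec (differentiableAt_endoLift hm hz hA) w (vertLift X)
  obtain ⟨a1, a2, a3, a4, b1, b2, b3, b4⟩ := hA
  have h2 := hasDerivAt_lifts hm hz w (hasDerivAt_natEndo hm hz w a2 b2 X).fun_neg
    (hasDerivAt_natEndo hm hz w a3 b3 X)
  simp only [zero_smul, add_zero] at h2
  refine h1.unique (h2.congr_of_eventuallyEq (Filter.Eventually.of_forall fun s => ?_))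
  change endoLift m A (z + s • w) *ᵥ vertLift X = _
  refine ext_parts m (z + s • w) ?_ ?_
  · rw [horPart_endoLift_mulVec, horPart_add, horPart_horLift, horPart_vertLift, natEndo_zero,
      vertPart_vertLift, horPart_vertLift]
    simp
  · rw [vertPart_endoLift_mulVec, vertPart_add, vertPart_horLift, horPart_vertLift, natEndo_zero,
      vertPart_vertLift, vertPart_vertLift]

/-- Along a vertical line the constant vector `horLift m z X` does not stay horizontal: at parameter
s it acquires the vertical part sΓ(V, X), which produces the additional connection terms. -/
theorem derivEndo_vertLift_horLift (hm : IsMetricOn m U) (hz : basePt z ∈ U) {A : EndoCoeffs}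
    (hA : A.Smooth) (V X : Fin n → ℝ) :
    derivEndo (endoLift m A) z (vertLift V) (horLift m z X)
      = horLift m z (natEndoDeriv m A.a₄ A.b₄ z V X
          - natEndo m A.a₂ A.b₂ z (christoffelMap m (basePt z) V X))
      + vertLift (natEndoDeriv m A.a₁ A.b₁ z V X
          + natEndo m A.a₃ A.b₃ z (christoffelMap m (basePt z) V X)
          - christoffelMap m (basePt z) V (natEndo m A.a₄ A.b₄ z X)) := by
  have h1 := hasDerivAt_mulVec (differentiableAt_endoLift hm hz hA) (vertLift V) (horLift m z X)
  obtain ⟨a1, a2, a3, a4, b1, b2, b3, b4⟩ := hA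
  set w : Fin n ⊕ Fin n → ℝ := vertLift V with hw
  have hb : ∀ s : ℝ, basePt (z + s • w) = basePt z := fun s => by
    funext i; simp [basePt, hw, vertLift]
  have hy : ∀ s : ℝ, fibrePt (z + s • w) = fibrePt z + s • V := fun s => by
    funext i; simp [fibrePt, hw, vertLift]
  have hvp : ∀ s : ℝ, vertPart m (z + s • w) (horLift m z X)
      = s • christoffelMap m (basePt z) V X := fun s => by
    rw [vertPart_eq, hb, hy, horPart_horLift, fibrePt_eq m z, vertPart_horLift, horPart_horLift,
      christoffelMap_add_left, christoffelMap_smul_left]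
    abel
  have h0 : ∀ Y, christoffelMap m (basePt z) (horPart w) Y = 0 := fun Y => by
    rw [hw, horPart_vertLift]; funext h; simp [christoffelMap]
  have hD0 : ∀ Y Y', christoffelDeriv m (basePt z) (horPart w) Y Y' = 0 := fun Y Y' => by
    rw [hw, horPart_vertLift]; funext h; simp [christoffelDeriv]
  have hn : ∀ {a b : ℝ → ℝ}, SmoothCoeff a → SmoothCoeff b → ∀ Y, HasDerivAt
      (fun s : ℝ => s • natEndo m a b (z + s • w) Y) (natEndo m a b z Y) 0 := fun ha hb Y => by
    refine ((hasDerivAt_id (0 : ℝ)).fun_smul (hasDerivAt_natEndo hm hz w ha hb Y)).congr_deriv ?_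
    simp
  have h2 := hasDerivAt_lifts hm hz w
    ((hasDerivAt_natEndo hm hz w a4 b4 X).fun_sub (hn a2 b2 (christoffelMap m (basePt z) V X)))
    ((hasDerivAt_natEndo hm hz w a1 b1 X).fun_add (hn a3 b3 (christoffelMap m (basePt z) V X)))
  have h3 : christoffelMap m (basePt z) (fibrePt z) (horPart w) = 0 := by
    rw [hm.gamma_comm hz, h0]
  simp only [zero_smul, add_zero, sub_zero, h0, hD0, h3, natEndo_zero] at h2
  rw [show vertPart m z w = V from vertPart_vertLift V] at h2
  refine h1.unique (h2.congr_of_eventuallyEq (Filter.Eventually.of_forall fun s => ?_))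
  change endoLift m A (z + s • w) *ᵥ horLift m z X = _
  refine ext_parts m (z + s • w) ?_ ?_
  · rw [horPart_endoLift_mulVec, horPart_add, horPart_horLift, horPart_vertLift, hvp,
      natEndo_smul, horPart_horLift, add_zero]
  · rw [vertPart_endoLift_mulVec, vertPart_add, vertPart_horLift, hvp, natEndo_smul,
      horPart_horLift, vertPart_vertLift, zero_add]

end Induced

section Induced

variable {n : ℕ} {m : (Fin n → ℝ) → Matrix (Fin n) (Fin n) ℝ} {U : Set (Fin n → ℝ)}
  {z : Fin n ⊕ Fin n → ℝ}

/-! ### The Nijenhuis tensor on vertical vectors -/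

/-- The vector `g(X, y) Y - g(Y, y) X`. -/
def wedgeY (m : (Fin n → ℝ) → Matrix (Fin n) (Fin n) ℝ) (z : Fin n ⊕ Fin n → ℝ)
    (X Y : Fin n → ℝ) : Fin n → ℝ :=
  ip m (basePt z) X (fibrePt z) • Y - ip m (basePt z) Y (fibrePt z) • X

/-- The curvature vector `R(U, V) Y`. -/
def curvatureVec (m : (Fin n → ℝ) → Matrix (Fin n) (Fin n) ℝ) (x U V Y : Fin n → ℝ) :
    Fin n → ℝ :=
  fun h => ∑ k, ∑ i, ∑ j, curvature m h k i j x * Y k * U i * V j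

/-- Only what is skew in X, Y enters the Nijenhuis tensor, and for natural tensors this is a
multiple of `wedgeY`. The next lemma does the same with a natural endomorphism inserted. -/
theorem natEndoDeriv_sub_swap (hm : IsMetricOn m U) (hz : basePt z ∈ U) (a b : ℝ → ℝ)
    (X Y : Fin n → ℝ) :
    natEndoDeriv m a b z X Y = natEndoDeriv m a b z Y X
      + (der a (energy m z) - b (energy m z)) • wedgeY m z X Y := by
  simp only [natEndoDeriv, wedgeY, hm.ip_comm hz Y X]
  module

theorem natEndoDeriv_natEndo_sub_swap (hm : IsMetricOn m U) (hz : basePt z ∈ U)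
    (a b c d : ℝ → ℝ) (X Y : Fin n → ℝ) :
    natEndoDeriv m a b z (natEndo m c d z X) Y = natEndoDeriv m a b z (natEndo m c d z Y) X
      + (der a (energy m z) * (c (energy m z) + 2 * energy m z * d (energy m z))
        - b (energy m z) * c (energy m z)) • wedgeY m z X Y := by
  simp only [natEndoDeriv, natEndo, wedgeY, ip_add_left, ip_smul_left, ip_add_right,
    ip_smul_right, hm.ip_comm hz Y X, ip_fibrePt_self]
  module

theorem natEndo_wedgeY (a b : ℝ → ℝ) (X Y : Fin n → ℝ) :
    natEndo m a b z (wedgeY m z X Y) = a (energy m z) • wedgeY m z X Y := by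
  simp only [natEndo, wedgeY, ip_sub_left, ip_smul_left]
  module

/-- The Nijenhuis tensor on vertical vectors, for a structure with `a₄ = -a₃`, `b₄ = -b₃`. -/
theorem nijJet_vertLift (hm : IsMetricOn m U) (hz : basePt z ∈ U) {A : EndoCoeffs}
    (hA : A.Smooth) (h4 : A.a₄ (energy m z) = -A.a₃ (energy m z))
    (k4 : A.b₄ (energy m z) = -A.b₃ (energy m z)) (X Y : Fin n → ℝ) :
    nijJet (endoLift m A z).mulVecLin (derivEndo (endoLift m A) z) (vertLift X) (vertLift Y)
      = horLift m z ((-der A.a₂ (energy m z) * (A.a₃ (energy m z)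
            + 2 * energy m z * A.b₃ (energy m z))
          + 2 * A.b₂ (energy m z) * A.a₃ (energy m z)
          - A.a₃ (energy m z) * der A.a₂ (energy m z)
          + A.a₂ (energy m z) * (der A.a₃ (energy m z) - A.b₃ (energy m z))) • wedgeY m z X Y)
        + vertLift ((2 * energy m z * A.b₃ (energy m z) * der A.a₃ (energy m z)
            + A.a₁ (energy m z) * (der A.a₂ (energy m z) - A.b₂ (energy m z))) • wedgeY m z X Y
          - curvatureVec m (basePt z) (natEndo m A.a₂ A.b₂ z X) (natEndo m A.a₂ A.b₂ z Y)
            (fibrePt z)) := by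
  have hJh : ∀ X, horPart ((endoLift m A z).mulVecLin (vertLift X)) = -natEndo m A.a₂ A.b₂ z X :=
    fun X => by
      rw [Matrix.mulVecLin_apply, horPart_endoLift_mulVec, horPart_vertLift, vertPart_vertLift,
        natEndo_zero, zero_sub]
  have hJv : ∀ X, vertPart m z ((endoLift m A z).mulVecLin (vertLift X))
      = natEndo m A.a₃ A.b₃ z X := fun X => by
    rw [Matrix.mulVecLin_apply, vertPart_endoLift_mulVec, horPart_vertLift, vertPart_vertLift,
      natEndo_zero, zero_add]
  have hΓ0 : ∀ Y, christoffelMap m (basePt z) 0 Y = 0 := fun Y => by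
    funext h; simp [christoffelMap]
  have hD0 : ∀ Y Y', christoffelDeriv m (basePt z) 0 Y Y' = 0 := fun Y Y' => by
    funext h; simp [christoffelDeriv]
  have hΓ0' : ∀ Y, christoffelMap m (basePt z) Y 0 = 0 := fun Y => by
    funext h; simp [christoffelMap]
  have hDneg : ∀ X Y Y', christoffelDeriv m (basePt z) (-X) Y Y'
      = -christoffelDeriv m (basePt z) X Y Y' := fun X Y Y' => by
    funext h; simp [christoffelDeriv]
  have hDneg' : ∀ X Y Y', christoffelDeriv m (basePt z) X Y (-Y')
      = -christoffelDeriv m (basePt z) X Y Y' := fun X Y Y' => by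
    funext h; simp [christoffelDeriv]
  have hDcomm : ∀ X Y Y', christoffelDeriv m (basePt z) X Y Y'
      = christoffelDeriv m (basePt z) X Y' Y := fun X Y Y' => by
    funext h
    simp only [christoffelDeriv]
    rw [Finset.sum_comm]
    refine Finset.sum_congr rfl fun i _ => Finset.sum_congr rfl fun j _ => ?_
    have : christoffel m h i j =ᶠ[nhds (basePt z)] christoffel m h j i := by
      filter_upwards [hm.isOpen.mem_nhds hz] with w hw
      exact christoffel_comm (hm.eventually_symm hw) h i j
    rw [this.fderiv_eq]; ring
  have hR : ∀ U V Y, curvatureVec m (basePt z) U V Y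
      = christoffelDeriv m (basePt z) U V Y - christoffelDeriv m (basePt z) V U Y
        + christoffelMap m (basePt z) U (christoffelMap m (basePt z) V Y)
        - christoffelMap m (basePt z) V (christoffelMap m (basePt z) U Y) := fun U V Y => by
    funext h; exact sum_curvature m (basePt z) U V Y h
  have hn4 : ∀ X, natEndo m A.a₄ A.b₄ z X = -natEndo m A.a₃ A.b₃ z X := fun X => by
    simp only [natEndo, h4, k4]; module
  rw [nijJet, derivEndo_vertLift hm hz hA, derivEndo_vertLift hm hz hA,
    derivEndo_vertLift hm hz hA, derivEndo_vertLift hm hz hA]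
  refine ext_parts m z ?_ ?_
  · rw [Matrix.mulVecLin_apply (endoLift m A z) (_ - _)]
    simp only [horPart_sub, vertPart_sub, horPart_endoLift_mulVec, horPart_add, horPart_horLift,
      horPart_vertLift, vertPart_add, vertPart_horLift, vertPart_vertLift, add_zero, zero_add,
      hJh, hJv, hn4, hΓ0, hΓ0', hD0, natEndo_zero, sub_zero, christoffelMap_neg_left,
      christoffelMap_neg_right, natEndo_neg, natEndo_sub]
    rw [natEndoDeriv_natEndo_sub_swap hm hz A.a₂ A.b₂ A.a₃ A.b₃ X Y,
      natEndoDeriv_sub_swap hm hz A.a₂ A.b₂ X Y, natEndoDeriv_sub_swap hm hz A.a₃ A.b₃ X Y,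
      hm.gamma_comm hz (natEndo m A.a₂ A.b₂ z X) Y, hm.gamma_comm hz (natEndo m A.a₂ A.b₂ z Y) X,
      hm.gamma_comm hz (natEndo m A.a₂ A.b₂ z X) (natEndo m A.a₂ A.b₂ z Y)]
    simp only [natEndo_add, natEndo_smul, natEndo_wedgeY]
    module
  -- In the vertical part the derivatives of the Christoffel symbols and their quadratic terms
  -- assemble to the curvature; the other connection terms cancel.
  · rw [Matrix.mulVecLin_apply (endoLift m A z) (_ - _)]
    simp only [vertPart_sub, vertPart_endoLift_mulVec, horPart_sub, horPart_add, horPart_horLift,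
      horPart_vertLift, vertPart_add, vertPart_horLift, vertPart_vertLift, add_zero, zero_add,
      hJh, hJv, hΓ0, hΓ0', hD0, natEndo_zero, sub_zero, christoffelMap_neg_left,
      christoffelMap_neg_right, natEndo_neg, natEndo_sub, hDneg, hDneg',
      christoffelMap_sub_left, hR]
    rw [natEndoDeriv_natEndo_sub_swap hm hz A.a₃ A.b₃ A.a₃ A.b₃ X Y,
      natEndoDeriv_sub_swap hm hz A.a₂ A.b₂ X Y, natEndoDeriv_sub_swap hm hz A.a₃ A.b₃ X Y,
      hm.gamma_comm hz (natEndo m A.a₂ A.b₂ z X) Y, hm.gamma_comm hz (natEndo m A.a₂ A.b₂ z Y) X,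
      hm.gamma_comm hz (natEndo m A.a₃ A.b₃ z X) (natEndo m A.a₂ A.b₂ z Y),
      hm.gamma_comm hz (natEndo m A.a₃ A.b₃ z Y) (natEndo m A.a₂ A.b₂ z X),
      hm.gamma_comm hz (christoffelMap m (basePt z) (fibrePt z) (natEndo m A.a₂ A.b₂ z X)),
      hm.gamma_comm hz (christoffelMap m (basePt z) (fibrePt z) (natEndo m A.a₂ A.b₂ z Y)),
      hm.gamma_comm hz (fibrePt z) (natEndo m A.a₂ A.b₂ z X),
      hm.gamma_comm hz (fibrePt z) (natEndo m A.a₂ A.b₂ z Y),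
      hDcomm _ (fibrePt z) (natEndo m A.a₂ A.b₂ z Y),
      hDcomm _ (fibrePt z) (natEndo m A.a₂ A.b₂ z X)]
    simp only [natEndo_add, natEndo_smul, natEndo_wedgeY]
    module

end Induced

theorem hasDerivAt_bilin_left {ι : Type} [Fintype ι] [DecidableEq ι]
    {G : (ι → ℝ) → Matrix ι ι ℝ} {z : ι → ℝ}
    (hG : ∀ r s, DifferentiableAt ℝ (fun w => G w r s) z) (u Y : ι → ℝ) {F : ℝ → ι → ℝ}
    {F' : ι → ℝ} (hF : HasDerivAt F F' 0) :
    HasDerivAt (fun s : ℝ => bilin (G (z + s • u)) (F s) Y)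
      (derivForm G z u (F 0) Y + bilinMap (G z) F' Y) 0 := by
  have hl : HasDerivAt (fun s : ℝ => z + s • u) u 0 := by
    simpa using ((hasDerivAt_id (0 : ℝ)).smul_const u).const_add z
  have h1 : HasDerivAt (fun t : ℝ => bilin (G (z + t • u)) (F t) Y)
      (∑ r, ∑ s, (fderiv ℝ (fun w => G w r s) z u * F 0 r + G (z + (0 : ℝ) • u) r s * F' r)
        * Y s) 0 := by
    unfold bilin
    refine HasDerivAt.fun_sum fun r _ => HasDerivAt.fun_sum fun s _ => ?_
    have h' : HasFDerivAt (fun w => G w r s) (fderiv ℝ (fun w => G w r s) z)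
        (z + (0 : ℝ) • u) := by simpa using (hG r s).hasFDerivAt
    exact ((h'.comp_hasDerivAt (0 : ℝ) hl).mul (hasDerivAt_pi.1 hF r)).mul_const _
  refine h1.congr_deriv ?_
  simp only [zero_smul, add_zero, add_mul, Finset.sum_add_distrib]
  rfl

section Induced

variable {n : ℕ} {m : (Fin n → ℝ) → Matrix (Fin n) (Fin n) ℝ} {U : Set (Fin n → ℝ)}
  {z : Fin n ⊕ Fin n → ℝ}

/-! ### The Tachibana operator on vertical vectors -/

/-- `G(J X^V, Y^V) = l g(X, Y) + q g(X, y) g(Y, y)`; this is `l`. -/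
def twinL (A : EndoCoeffs) (C : MetricCoeffs) (t : ℝ) : ℝ :=
  C.c₂ t * A.a₃ t - C.c₃ t * A.a₂ t

/-- `G(J X^V, Y^V) = l g(X, Y) + q g(X, y) g(Y, y)`; this is `q`. -/
def twinQ (A : EndoCoeffs) (C : MetricCoeffs) (t : ℝ) : ℝ :=
  (C.c₂ t + 2 * t * C.d₂ t) * A.b₃ t + C.d₂ t * A.a₃ t
    - ((C.c₃ t + 2 * t * C.d₃ t) * A.b₂ t + C.d₃ t * A.a₂ t)

theorem smoothCoeff_twinL {A : EndoCoeffs} {C : MetricCoeffs} (hA : A.Smooth) (hC : C.Smooth) :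
    SmoothCoeff (twinL A C) := by
  obtain ⟨a1, a2, a3, a4, b1, b2, b3, b4⟩ := hA
  obtain ⟨c1, c2, c3, d1, d2, d3⟩ := hC
  exact (c2.mul a3).sub (c3.mul a2)

theorem smoothCoeff_twinQ {A : EndoCoeffs} {C : MetricCoeffs} (hA : A.Smooth) (hC : C.Smooth) :
    SmoothCoeff (twinQ A C) := by
  obtain ⟨a1, a2, a3, a4, b1, b2, b3, b4⟩ := hA
  obtain ⟨c1, c2, c3, d1, d2, d3⟩ := hC
  have ht : ContDiffOn ℝ ∞ (fun t : ℝ => 2 * t) (Set.Ici 0) :=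
    (contDiff_const.mul contDiff_id).contDiffOn
  exact (((c2.add (ht.mul d2)).mul b3).add (d2.mul a3)).sub
    (((c3.add (ht.mul d3)).mul b2).add (d3.mul a2))

theorem natForm_twin (hm : IsMetricOn m U) (hz : basePt z ∈ U) (A : EndoCoeffs)
    (C : MetricCoeffs) (X Y : Fin n → ℝ) :
    natForm m (twinL A C) (twinQ A C) z X Y
      = natForm m C.c₂ C.d₂ z (natEndo m A.a₃ A.b₃ z X) Y
        - natForm m C.c₃ C.d₃ z (natEndo m A.a₂ A.b₂ z X) Y := by
  simp only [natForm, natEndo, ip_add_left, ip_smul_left, ip_fibrePt_self, twinL, twinQ,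
    hm.ip_comm hz (fibrePt z) Y]
  ring

theorem metricForm_vertLift (C : MetricCoeffs) (w : Fin n ⊕ Fin n → ℝ) (Z : Fin n → ℝ) :
    metricForm m C z w (vertLift Z) = natForm m C.c₂ C.d₂ z (vertPart m z w) Z
      + natForm m C.c₃ C.d₃ z Z (horPart w) := by
  simp [metricForm_eq, horPart_vertLift, vertPart_vertLift, natForm, ip_zero_right, ip_zero_left]

theorem derivForm_vertLift (hm : IsMetricOn m U) (hz : basePt z ∈ U) {C : MetricCoeffs}
    (hC : C.Smooth) (w : Fin n ⊕ Fin n → ℝ) (Y Z : Fin n → ℝ) :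
    derivForm (metricLift m C) z w (vertLift Y) (vertLift Z)
      = natFormDeriv m C.c₂ C.d₂ z (vertPart m z w) Y Z
        + (natForm m C.c₂ C.d₂ z (christoffelMap m (basePt z) (horPart w) Y) Z
          + natForm m C.c₂ C.d₂ z Y (christoffelMap m (basePt z) (horPart w) Z)) := by
  have h1 := hasDerivAt_bilin (differentiableAt_metricLift hm hz hC) w (vertLift Y) (vertLift Z)
  refine h1.unique ((hasDerivAt_natForm hm hz w hC.2.1 hC.2.2.2.2.1 Y Z).congr_of_eventuallyEq
    (Filter.Eventually.of_forall fun s => ?_))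
  change bilin _ _ _ = _
  rw [bilin_metricLift, metricForm_vertLift, horPart_vertLift, vertPart_vertLift]
  simp [natForm, ip_zero_right, ip_zero_left]

/-- The left side is the product rule for G(JY^V, Z^V), with Y and Z fixed. Since that expression is
again a natural form, its derivative is known from `hasDerivAt_natForm`. -/
theorem derivForm_J_vertLift (hm : IsMetricOn m U) (hz : basePt z ∈ U) {A : EndoCoeffs}
    (hA : A.Smooth) {C : MetricCoeffs} (hC : C.Smooth) (w : Fin n ⊕ Fin n → ℝ)
    (Y Z : Fin n → ℝ) :
    derivForm (metricLift m C) z w ((endoLift m A z).mulVecLin (vertLift Y)) (vertLift Z)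
        + bilinMap (metricLift m C z) (derivEndo (endoLift m A) z w (vertLift Y)) (vertLift Z)
      = natFormDeriv m (twinL A C) (twinQ A C) z (vertPart m z w) Y Z
        + (natForm m (twinL A C) (twinQ A C) z (christoffelMap m (basePt z) (horPart w) Y) Z
          + natForm m (twinL A C) (twinQ A C) z Y
            (christoffelMap m (basePt z) (horPart w) Z)) := by
  have h1 := hasDerivAt_bilin_left (differentiableAt_metricLift hm hz hC) w (vertLift Z)
    (hasDerivAt_mulVec (differentiableAt_endoLift hm hz hA) w (vertLift Y))
  simp only [zero_smul, add_zero] at h1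
  have ev : ∀ᶠ s : ℝ in nhds 0, basePt (z + s • w) ∈ U := by
    have h2 : Filter.Tendsto (fun s : ℝ => z + s • w) (nhds 0) (nhds z) := by
      simpa using (hasDerivAt_line z w).continuousAt.tendsto
    exact h2.eventually (eventually_basePt_mem hm hz)
  refine h1.unique ((hasDerivAt_natForm hm hz w (smoothCoeff_twinL hA hC)
    (smoothCoeff_twinQ hA hC) Y Z).congr_of_eventuallyEq ?_)
  filter_upwards [ev] with s hs
  rw [bilin_metricLift, metricForm_vertLift, horPart_endoLift_mulVec, vertPart_endoLift_mulVec,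
    horPart_vertLift, vertPart_vertLift, natEndo_zero, natEndo_zero, zero_sub, zero_add,
    natForm_twin hm hs, natForm_comm hm hs C.c₃ C.d₃ Z, ← neg_one_smul ℝ, natForm_smul_left]
  ring

theorem natFormDeriv_zero (c d : ℝ → ℝ) (Y Z : Fin n → ℝ) :
    natFormDeriv m c d z 0 Y Z = 0 := by
  simp [natFormDeriv, ip_zero_left, ip_zero_right]

/-- The coefficient of `g(X, y) g(Y, Z)` in the Tachibana operator on `X^V, Y^V, Z^V`. -/
def tachVertA (A : EndoCoeffs) (C : MetricCoeffs) (t : ℝ) : ℝ :=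
  (A.a₃ t + 2 * t * A.b₃ t) * der C.c₂ t - der (twinL A C) t
    + 2 * (C.c₂ t * A.b₃ t - C.c₃ t * A.b₂ t)

/-- The coefficient of `g(X, y) g(Y, y) g(Z, y)` in the Tachibana operator on `X^V, Y^V, Z^V`. -/
def tachVertB (A : EndoCoeffs) (C : MetricCoeffs) (t : ℝ) : ℝ :=
  (A.a₃ t + 2 * t * A.b₃ t) * der C.d₂ t + 2 * C.d₂ t * A.b₃ t - der (twinQ A C) t
    + 2 * ((C.c₂ t + 2 * t * C.d₂ t) * der A.b₃ t + C.d₂ t * der A.a₃ t + C.d₂ t * A.b₃ t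
    - (C.c₃ t + 2 * t * C.d₃ t) * der A.b₂ t - C.d₃ t * der A.a₂ t
    - C.d₃ t * A.b₂ t)

/-- The coefficient of `g(Y, y) g(X, Z) + g(Z, y) g(X, Y)` in the Tachibana operator on
`X^V, Y^V, Z^V`. -/
def tachVertS (A : EndoCoeffs) (C : MetricCoeffs) (t : ℝ) : ℝ :=
  C.d₃ t * A.a₂ t + C.c₂ t * der A.a₃ t - C.c₃ t * der A.a₂ t

/-- The coefficient of `g(X, y) g(Y, Z)` in the Tachibana operator on `X^H, Y^V, Z^V`. -/
def tachHorA (A : EndoCoeffs) (C : MetricCoeffs) (t : ℝ) : ℝ :=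
  (A.a₁ t + 2 * t * A.b₁ t) * der C.c₂ t
    + 2 * (C.c₂ t * A.b₁ t + C.c₃ t * A.b₄ t)

/-- The coefficient of `g(X, y) g(Y, y) g(Z, y)` in the Tachibana operator on `X^H, Y^V, Z^V`. -/
def tachHorB (A : EndoCoeffs) (C : MetricCoeffs) (t : ℝ) : ℝ :=
  (A.a₁ t + 2 * t * A.b₁ t) * der C.d₂ t + 2 * C.d₂ t * A.b₁ t
    + 2 * ((C.c₂ t + 2 * t * C.d₂ t) * der A.b₁ t + C.d₂ t * der A.a₁ t + C.d₂ t * A.b₁ t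
    + (C.c₃ t + 2 * t * C.d₃ t) * der A.b₄ t + C.d₃ t * der A.a₄ t
    + C.d₃ t * A.b₄ t)

/-- The coefficient of `g(Y, y) g(X, Z) + g(Z, y) g(X, Y)` in the Tachibana operator on
`X^H, Y^V, Z^V`. -/
def tachHorS (A : EndoCoeffs) (C : MetricCoeffs) (t : ℝ) : ℝ :=
  C.d₂ t * A.a₁ t + (C.c₂ t + 2 * t * C.d₂ t) * A.b₁ t
    + (C.c₃ t + 2 * t * C.d₃ t) * A.b₄ t
    + C.c₂ t * der A.a₁ t + C.c₃ t * der A.a₄ t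

/-- As S is a tensor, the connection of the base drops out. What is left is the general natural form
that is symmetric in Y, Z and odd in y. -/
theorem tachibanaJet_vertLift (hm : IsMetricOn m U) (hz : basePt z ∈ U) {A : EndoCoeffs}
    (hA : A.Smooth) {C : MetricCoeffs} (hC : C.Smooth) {t : ℝ} (ht : energy m z = t)
    (X Y Z : Fin n → ℝ) :
    tachibanaJet (endoLift m A z).mulVecLin (derivEndo (endoLift m A) z)
        (bilinMap (metricLift m C z)) (derivForm (metricLift m C) z)
        (vertLift X) (vertLift Y) (vertLift Z)
      = ip m (basePt z) X (fibrePt z) *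
          (tachVertA A C t * ip m (basePt z) Y Z
          + tachVertB A C t
            * (ip m (basePt z) Y (fibrePt z) * ip m (basePt z) Z (fibrePt z)))
        + tachVertS A C t
          * (ip m (basePt z) Y (fibrePt z) * ip m (basePt z) X Z
            + ip m (basePt z) Z (fibrePt z) * ip m (basePt z) X Y) := by
  unfold tachVertA tachVertB tachVertS
  have hJh : horPart ((endoLift m A z).mulVecLin (vertLift X)) = -natEndo m A.a₂ A.b₂ z X := by
    rw [Matrix.mulVecLin_apply, horPart_endoLift_mulVec, horPart_vertLift, vertPart_vertLift,
      natEndo_zero, zero_sub]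
  have hJv : vertPart m z ((endoLift m A z).mulVecLin (vertLift X)) = natEndo m A.a₃ A.b₃ z X := by
    rw [Matrix.mulVecLin_apply, vertPart_endoLift_mulVec, horPart_vertLift, vertPart_vertLift,
      natEndo_zero, zero_add]
  have hΓ0 : ∀ Y, christoffelMap m (basePt z) 0 Y = 0 := fun Y => by
    funext h; simp [christoffelMap]
  have hΓ0' : ∀ Y, christoffelMap m (basePt z) Y 0 = 0 := fun Y => by
    funext h; simp [christoffelMap]
  have hD0 : ∀ Y Y', christoffelDeriv m (basePt z) 0 Y Y' = 0 := fun Y Y' => by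
    funext h; simp [christoffelDeriv]
  have hB : ∀ w Z, bilinMap (metricLift m C z) w (vertLift Z)
      = natForm m C.c₂ C.d₂ z (vertPart m z w) Z + natForm m C.c₃ C.d₃ z (horPart w) Z :=
    fun w Z => by
      rw [bilinMap, LinearMap.mk₂_apply, bilin_metricLift, metricForm_vertLift,
        natForm_comm hm hz C.c₃ C.d₃ Z]
  have hB' : ∀ w Z, bilinMap (metricLift m C z) (vertLift Z) w
      = natForm m C.c₂ C.d₂ z (vertPart m z w) Z + natForm m C.c₃ C.d₃ z (horPart w) Z :=
    fun w Z => by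
      rw [← hB, bilinMap, LinearMap.mk₂_apply, LinearMap.mk₂_apply, bilin_metricLift,
        bilin_metricLift, metricForm_comm hm hz]
  rw [tachibanaJet, derivForm_J_vertLift hm hz hA hC, derivForm_vertLift hm hz hC, hB, hB',
    derivEndo_vertLift hm hz hA, derivEndo_vertLift hm hz hA, hJh, hJv]
  simp only [horPart_add, horPart_horLift, horPart_vertLift, vertPart_add, vertPart_horLift,
    vertPart_vertLift, zero_add, add_zero, hΓ0, hΓ0', hD0, natEndo_zero, sub_zero]
  rw [christoffelMap_neg_left, christoffelMap_neg_left, hm.gamma_comm hz _ Y,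
    hm.gamma_comm hz _ Z, christoffelMap_neg_right, christoffelMap_neg_right, sub_neg_eq_add,
    sub_neg_eq_add]
  -- The connection terms cancel whatever their values are, so they may be treated as arbitrary
  -- vectors.
  generalize christoffelMap m (basePt z) Y (natEndo m A.a₂ A.b₂ z X) = P
  generalize christoffelMap m (basePt z) Z (natEndo m A.a₂ A.b₂ z X) = Q
  simp only [natForm, natFormDeriv, natEndo, natEndoDeriv, ip_add_left, ip_add_right, ip_smul_left,
    ip_smul_right, ip_neg_left, ip_neg_right, ip_fibrePt_self, ip_zero_left, ip_zero_right,
    hm.ip_comm hz (fibrePt z) Y, hm.ip_comm hz (fibrePt z) Z,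
    hm.ip_comm hz Z Y, hm.ip_comm hz Y X, hm.ip_comm hz Z X, hm.ip_comm hz Q Y, ht, twinQ]
  ring

theorem tachibanaJet_horLift (hm : IsMetricOn m U) (hz : basePt z ∈ U) {A : EndoCoeffs}
    (hA : A.Smooth) {C : MetricCoeffs} (hC : C.Smooth) {t : ℝ} (ht : energy m z = t)
    (X Y Z : Fin n → ℝ) :
    tachibanaJet (endoLift m A z).mulVecLin (derivEndo (endoLift m A) z)
        (bilinMap (metricLift m C z)) (derivForm (metricLift m C) z)
        (horLift m z X) (vertLift Y) (vertLift Z)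
      = ip m (basePt z) X (fibrePt z) *
          (tachHorA A C t * ip m (basePt z) Y Z
          + tachHorB A C t
            * (ip m (basePt z) Y (fibrePt z) * ip m (basePt z) Z (fibrePt z)))
        + tachHorS A C t
          * (ip m (basePt z) Y (fibrePt z) * ip m (basePt z) X Z
            + ip m (basePt z) Z (fibrePt z) * ip m (basePt z) X Y) := by
  unfold tachHorA tachHorB tachHorS
  have hJh : horPart ((endoLift m A z).mulVecLin (horLift m z X)) = natEndo m A.a₄ A.b₄ z X := by
    rw [Matrix.mulVecLin_apply, horPart_endoLift_mulVec, horPart_horLift, vertPart_horLift,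
      natEndo_zero, sub_zero]
  have hJv : vertPart m z ((endoLift m A z).mulVecLin (horLift m z X))
      = natEndo m A.a₁ A.b₁ z X := by
    rw [Matrix.mulVecLin_apply, vertPart_endoLift_mulVec, horPart_horLift, vertPart_horLift,
      natEndo_zero, add_zero]
  have hB : ∀ w Z, bilinMap (metricLift m C z) w (vertLift Z)
      = natForm m C.c₂ C.d₂ z (vertPart m z w) Z + natForm m C.c₃ C.d₃ z (horPart w) Z :=
    fun w Z => by
      rw [bilinMap, LinearMap.mk₂_apply, bilin_metricLift, metricForm_vertLift,
        natForm_comm hm hz C.c₃ C.d₃ Z]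
  have hB' : ∀ w Z, bilinMap (metricLift m C z) (vertLift Z) w
      = natForm m C.c₂ C.d₂ z (vertPart m z w) Z + natForm m C.c₃ C.d₃ z (horPart w) Z :=
    fun w Z => by
      rw [← hB, bilinMap, LinearMap.mk₂_apply, LinearMap.mk₂_apply, bilin_metricLift,
        bilin_metricLift, metricForm_comm hm hz]
  rw [tachibanaJet, derivForm_J_vertLift hm hz hA hC, derivForm_vertLift hm hz hC, hB, hB',
    derivEndo_vertLift_horLift hm hz hA, derivEndo_vertLift_horLift hm hz hA, hJh, hJv]
  simp only [horPart_add, horPart_horLift, horPart_vertLift, vertPart_add, vertPart_horLift,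
    vertPart_vertLift, zero_add, add_zero, natFormDeriv_zero, natForm_twin hm hz]
  rw [hm.gamma_comm hz _ Y, hm.gamma_comm hz _ Z, hm.gamma_comm hz X Y, hm.gamma_comm hz X Z]
  generalize christoffelMap m (basePt z) Y (natEndo m A.a₄ A.b₄ z X) = P
  generalize christoffelMap m (basePt z) Z (natEndo m A.a₄ A.b₄ z X) = Q
  generalize christoffelMap m (basePt z) Y X = P'
  generalize christoffelMap m (basePt z) Z X = Q'
  simp only [natForm, natFormDeriv, natEndo, natEndoDeriv, ip_add_left, ip_add_right, ip_smul_left,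
    ip_smul_right, ip_sub_left, ip_fibrePt_self,
    hm.ip_comm hz (fibrePt z) Y, hm.ip_comm hz (fibrePt z) Z,
    hm.ip_comm hz (fibrePt z) Q',
    hm.ip_comm hz Z Y, hm.ip_comm hz Y X, hm.ip_comm hz Z X, hm.ip_comm hz Q Y,
    hm.ip_comm hz Q' Y, ht]
  ring

end Induced

/-! ### Functions on the half-line -/

section HalfLine

variable {E : Type*} [NormedAddCommGroup E] [NormedSpace ℝ E]

/-- At t = 0 the vector y vanishes and tests in its direction give nothing; relations obtained for t
> 0 reach t = 0 through this lemma. -/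
theorem eq_of_eq_of_pos {f g : ℝ → E} (hf : ContinuousOn f (Set.Ici 0))
    (hg : ContinuousOn g (Set.Ici 0)) (h : ∀ t, 0 < t → f t = g t) {t : ℝ} (ht : 0 ≤ t) :
    f t = g t := by
  have h1 : Set.EqOn f g (Set.Ioi 0) := h
  exact h1.of_subset_closure hf hg Set.Ioi_subset_Ici_self (by rw [closure_Ioi]) ht

theorem hasDerivWithinAt_unique {f g : ℝ → E} {f' g' : E} {t : ℝ} (ht : 0 ≤ t)
    (hf : HasDerivWithinAt f f' (Set.Ici 0) t) (hg : HasDerivWithinAt g g' (Set.Ici 0) t)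
    (h : ∀ s, 0 ≤ s → f s = g s) : f' = g' := by
  rw [← hf.derivWithin (uniqueDiffOn_Ici 0 t ht), ← hg.derivWithin (uniqueDiffOn_Ici 0 t ht)]
  exact derivWithin_congr h (h t ht)

theorem hasDerivWithinAt_of_contDiffOn {f : ℝ → E} (hf : ContDiffOn ℝ ∞ f (Set.Ici 0)) {t : ℝ}
    (ht : 0 ≤ t) : HasDerivWithinAt f (derivWithin f (Set.Ici 0) t) (Set.Ici 0) t :=
  ((hf t ht).differentiableWithinAt (by simp)).hasDerivWithinAt

/-- A solution of a linear homogeneous differential equation that vanishes at some point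
vanishes at `0`. -/
theorem eq_zero_of_linear_ode {f φ : ℝ → ℂ} (hφ : ContinuousOn φ (Set.Ici 0))
    (hf : ∀ t, 0 ≤ t → HasDerivWithinAt f (φ t * f t) (Set.Ici 0) t) {T : ℝ} (hT : 0 ≤ T)
    (h0 : f T = 0) : f 0 = 0 := by
  have hsub : Set.Icc 0 T ⊆ Set.Ici (0 : ℝ) := Set.Icc_subset_Ici_self
  obtain ⟨K, hK⟩ := isCompact_Icc.exists_bound_of_continuousOn (hφ.mono hsub)
  have hmem : ∀ x ∈ Set.Icc 0 T, T - x ∈ Set.Icc 0 T := fun x hx =>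
    ⟨by linarith [hx.2], by linarith [hx.1]⟩
  have hcont : ContinuousOn f (Set.Icc 0 T) := fun t ht =>
    ((hf t ht.1).continuousWithinAt).mono hsub
  -- Time is reversed, since the uniqueness theorem propagates a zero forward from the left
  -- endpoint.
  have h1 := eq_zero_of_abs_deriv_le_mul_abs_self_of_eq_zero_right (f := fun x => f (T - x))
    (f' := fun x => -(φ (T - x) * f (T - x))) (K := K) (a := 0) (b := T)
    (hcont.comp (by fun_prop) hmem) ?_ (by simpa using h0) ?_ T ⟨hT, le_rfl⟩
  · simpa using h1
  · intro x hx
    have hx' : 0 < T - x := by linarith [hx.2]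
    have h2 : HasDerivAt f (φ (T - x) * f (T - x)) (T - x) :=
      (hf _ hx'.le).hasDerivAt (Ici_mem_nhds hx')
    have h3 := HasDerivAt.scomp x h2 ((hasDerivAt_id x).const_sub T)
    simpa [Function.comp_def] using h3.hasDerivWithinAt
  · intro x hx
    rw [norm_neg, norm_mul]
    exact mul_le_mul_of_nonneg_right (hK _ (hmem x ⟨hx.1, hx.2.le⟩)) (norm_nonneg _)

end HalfLine

theorem SmoothCoeff.continuousOn {f : ℝ → ℝ} (hf : SmoothCoeff f) :
    ContinuousOn f (Set.Ici 0) :=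
  ContDiffOn.continuousOn hf

theorem SmoothCoeff.ofReal {f : ℝ → ℝ} (hf : SmoothCoeff f) :
    ContDiffOn ℝ ∞ (fun t => (f t : ℂ)) (Set.Ici 0) :=
  Complex.ofRealCLM.contDiff.comp_contDiffOn hf

theorem SmoothCoeff.hasDerivWithinAt_ofReal {f : ℝ → ℝ} (hf : SmoothCoeff f) {t : ℝ}
    (ht : 0 ≤ t) : HasDerivWithinAt (fun t => (f t : ℂ)) (NaturalLift.der f t) (Set.Ici 0) t :=
  (hf.hasDerivWithinAt ht).ofReal_comp

/-! ### Algebraic relations of an almost complex structure -/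

/-- The relations between the coefficients that express `J² = -1`. -/
structure EndoCoeffs.IsComplex (A : EndoCoeffs) : Prop where
  smooth : A.Smooth
  a₄_eq : ∀ t, 0 ≤ t → A.a₄ t = -A.a₃ t
  b₄_eq : ∀ t, 0 ≤ t → A.b₄ t = -A.b₃ t
  a_rel : ∀ t, 0 ≤ t → A.a₁ t * A.a₂ t = 1 + A.a₃ t ^ 2
  b_rel : ∀ t, 0 ≤ t → A.b₁ t * A.a₂ t + A.a₁ t * A.b₂ t + 2 * t * (A.b₁ t * A.b₂ t)
    = 2 * A.a₃ t * A.b₃ t + 2 * t * A.b₃ t ^ 2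

/-- The complex function `(a₃ - i) / a₂`. -/
def EndoCoeffs.sigma (A : EndoCoeffs) (t : ℝ) : ℂ := (A.a₃ t - Complex.I) / A.a₂ t

/-- The complex function `(b₃ - b₂ σ) / (a₂ + 2 t b₂)`. -/
def EndoCoeffs.rho (A : EndoCoeffs) (t : ℝ) : ℂ :=
  (A.b₃ t - A.b₂ t * A.sigma t) / (A.a₂ t + 2 * t * A.b₂ t)

/-- The derivative of a complex function on the half-line. -/
def derC (f : ℝ → ℂ) (t : ℝ) : ℂ := derivWithin f (Set.Ici 0) t

/-- The integrability condition for constant sectional curvature `c`. -/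
def EndoCoeffs.NijenhuisEqs (A : EndoCoeffs) (c : ℝ) : Prop :=
  ∀ t, 0 ≤ t →
    2 * t * A.b₃ t * der A.a₃ t + A.a₁ t * (der A.a₂ t - A.b₂ t)
      + c * A.a₂ t * (A.a₂ t + 2 * t * A.b₂ t) = 0 ∧
    -der A.a₂ t * (A.a₃ t + 2 * t * A.b₃ t) + 2 * A.b₂ t * A.a₃ t - A.a₃ t * der A.a₂ t
      + A.a₂ t * (der A.a₃ t - A.b₃ t) = 0

namespace EndoCoeffs.IsComplex

variable {A : EndoCoeffs} {t : ℝ}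

theorem a₁_ne_zero (h : A.IsComplex) (ht : 0 ≤ t) : A.a₁ t ≠ 0 := by
  intro h0
  have := h.a_rel t ht
  rw [h0] at this
  nlinarith [sq_nonneg (A.a₃ t)]

theorem a₂_ne_zero (h : A.IsComplex) (ht : 0 ≤ t) : A.a₂ t ≠ 0 := by
  intro h0
  have := h.a_rel t ht
  rw [h0] at this
  nlinarith [sq_nonneg (A.a₃ t)]

/-- The relation for the complex structure induced on the span of y^H and y^V, whose coefficients
are aₖ + 2tbₖ. -/
theorem cap_rel (h : A.IsComplex) (ht : 0 ≤ t) : (A.a₁ t + 2 * t * A.b₁ t) * (A.a₂ t + 2 * t * A.b₂ t)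
    = 1 + (A.a₃ t + 2 * t * A.b₃ t) ^ 2 := by
  linear_combination h.a_rel t ht + 2 * t * h.b_rel t ht

theorem cap₂_ne_zero (h : A.IsComplex) (ht : 0 ≤ t) : A.a₂ t + 2 * t * A.b₂ t ≠ 0 := by
  intro h0
  have := h.cap_rel ht
  rw [h0] at this
  nlinarith [sq_nonneg (A.a₃ t + 2 * t * A.b₃ t)]

theorem der_a_rel (h : A.IsComplex) (ht : 0 ≤ t) :
    der A.a₁ t * A.a₂ t + A.a₁ t * der A.a₂ t = 2 * A.a₃ t * der A.a₃ t := by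
  obtain ⟨a1, a2, a3, -⟩ := h.smooth
  have h1 := (a1.hasDerivWithinAt ht).mul (a2.hasDerivWithinAt ht)
  have h2 := ((a3.hasDerivWithinAt ht).pow 2).const_add 1
  have h3 := hasDerivWithinAt_unique ht h1 h2 fun s hs => h.a_rel s hs
  rw [h3]; push_cast; ring

end EndoCoeffs.IsComplex

/-- This expresses that the fractions claimed for b₁, b₂, b₃ satisfy `b_rel`, after clearing
denominators; here u, v, w stand for a₁, a₂, a₃ and the primed letters for their derivatives. -/
theorem integrab_identity {u v w u' v' w' : ℝ} (t c : ℝ) (hv : v ≠ 0)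
    (e1 : u * v = 1 + w ^ 2) (e2 : u' * v + u * v' = 2 * w * w') :
    2 * w * (u * w' + 2 * c * v * w + 4 * c * t * v' * w - 2 * c * t * v * w')
        * (u - 2 * t * u' - 2 * c * t * v - 4 * c * t ^ 2 * v')
      + 2 * t * (u * w' + 2 * c * v * w + 4 * c * t * v' * w - 2 * c * t * v * w') ^ 2
      - u * (2 * t * w' ^ 2 - 2 * t * u' * v' + c * v ^ 2 + 2 * c * t * v * v' + u * v')
        * (u - 2 * t * u' - 2 * c * t * v - 4 * c * t ^ 2 * v')
    = (v * (u - 2 * t * u' - 2 * c * t * v - 4 * c * t ^ 2 * v')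
        + 2 * t * (2 * t * w' ^ 2 - 2 * t * u' * v' + c * v ^ 2 + 2 * c * t * v * v' + u * v'))
      * (2 * c ^ 2 * t * v ^ 2 + 2 * c * t * u * v' + u * u' - c + 3 * c * w ^ 2) := by
  -- After elimination of u and u' no constraint is left, and the claim is a rational identity.
  obtain rfl : u = (1 + w ^ 2) / v := by field_simp; linarith
  obtain rfl : u' = (2 * w * w' - (1 + w ^ 2) / v * v') / v := by
    field_simp; field_simp at e2; linarith
  field_simp
  ring

namespace EndoCoeffs.IsComplex

variable {A : EndoCoeffs} {t : ℝ}

/-! ### The complex functions `σ` and `ρ` -/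

theorem a₂_mul_sigma (h : A.IsComplex) (ht : 0 ≤ t) :
    (A.a₂ t : ℂ) * A.sigma t = A.a₃ t - Complex.I := by
  have := Complex.ofReal_ne_zero.2 (h.a₂_ne_zero ht)
  rw [sigma]; field_simp

theorem cap₂_mul_rho (h : A.IsComplex) (ht : 0 ≤ t) :
    ((A.a₂ t : ℂ) + 2 * t * A.b₂ t) * A.rho t = A.b₃ t - A.b₂ t * A.sigma t := by
  have := Complex.ofReal_ne_zero.2 (h.cap₂_ne_zero ht)
  push_cast at this
  rw [rho]; field_simp

/-- This is `a_rel` with 1 + a₃² factored as (a₃ + i)(a₃ - i). -/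
theorem a₁_eq (h : A.IsComplex) (ht : 0 ≤ t) :
    (A.a₁ t : ℂ) = (A.a₃ t + Complex.I) * A.sigma t := by
  have h0 := Complex.ofReal_ne_zero.2 (h.a₂_ne_zero ht)
  have h1 := congrArg (fun r : ℝ => (r : ℂ)) (h.a_rel t ht)
  push_cast at h1
  apply mul_right_cancel₀ h0
  linear_combination h1 - (A.a₃ t + Complex.I) * h.a₂_mul_sigma ht + Complex.I_sq

theorem contDiffOn_sigma (h : A.IsComplex) : ContDiffOn ℝ ∞ A.sigma (Set.Ici 0) := by
  obtain ⟨-, a2, a3, -⟩ := h.smooth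
  unfold sigma
  simp only [div_eq_mul_inv]
  exact (a3.ofReal.sub contDiffOn_const).mul (a2.ofReal.inv
    fun t ht => Complex.ofReal_ne_zero.2 (h.a₂_ne_zero ht))

theorem contDiffOn_rho (h : A.IsComplex) : ContDiffOn ℝ ∞ A.rho (Set.Ici 0) := by
  obtain ⟨-, a2, a3, -, -, b2, b3, -⟩ := h.smooth
  have ht : ContDiffOn ℝ ∞ (fun t : ℝ => 2 * (t : ℂ)) (Set.Ici 0) :=
    (contDiff_const.mul Complex.ofRealCLM.contDiff).contDiffOn
  unfold rho
  simp only [div_eq_mul_inv]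
  refine (b3.ofReal.sub (b2.ofReal.mul h.contDiffOn_sigma)).mul
    ((a2.ofReal.add (ht.mul b2.ofReal)).inv fun t ht => ?_)
  have := Complex.ofReal_ne_zero.2 (h.cap₂_ne_zero ht)
  push_cast at this
  exact this

theorem hasDerivWithinAt_sigma (h : A.IsComplex) (ht : 0 ≤ t) :
    HasDerivWithinAt A.sigma (derC A.sigma t) (Set.Ici 0) t :=
  hasDerivWithinAt_of_contDiffOn h.contDiffOn_sigma ht

theorem hasDerivWithinAt_rho (h : A.IsComplex) (ht : 0 ≤ t) :
    HasDerivWithinAt A.rho (derC A.rho t) (Set.Ici 0) t :=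
  hasDerivWithinAt_of_contDiffOn h.contDiffOn_rho ht

theorem hasDerivWithinAt_derC_sigma (h : A.IsComplex) (ht : 0 ≤ t) :
    HasDerivWithinAt (derC A.sigma) (derC (derC A.sigma) t) (Set.Ici 0) t :=
  hasDerivWithinAt_of_contDiffOn
    (ContDiffOn.derivWithin h.contDiffOn_sigma (uniqueDiffOn_Ici 0) (by simp)) ht

theorem a₂_mul_derC_sigma (h : A.IsComplex) (ht : 0 ≤ t) :
    (der A.a₂ t : ℂ) * A.sigma t + A.a₂ t * derC A.sigma t = der A.a₃ t := by
  obtain ⟨-, a2, a3, -⟩ := h.smooth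
  have h1 := (a2.hasDerivWithinAt_ofReal ht).mul (h.hasDerivWithinAt_sigma ht)
  have h2 := (a3.hasDerivWithinAt_ofReal ht).sub_const Complex.I
  exact hasDerivWithinAt_unique ht h1 h2 fun s hs => h.a₂_mul_sigma hs

theorem der_a₁_eq (h : A.IsComplex) (ht : 0 ≤ t) :
    (der A.a₁ t : ℂ) = der A.a₃ t * A.sigma t + (A.a₃ t + Complex.I) * derC A.sigma t := by
  obtain ⟨a1, -, a3, -⟩ := h.smooth
  have h1 := ((a3.hasDerivWithinAt_ofReal ht).add_const Complex.I).mul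
    (h.hasDerivWithinAt_sigma ht)
  exact hasDerivWithinAt_unique ht (a1.hasDerivWithinAt_ofReal ht) h1 fun s hs => h.a₁_eq hs

/-- The function `s = σ + 2 t ρ` is the analogue of `σ` for the coefficients `aₖ + 2 t bₖ`. -/
theorem cap₂_mul_s (h : A.IsComplex) (ht : 0 ≤ t) :
    ((A.a₂ t : ℂ) + 2 * t * A.b₂ t) * (A.sigma t + 2 * t * A.rho t)
      = A.a₃ t + 2 * t * A.b₃ t - Complex.I := by
  linear_combination h.a₂_mul_sigma ht + 2 * t * h.cap₂_mul_rho ht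

/-- The numerator a₃ + 2tb₃ - i has imaginary part -1. -/
theorem s_ne_zero (h : A.IsComplex) (ht : 0 ≤ t) : A.sigma t + 2 * t * A.rho t ≠ 0 := by
  intro h0
  have h1 := h.cap₂_mul_s ht
  rw [h0, mul_zero] at h1
  have h2 := congrArg Complex.im h1
  simp at h2

/-- The integrability condition as a differential equation for `σ`. -/
theorem derC_sigma_eq (h : A.IsComplex) {c : ℝ} (hc : A.NijenhuisEqs c) (ht : 0 ≤ t) :
    (A.sigma t + 2 * t * A.rho t) * derC A.sigma t - A.rho t * A.sigma t + c = 0 := by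
  have h0 := Complex.ofReal_ne_zero.2 (h.a₂_ne_zero ht)
  have h1 := Complex.ofReal_ne_zero.2 (h.cap₂_ne_zero ht)
  push_cast at h1
  obtain ⟨n1, n2⟩ := hc t ht
  have n1' := congrArg (fun r : ℝ => (r : ℂ)) n1
  have n2' := congrArg (fun r : ℝ => (r : ℂ)) n2
  have e1 := congrArg (fun r : ℝ => (r : ℂ)) (h.a_rel t ht)
  push_cast at n1' n2' e1
  have e2 := h.a₂_mul_sigma ht
  have e3 := h.cap₂_mul_rho ht
  have e4 := h.a₂_mul_derC_sigma ht
  have e5 := h.cap₂_mul_s ht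
  -- The factor a₂²(a₂ + 2tb₂) clears all denominators of σ, σ' and ρ.
  apply mul_left_cancel₀ (mul_ne_zero (pow_ne_zero 2 h0) h1)
  generalize A.sigma t = σ at *
  generalize A.rho t = ρ at *
  generalize derC A.sigma t = σ' at *
  have e6 : (A.a₂ t : ℂ) ^ 2 * σ' = A.a₂ t * der A.a₃ t - der A.a₂ t * (A.a₃ t - Complex.I) := by
    linear_combination (A.a₂ t : ℂ) * e4 - der A.a₂ t * e2
  have e7 : (A.a₂ t : ℂ) * (((A.a₂ t : ℂ) + 2 * t * A.b₂ t) * ρ)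
      = A.a₂ t * A.b₃ t - A.b₂ t * (A.a₃ t - Complex.I) := by
    linear_combination (A.a₂ t : ℂ) * e3 - A.b₂ t * e2
  have e8 : (A.a₂ t : ℂ) ^ 2 * (((A.a₂ t : ℂ) + 2 * t * A.b₂ t) * (ρ * σ))
      = (A.a₂ t * A.b₃ t - A.b₂ t * (A.a₃ t - Complex.I)) * (A.a₃ t - Complex.I) := by
    rw [← e7, ← e2]; ring
  have e9 : (A.a₂ t : ℂ) ^ 2 * (((A.a₂ t : ℂ) + 2 * t * A.b₂ t) * ((σ + 2 * t * ρ) * σ'))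
      = (A.a₃ t + 2 * t * A.b₃ t - Complex.I)
        * (A.a₂ t * der A.a₃ t - der A.a₂ t * (A.a₃ t - Complex.I)) := by
    rw [← e6, ← e5]; ring
  linear_combination e9 - e8 + (A.a₂ t : ℂ) * n1' + (A.a₃ t - Complex.I) * n2'
    + (A.b₂ t - der A.a₂ t) * (e1 + Complex.I_sq)

/-- `σ² + 2 c t` has no zeros. -/
theorem kappa_ne_zero (h : A.IsComplex) {c : ℝ} (hc : A.NijenhuisEqs c) (ht : 0 ≤ t) :
    A.sigma t ^ 2 + 2 * c * t ≠ 0 := by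
  intro h0
  -- Substituting σ' from `derC_sigma_eq` makes 2σσ' + 2c a multiple of σ² + 2ct. The factor is
  -- continuous because σ + 2tρ has no zeros.
  have hd : ∀ t, 0 ≤ t → HasDerivWithinAt (fun t : ℝ => A.sigma t ^ 2 + 2 * c * t)
      (2 * (A.rho t / (A.sigma t + 2 * t * A.rho t)) * (A.sigma t ^ 2 + 2 * c * t))
      (Set.Ici 0) t := by
    intro t ht
    have h1 := ((h.hasDerivWithinAt_sigma ht).pow 2).add
      (((hasDerivAt_id t).ofReal_comp.hasDerivWithinAt (s := Set.Ici 0)).const_mul (2 * (c : ℂ)))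
    refine h1.congr_deriv ?_
    have h2 := h.s_ne_zero ht
    have h3 := h.derC_sigma_eq hc ht
    rw [mul_div_assoc', div_mul_eq_mul_div, eq_div_iff h2]
    push_cast
    linear_combination 2 * A.sigma t * h3
  have hcont : ContinuousOn (fun t : ℝ => 2 * (A.rho t / (A.sigma t + 2 * t * A.rho t)))
      (Set.Ici 0) := by
    have h1 := h.contDiffOn_sigma.continuousOn
    have h2 := h.contDiffOn_rho.continuousOn
    have h3 : ContinuousOn (fun t : ℝ => 2 * (t : ℂ)) (Set.Ici 0) := by fun_prop
    exact continuousOn_const.mul (h2.div (h1.add (h3.mul h2)) fun t ht => h.s_ne_zero ht)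
  have h1 := eq_zero_of_linear_ode hcont hd ht h0
  -- A zero at t would propagate back to 0, where the function equals σ(0)²; but a₂σ has imaginary
  -- part -1.
  have h2 : A.sigma 0 = 0 := by simpa using h1
  have h3 := h.a₂_mul_sigma le_rfl
  rw [h2, mul_zero] at h3
  have h4 := congrArg Complex.im h3
  simp at h4

/-! ### The integrability conditions -/

/-- Up to the factor -a₂, D is the determinant of `NijenhuisEqs` as a linear system for b₂, b₃. At t
= 0 it is a₁. If it vanished at some t > 0, then a₂ + 2ta₂', a₃', a₃ and a₁ - 2cta₂ would all vanish
there, whence σ² + 2ct = 0, contrary to `kappa_ne_zero`. -/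
theorem integrabDenom_ne_zero (h : A.IsComplex) {c : ℝ} (hc : A.NijenhuisEqs c) (ht : 0 ≤ t) :
    integrabDenom A c t ≠ 0 := by
  intro hD
  have h1 := h.a₁_ne_zero ht
  have h2 := h.a₂_ne_zero ht
  have h3 := h.cap₂_ne_zero ht
  have hk := h.kappa_ne_zero hc ht
  have e1 := h.a_rel t ht
  have e2 := h.der_a_rel ht
  have e3 := h.a₂_mul_sigma ht
  obtain ⟨n1, n2⟩ := hc t ht
  rw [integrabDenom] at hD
  rcases ht.eq_or_lt with rfl | ht'
  · simp at hD; exact h1 hD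
  obtain ⟨hP, hW⟩ : A.a₂ t + 2 * t * der A.a₂ t = 0 ∧ 2 * t * der A.a₃ t = 0 := by
    -- The system has a solution, so when its determinant vanishes the Cramer numerator of b₂
    -- vanishes as well.
    have hNum : A.a₂ t * (2 * t * der A.a₃ t ^ 2 - 2 * t * der A.a₁ t * der A.a₂ t
        + c * A.a₂ t ^ 2 + 2 * c * t * A.a₂ t * der A.a₂ t + A.a₁ t * der A.a₂ t) = 0 := by
      linear_combination A.a₂ t * A.b₂ t * hD + (A.a₂ t + 2 * t * der A.a₂ t) * n1
        + 2 * t * der A.a₃ t * n2 + 2 * t * (A.b₂ t - der A.a₂ t) * e2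
    -- The determinant and the numerator combine to a sum of two squares, which separates one scalar
    -- relation into two.
    have hsum : (A.a₃ t * (A.a₂ t + 2 * t * der A.a₂ t) - A.a₂ t * (2 * t * der A.a₃ t)) ^ 2
        + (A.a₂ t + 2 * t * der A.a₂ t) ^ 2 = 0 := by
      linear_combination A.a₂ t ^ 3 * hD + 2 * t * A.a₂ t * hNum
        - (A.a₂ t + 2 * t * der A.a₂ t) * ((A.a₂ t + 2 * t * der A.a₂ t) * e1
          - 2 * t * A.a₂ t * e2)
    have hP : A.a₂ t + 2 * t * der A.a₂ t = 0 := by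
      nlinarith [sq_nonneg (A.a₃ t * (A.a₂ t + 2 * t * der A.a₂ t)
        - A.a₂ t * (2 * t * der A.a₃ t)), sq_nonneg (A.a₂ t + 2 * t * der A.a₂ t)]
    refine ⟨hP, ?_⟩
    rw [hP] at hsum
    have : A.a₂ t * (2 * t * der A.a₃ t) = 0 := by simpa using hsum
    exact (mul_eq_zero.1 this).resolve_left h2
  have hw' : der A.a₃ t = 0 := by simpa [ht'.ne'] using hW
  have hb : A.a₃ t = 0 := by
    have : A.a₃ t * (A.a₂ t + 2 * t * A.b₂ t) = 0 := by
      rw [hw'] at n2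
      linear_combination t * n2 + (A.a₃ t + t * A.b₃ t) * hP
    exact (mul_eq_zero.1 this).resolve_right h3
  have hp : A.a₁ t - 2 * t * c * A.a₂ t = 0 := by
    have : (A.a₁ t - 2 * t * c * A.a₂ t) * (A.a₂ t + 2 * t * A.b₂ t) = 0 := by
      rw [hw'] at n1
      linear_combination (-2 * t) * n1 + A.a₁ t * hP
    exact (mul_eq_zero.1 this).resolve_right h3
  apply hk
  have h2' := Complex.ofReal_ne_zero.2 h2
  have e1' := congrArg (fun r : ℝ => (r : ℂ)) e1
  have hp' := congrArg (fun r : ℝ => (r : ℂ)) hp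
  simp only [hb] at e1' e3
  push_cast at e1' hp' e3
  apply mul_left_cancel₀ (pow_ne_zero 2 h2')
  linear_combination (A.a₂ t * A.sigma t - Complex.I) * e3 + e1' - A.a₂ t * hp' + Complex.I_sq

/-- The integrability conditions, solved for `b₁`, `b₂`, `b₃`. -/
theorem integrabForm_iff (h : A.IsComplex) (c : ℝ) :
    IntegrabForm A c ↔ A.NijenhuisEqs c := by
  constructor
  · intro H t ht
    obtain ⟨hD, -, k2, k3⟩ := H t ht
    have e1 := h.a_rel t ht
    have e2 := h.der_a_rel ht
    rw [eq_div_iff hD] at k2 k3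
    rw [integrabDenom] at *
    constructor
    · apply mul_left_cancel₀ hD
      linear_combination 2 * t * der A.a₃ t * k3 - (A.a₁ t - 2 * c * t * A.a₂ t) * k2
        - 2 * c * t * (A.a₂ t + 2 * t * der A.a₂ t) * e2
    · apply mul_left_cancel₀ hD
      linear_combination 2 * A.a₃ t * k2 - (A.a₂ t + 2 * t * der A.a₂ t) * k3
        - 2 * t * der A.a₃ t * e2
  · intro H t ht
    have hD := h.integrabDenom_ne_zero H ht
    refine ⟨hD, ?_⟩
    rw [eq_div_iff hD, eq_div_iff hD, eq_div_iff hD]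
    have e1 := h.a_rel t ht
    have e2 := h.der_a_rel ht
    have e3 := h.b_rel t ht
    have h2 := h.a₂_ne_zero ht
    have h3 := h.cap₂_ne_zero ht
    obtain ⟨n1, n2⟩ := H t ht
    rw [integrabDenom] at *
    -- Cramer's rule for b₂ and then b₃; `e2` removes the product a₃a₃' from the determinant.
    have k2 : A.b₂ t * (A.a₁ t - 2 * t * der A.a₁ t - 2 * c * t * A.a₂ t
        - 4 * c * t ^ 2 * der A.a₂ t) = 2 * t * der A.a₃ t ^ 2 - 2 * t * der A.a₁ t * der A.a₂ t
        + c * A.a₂ t ^ 2 + 2 * c * t * A.a₂ t * der A.a₂ t + A.a₁ t * der A.a₂ t := by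
      apply mul_left_cancel₀ h2
      linear_combination (-(A.a₂ t + 2 * t * der A.a₂ t)) * n1
        - 2 * t * der A.a₃ t * n2 - 2 * t * (A.b₂ t - der A.a₂ t) * e2
    have k3 : A.b₃ t * (A.a₁ t - 2 * t * der A.a₁ t - 2 * c * t * A.a₂ t
        - 4 * c * t ^ 2 * der A.a₂ t) = A.a₁ t * der A.a₃ t + 2 * c * A.a₂ t * A.a₃ t
        + 4 * c * t * der A.a₂ t * A.a₃ t - 2 * c * t * A.a₂ t * der A.a₃ t := by
      apply mul_left_cancel₀ h2
      linear_combination (-2 * A.a₃ t) * n1 - (A.a₁ t - 2 * c * t * A.a₂ t) * n2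
        - 2 * t * A.b₃ t * e2
    refine ⟨?_, k2, k3⟩
    -- For b₁ the relation `b_rel` is linear with leading factor a₂ + 2tb₂; inserting the fractions
    -- for b₂ and b₃ leaves `integrab_identity`.
    apply mul_left_cancel₀ (mul_ne_zero h3 hD)
    have key := integrab_identity t c h2 e1 e2
    generalize A.a₁ t = u, A.a₂ t = v, A.a₃ t = w, der A.a₁ t = u', der A.a₂ t = v',
      der A.a₃ t = w', A.b₁ t = b₁, A.b₂ t = b₂, A.b₃ t = b₃ at *
    generalize u - 2 * t * u' - 2 * c * t * v - 4 * c * t ^ 2 * v' = D,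
      2 * t * w' ^ 2 - 2 * t * u' * v' + c * v ^ 2 + 2 * c * t * v * v' + u * v' = N₂,
      u * w' + 2 * c * v * w + 4 * c * t * v' * w - 2 * c * t * v * w' = N₃,
      2 * c ^ 2 * t * v ^ 2 + 2 * c * t * u * v' + u * u' - c + 3 * c * w ^ 2 = N₁ at *
    linear_combination D ^ 2 * e3 + 2 * w * D * k3 + 2 * t * (b₃ * D + N₃) * k3 - u * D * k2
      - 2 * t * N₁ * k2 + key

end EndoCoeffs.IsComplex

/-! ### Algebraic relations of an almost anti-Hermitian structure -/

/-- The relations between the coefficients that express `G(JX, JY) = -G(X, Y)`. -/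
structure MetricCoeffs.IsNorden (C : MetricCoeffs) (A : EndoCoeffs) : Prop where
  smooth : C.Smooth
  ne : ∀ t, 0 ≤ t → C.c₂ t ≠ 0 ∨ C.c₃ t ≠ 0
  c_rel : ∀ t, 0 ≤ t → A.a₁ t * C.c₂ t = 2 * (A.a₃ t * C.c₃ t) - A.a₂ t * C.c₁ t
  d_rel : ∀ t, 0 ≤ t → A.b₁ t * C.c₂ t + (A.a₁ t + 2 * t * A.b₁ t) * C.d₂ t
    = 2 * (A.b₃ t * C.c₃ t + (A.a₃ t + 2 * t * A.b₃ t) * C.d₃ t)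
      - (A.b₂ t * C.c₁ t + (A.a₂ t + 2 * t * A.b₂ t) * C.d₁ t)

variable {A : EndoCoeffs} {C : MetricCoeffs} {t : ℝ}

theorem smoothCoeff_tachVertS (hA : A.Smooth) (hC : C.Smooth) :
    SmoothCoeff (tachVertS A C) := by
  obtain ⟨-, a2, a3, -⟩ := hA
  obtain ⟨-, c2, c3, -, -, d3⟩ := hC
  exact ((d3.mul a2).add (c2.mul a3.der)).sub (c3.mul a2.der)

theorem smoothCoeff_tachHorS (hA : A.Smooth) (hC : C.Smooth) :
    SmoothCoeff (tachHorS A C) := by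
  obtain ⟨a1, -, -, a4, b1, -, -, b4⟩ := hA
  obtain ⟨-, c2, c3, -, d2, d3⟩ := hC
  have ht : ContDiffOn ℝ ∞ (fun t : ℝ => 2 * t) (Set.Ici 0) :=
    (contDiff_const.mul contDiff_id).contDiffOn
  exact ((((d2.mul a1).add ((c2.add (ht.mul d2)).mul b1)).add
    ((c3.add (ht.mul d3)).mul b4)).add (c2.mul a1.der)).add (c3.mul a4.der)

namespace EndoCoeffs.IsComplex

theorem der_a₄ (h : A.IsComplex) (ht : 0 ≤ t) : der A.a₄ t = -der A.a₃ t := by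
  obtain ⟨-, -, a3, a4, -⟩ := h.smooth
  exact hasDerivWithinAt_unique ht (a4.hasDerivWithinAt ht) (a3.hasDerivWithinAt ht).neg
    fun s hs => h.a₄_eq s hs

theorem der_b₄ (h : A.IsComplex) (ht : 0 ≤ t) : der A.b₄ t = -der A.b₃ t := by
  obtain ⟨-, -, -, -, -, -, b3, b4⟩ := h.smooth
  exact hasDerivWithinAt_unique ht (b4.hasDerivWithinAt ht) (b3.hasDerivWithinAt ht).neg
    fun s hs => h.b₄_eq s hs

end EndoCoeffs.IsComplex

namespace MetricCoeffs.IsNorden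

/-- The bracket is the defect of the formula for d₃ in (II). -/
theorem tachVertS_eq (hC : C.IsNorden A) (h : A.IsComplex) (ht : 0 ≤ t) :
    A.a₁ t * tachVertS A C t
      = A.a₂ t * (A.a₁ t * C.d₃ t - (der A.a₃ t * C.c₁ t - der A.a₁ t * C.c₃ t)) := by
  rw [tachVertS]
  linear_combination der A.a₃ t * hC.c_rel t ht - C.c₃ t * h.der_a_rel ht

/-- The relation `d_rel` replaces d₂ by d₁ and d₃; the two integrability equations and the vanishing
of `tachVertS` then eliminate everything but d₁ - c c₂. -/
theorem tachHorS_eq (hC : C.IsNorden A) (h : A.IsComplex) {c : ℝ} (hc : A.NijenhuisEqs c)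
    (ht : 0 ≤ t) (hS : tachVertS A C t = 0) :
    tachHorS A C t = -((A.a₂ t + 2 * t * A.b₂ t) * (C.d₁ t - c * C.c₂ t)) := by
  rw [tachVertS] at hS
  rw [tachHorS, h.der_a₄ ht, h.b₄_eq t ht]
  obtain ⟨n1, n2⟩ := hc t ht
  apply mul_left_cancel₀ (h.a₂_ne_zero ht)
  linear_combination A.a₂ t * hC.d_rel t ht - C.c₃ t * n2 - C.c₂ t * n1
    + (2 * A.a₃ t + 2 * t * A.b₃ t) * hS + C.c₂ t * h.der_a_rel ht - A.b₂ t * hC.c_rel t ht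

/-- By `c_rel` and a₁a₂ = 1 + a₃², the fraction is another way of writing c c₂. -/
theorem d₁_iff (hC : C.IsNorden A) (h : A.IsComplex) (c : ℝ) (ht : 0 ≤ t) :
    C.d₁ t = c * (2 * A.a₁ t * A.a₃ t * C.c₃ t - C.c₁ t * (1 + A.a₃ t ^ 2)) / A.a₁ t ^ 2 ↔
      C.d₁ t = c * C.c₂ t := by
  have h1 := h.a₁_ne_zero ht
  have h2 : c * (2 * A.a₁ t * A.a₃ t * C.c₃ t - C.c₁ t * (1 + A.a₃ t ^ 2)) / A.a₁ t ^ 2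
      = c * C.c₂ t := by
    rw [div_eq_iff (pow_ne_zero 2 h1)]
    linear_combination (-c * A.a₁ t) * hC.c_rel t ht + c * C.c₁ t * h.a_rel t ht
  rw [h2]

/-- The symmetric part of the Tachibana operator vanishes exactly if `d₁`, `d₃` have the
conformally anti-Kähler form. -/
theorem conformalForm_iff (hC : C.IsNorden A) (h : A.IsComplex) {c : ℝ}
    (hc : A.NijenhuisEqs c) :
    ConformalForm A C c ↔ ∀ t, 0 ≤ t → tachVertS A C t = 0 ∧ tachHorS A C t = 0 := by
  have key : ∀ t, 0 ≤ t → (tachVertS A C t = 0 ↔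
      C.d₃ t = (der A.a₃ t * C.c₁ t - der A.a₁ t * C.c₃ t) / A.a₁ t) := by
    intro t ht
    have h1 := h.a₁_ne_zero ht
    have h2 := h.a₂_ne_zero ht
    rw [eq_div_iff h1, ← mul_right_inj' h1, hC.tachVertS_eq h ht, mul_zero, mul_eq_zero,
      or_iff_right h2, sub_eq_zero, mul_comm (A.a₁ t)]
  refine forall₂_congr fun t ht => ?_
  rw [hC.d₁_iff h c ht, ← key t ht, and_comm]
  refine and_congr_right fun hS => ?_
  rw [hC.tachHorS_eq h hc ht hS, neg_eq_zero, mul_eq_zero, or_iff_right (h.cap₂_ne_zero ht),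
    sub_eq_zero]

end MetricCoeffs.IsNorden

/-! ### The Tachibana operator of a conformally anti-Kähler structure -/

/-- The complex function `c₂ - i l`. -/
def gammaC (A : EndoCoeffs) (C : MetricCoeffs) (t : ℝ) : ℂ :=
  C.c₂ t - Complex.I * twinL A C t

/-- The complex function `d₂ - i q`. -/
def deltaC (A : EndoCoeffs) (C : MetricCoeffs) (t : ℝ) : ℂ :=
  C.d₂ t - Complex.I * twinQ A C t

namespace EndoCoeffs.IsComplex

theorem hasDerivWithinAt_s (h : A.IsComplex) (ht : 0 ≤ t) :
    HasDerivWithinAt (fun t => A.sigma t + 2 * t * A.rho t)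
      (derC A.sigma t + 2 * A.rho t + 2 * t * derC A.rho t) (Set.Ici 0) t := by
  have h1 : HasDerivWithinAt (fun t : ℝ => 2 * (t : ℂ)) 2 (Set.Ici 0) t := by
    simpa using ((hasDerivAt_id t).ofReal_comp.hasDerivWithinAt (s := Set.Ici 0)).const_mul
      (2 : ℂ)
  exact ((h.hasDerivWithinAt_sigma ht).add (h1.mul (h.hasDerivWithinAt_rho ht))).congr_deriv
    (by ring)

theorem b₁_eq (h : A.IsComplex) (ht : 0 ≤ t) :
    (A.b₁ t : ℂ) = (A.sigma t + 2 * t * A.rho t) * A.b₃ t + (A.a₃ t + Complex.I) * A.rho t := by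
  have h1 := Complex.ofReal_ne_zero.2 (h.cap₂_ne_zero ht)
  have h2 := congrArg (fun r : ℝ => (r : ℂ)) (h.b_rel t ht)
  push_cast at h1 h2
  apply mul_left_cancel₀ h1
  linear_combination h2 - A.b₃ t * h.cap₂_mul_s ht - (A.a₃ t + Complex.I) * h.cap₂_mul_rho ht
    - A.b₂ t * h.a₁_eq ht

theorem b₃_eq (h : A.IsComplex) (ht : 0 ≤ t) :
    (A.b₃ t : ℂ) = (A.sigma t + 2 * t * A.rho t) * A.b₂ t + A.a₂ t * A.rho t := by
  linear_combination -h.cap₂_mul_rho ht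

theorem der_b₁_eq (h : A.IsComplex) (ht : 0 ≤ t) :
    (der A.b₁ t : ℂ) = (derC A.sigma t + 2 * A.rho t + 2 * t * derC A.rho t) * A.b₃ t
      + (A.sigma t + 2 * t * A.rho t) * der A.b₃ t
      + (der A.a₃ t * A.rho t + (A.a₃ t + Complex.I) * derC A.rho t) := by
  obtain ⟨-, -, a3, -, b1, -, b3, -⟩ := h.smooth
  exact hasDerivWithinAt_unique ht (b1.hasDerivWithinAt_ofReal ht)
    (((h.hasDerivWithinAt_s ht).mul (b3.hasDerivWithinAt_ofReal ht)).add
      (((a3.hasDerivWithinAt_ofReal ht).add_const Complex.I).mul (h.hasDerivWithinAt_rho ht)))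
    fun s hs => h.b₁_eq hs

theorem der_b₃_eq (h : A.IsComplex) (ht : 0 ≤ t) :
    (der A.b₃ t : ℂ) = (derC A.sigma t + 2 * A.rho t + 2 * t * derC A.rho t) * A.b₂ t
      + (A.sigma t + 2 * t * A.rho t) * der A.b₂ t
      + (der A.a₂ t * A.rho t + A.a₂ t * derC A.rho t) := by
  obtain ⟨-, a2, -, -, -, b2, b3, -⟩ := h.smooth
  exact hasDerivWithinAt_unique ht (b3.hasDerivWithinAt_ofReal ht)
    (((h.hasDerivWithinAt_s ht).mul (b2.hasDerivWithinAt_ofReal ht)).add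
      ((a2.hasDerivWithinAt_ofReal ht).mul (h.hasDerivWithinAt_rho ht)))
    fun s hs => h.b₃_eq hs

theorem cap₁_eq (h : A.IsComplex) (ht : 0 ≤ t) :
    (A.a₁ t : ℂ) + 2 * t * A.b₁ t
      = (A.a₃ t + 2 * t * A.b₃ t + Complex.I) * (A.sigma t + 2 * t * A.rho t) := by
  linear_combination h.a₁_eq ht + 2 * t * h.b₁_eq ht

/-- With s = σ + 2tρ, the vector s y^V - y^H is a -i eigenvector of J. In this complex direction the
real coefficients of S combine to an expression in γ and ρ; `tachB_eq` is the analogue with δ. -/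
theorem tachA_eq (h : A.IsComplex) (ht : 0 ≤ t) :
    Complex.I * ((A.sigma t + 2 * t * A.rho t) * tachVertA A C t - tachHorA A C t)
      = (A.sigma t + 2 * t * A.rho t) * (der C.c₂ t - Complex.I * der (twinL A C) t)
        + 2 * gammaC A C t * A.rho t := by
  rw [tachVertA, tachHorA, gammaC, h.b₄_eq t ht]
  unfold twinL
  push_cast
  linear_combination (-Complex.I * der C.c₂ t) * h.cap₁_eq ht
    - 2 * Complex.I * C.c₂ t * h.b₁_eq ht + 2 * Complex.I * C.c₃ t * h.b₃_eq ht
    - (der C.c₂ t * (A.sigma t + 2 * t * A.rho t) + 2 * C.c₂ t * A.rho t) * Complex.I_sq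

theorem tachB_eq (h : A.IsComplex) (ht : 0 ≤ t) (hS : tachVertS A C t = 0) :
    Complex.I * ((A.sigma t + 2 * t * A.rho t) * tachVertB A C t - tachHorB A C t)
      = (A.sigma t + 2 * t * A.rho t) * (der C.d₂ t - Complex.I * der (twinQ A C) t)
        + 4 * deltaC A C t * A.rho t + 2 * deltaC A C t * derC A.sigma t
        + 2 * (gammaC A C t + 2 * t * deltaC A C t) * derC A.rho t := by
  have hS' := congrArg (fun r : ℝ => (r : ℂ)) hS
  simp only [tachVertS] at hS'
  rw [tachVertB, tachHorB, gammaC, deltaC, h.b₄_eq t ht, h.der_b₄ ht, h.der_a₄ ht]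
  unfold twinL
  rw [show twinQ A C t = (C.c₂ t + 2 * t * C.d₂ t) * A.b₃ t + C.d₂ t * A.a₃ t
    - ((C.c₃ t + 2 * t * C.d₃ t) * A.b₂ t + C.d₃ t * A.a₂ t) from rfl]
  push_cast at hS' ⊢
  linear_combination (-Complex.I * der C.d₂ t) * h.cap₁_eq ht
    - 2 * Complex.I * (C.c₂ t + 2 * t * C.d₂ t) * h.der_b₁_eq ht
    + 2 * Complex.I * (C.c₃ t + 2 * t * C.d₃ t) * h.der_b₃_eq ht
    - 2 * Complex.I * C.d₂ t * h.der_a₁_eq ht - 2 * Complex.I * C.d₃ t * h.a₂_mul_derC_sigma ht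
    - 4 * Complex.I * C.d₂ t * h.b₁_eq ht + 2 * Complex.I * C.d₃ t * h.b₃_eq ht
    - 2 * Complex.I * A.rho t * hS'
    - (der C.d₂ t * (A.sigma t + 2 * t * A.rho t)
      + 2 * ((C.c₂ t + 2 * t * C.d₂ t) * derC A.rho t + C.d₂ t * derC A.sigma t
        + 2 * C.d₂ t * A.rho t)) * Complex.I_sq

/-- The two real conditions merge into one complex relation through the combination σ `tachVertS` -
`tachHorS`. -/
theorem deltaC_mul_s (h : A.IsComplex) (ht : 0 ≤ t) (hS : tachVertS A C t = 0)
    (hS' : tachHorS A C t = 0) :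
    deltaC A C t * (A.sigma t + 2 * t * A.rho t)
      + gammaC A C t * (derC A.sigma t + A.rho t) = 0 := by
  have k1 := congrArg (fun r : ℝ => (r : ℂ)) hS
  have k2 := congrArg (fun r : ℝ => (r : ℂ)) hS'
  simp only [tachVertS, tachHorS, h.der_a₄ ht, h.b₄_eq t ht] at k1 k2
  rw [gammaC, deltaC, twinL, twinQ]
  push_cast at k1 k2 ⊢
  linear_combination Complex.I * A.sigma t * k1 - Complex.I * k2
    + Complex.I * C.c₂ t * h.der_a₁_eq ht + Complex.I * C.c₃ t * h.a₂_mul_derC_sigma ht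
    + Complex.I * C.d₂ t * h.a₁_eq ht + Complex.I * (C.c₂ t + 2 * t * C.d₂ t) * h.b₁_eq ht
    - Complex.I * (C.c₃ t + 2 * t * C.d₃ t) * h.b₃_eq ht
    + (C.d₂ t * (A.sigma t + 2 * t * A.rho t) + C.c₂ t * (A.rho t + derC A.sigma t))
      * Complex.I_sq

/-- Differentiating `derC_sigma_eq` and `deltaC_mul_s` gives two relations containing σ''.
Eliminating σ'' between them, and using `deltaC_mul_s` once more, yields the claim multiplied by σ +
2tρ. -/
theorem tachibana_compat (h : A.IsComplex) (hC : C.Smooth) {c : ℝ} (hc : A.NijenhuisEqs c)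
    (hS : ∀ t, 0 ≤ t → tachVertS A C t = 0 ∧ tachHorS A C t = 0) (ht : 0 ≤ t) :
    (A.sigma t + 2 * t * A.rho t) * (der C.c₂ t - Complex.I * der (twinL A C) t) * deltaC A C t
      + 2 * gammaC A C t * A.rho t * deltaC A C t
    = ((A.sigma t + 2 * t * A.rho t) * (der C.d₂ t - Complex.I * der (twinQ A C) t)
        + 4 * deltaC A C t * A.rho t + 2 * deltaC A C t * derC A.sigma t
        + 2 * (gammaC A C t + 2 * t * deltaC A C t) * derC A.rho t) * gammaC A C t := by
  have hγ : HasDerivWithinAt (gammaC A C) (der C.c₂ t - Complex.I * der (twinL A C) t)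
      (Set.Ici 0) t :=
    (hC.2.1.hasDerivWithinAt_ofReal ht).sub
      (((smoothCoeff_twinL h.smooth hC).hasDerivWithinAt_ofReal ht).const_mul Complex.I)
  have hδ : HasDerivWithinAt (deltaC A C) (der C.d₂ t - Complex.I * der (twinQ A C) t)
      (Set.Ici 0) t :=
    (hC.2.2.2.2.1.hasDerivWithinAt_ofReal ht).sub
      (((smoothCoeff_twinQ h.smooth hC).hasDerivWithinAt_ofReal ht).const_mul Complex.I)
  have e1 := h.derC_sigma_eq hc ht
  have e2 := hasDerivWithinAt_unique ht
    ((((h.hasDerivWithinAt_s ht).mul (h.hasDerivWithinAt_derC_sigma ht)).sub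
      ((h.hasDerivWithinAt_rho ht).mul (h.hasDerivWithinAt_sigma ht))).add_const (c : ℂ))
    (hasDerivWithinAt_const t (Set.Ici 0) 0) fun s hs => h.derC_sigma_eq hc hs
  have e3 := h.deltaC_mul_s ht (hS t ht).1 (hS t ht).2
  have e4 := hasDerivWithinAt_unique ht
    ((hδ.mul (h.hasDerivWithinAt_s ht)).add
      (hγ.mul ((h.hasDerivWithinAt_derC_sigma ht).add (h.hasDerivWithinAt_rho ht))))
    (hasDerivWithinAt_const t (Set.Ici 0) 0)
    fun s hs => h.deltaC_mul_s hs (hS s hs).1 (hS s hs).2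
  apply mul_left_cancel₀ (h.s_ne_zero ht)
  simp only [Pi.add_apply] at e2 e4
  generalize der C.c₂ t - Complex.I * der (twinL A C) t = γ' at *
  generalize der C.d₂ t - Complex.I * der (twinQ A C) t = δ' at *
  generalize gammaC A C t = γ, deltaC A C t = δ at *
  generalize derC (derC A.sigma) t = σ₂, derC A.sigma t = σ₁, derC A.rho t = ρ₁, A.sigma t = σ,
    A.rho t = ρ at *
  linear_combination (σ + 2 * t * ρ) * γ' * e3 - (σ + 2 * t * ρ) * γ * e4 + γ ^ 2 * e2
    - γ * (σ₁ + 2 * t * ρ₁) * e3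

/-- The Tachibana operator of a structure of conformally anti-Kähler form is of pure trace. -/
theorem exists_tachibana_form (h : A.IsComplex) (hC : C.IsNorden A) {c : ℝ}
    (hc : A.NijenhuisEqs c)
    (hS : ∀ t, 0 ≤ t → tachVertS A C t = 0 ∧ tachHorS A C t = 0) (ht : 0 ≤ t) :
    ∃ p φ p' φ' : ℝ, p' = (A.a₃ t + 2 * t * A.b₃ t) * p - (A.a₂ t + 2 * t * A.b₂ t) * φ ∧
      φ' = (A.a₁ t + 2 * t * A.b₁ t) * p - (A.a₃ t + 2 * t * A.b₃ t) * φ ∧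
      tachVertA A C t = C.c₂ t * p + twinL A C t * p' ∧
      tachVertB A C t = C.d₂ t * p + twinQ A C t * p' ∧
      tachHorA A C t = C.c₂ t * φ + twinL A C t * φ' ∧
      tachHorB A C t = C.d₂ t * φ + twinQ A C t * φ' := by
  -- A zero of γ would give c₂ = 0 and then a₂c₃ = 0, against nondegeneracy.
  have hγ : gammaC A C t ≠ 0 := by
    intro h0
    have h1 := congrArg Complex.re h0
    have h2 := congrArg Complex.im h0
    simp [gammaC] at h1 h2
    rw [twinL, h1] at h2
    have h3 : C.c₃ t = 0 := by simpa [h.a₂_ne_zero ht] using h2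
    rcases hC.ne t ht with h4 | h4
    · exact h4 h1
    · exact h4 h3
  have hA2 := h.cap₂_ne_zero ht
  -- Because J y^V = (a₃ + 2tb₃)y^V - (a₂ + 2tb₂)y^H, the numbers α and β collect the coefficients
  -- of S(y^V, ·, ·) + iS(J y^V, ·, ·).
  obtain ⟨α, hα⟩ : ∃ α : ℂ, α = tachVertA A C t + Complex.I * ((A.a₃ t + 2 * t * A.b₃ t)
      * tachVertA A C t - (A.a₂ t + 2 * t * A.b₂ t) * tachHorA A C t) := ⟨_, rfl⟩
  obtain ⟨β, hβ⟩ : ∃ β : ℂ, β = tachVertB A C t + Complex.I * ((A.a₃ t + 2 * t * A.b₃ t)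
      * tachVertB A C t - (A.a₂ t + 2 * t * A.b₂ t) * tachHorB A C t) := ⟨_, rfl⟩
  have hcompat : α * deltaC A C t = β * gammaC A C t := by
    have e1 := h.tachA_eq (C := C) ht
    have e2 := h.tachB_eq ht (hS t ht).1
    have e3 := h.cap₂_mul_s ht
    have e4 := h.tachibana_compat hC.smooth hc hS ht
    have e5 : α = (A.a₂ t + 2 * t * A.b₂ t) * (Complex.I * ((A.sigma t + 2 * t * A.rho t)
        * tachVertA A C t - tachHorA A C t)) := by
      rw [hα]
      linear_combination (-Complex.I * tachVertA A C t) * e3 + tachVertA A C t * Complex.I_sq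
    have e6 : β = (A.a₂ t + 2 * t * A.b₂ t) * (Complex.I * ((A.sigma t + 2 * t * A.rho t)
        * tachVertB A C t - tachHorB A C t)) := by
      rw [hβ]
      linear_combination (-Complex.I * tachVertB A C t) * e3 + tachVertB A C t * Complex.I_sq
    rw [e5, e6, e1, e2]
    linear_combination (A.a₂ t + 2 * t * A.b₂ t) * e4
  -- The real part of Θ is p and its imaginary part is p'; φ is then determined by p'.
  obtain ⟨Θ, hΘ⟩ : ∃ Θ, Θ = α / gammaC A C t := ⟨_, rfl⟩
  have k1 : gammaC A C t * Θ = α := by rw [hΘ]; field_simp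
  have k2 : deltaC A C t * Θ = β := by
    rw [hΘ, mul_div_assoc', div_eq_iff hγ, mul_comm, hcompat]
  rw [hα] at k1
  rw [hβ] at k2
  have r1 := congrArg Complex.re k1
  have i1 := congrArg Complex.im k1
  have r2 := congrArg Complex.re k2
  have i2 := congrArg Complex.im k2
  simp [gammaC, deltaC] at r1 i1 r2 i2
  have hφ : (A.a₂ t + 2 * t * A.b₂ t)
      * (((A.a₃ t + 2 * t * A.b₃ t) * Θ.re - Θ.im) / (A.a₂ t + 2 * t * A.b₂ t))
      = (A.a₃ t + 2 * t * A.b₃ t) * Θ.re - Θ.im := by field_simp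
  refine ⟨Θ.re, ((A.a₃ t + 2 * t * A.b₃ t) * Θ.re - Θ.im) / (A.a₂ t + 2 * t * A.b₂ t), Θ.im, _,
    ?_, rfl, ?_, ?_, ?_, ?_⟩
  · rw [hφ]; ring
  · linarith
  · linarith
  · apply mul_left_cancel₀ hA2
    generalize ((A.a₃ t + 2 * t * A.b₃ t) * Θ.re - Θ.im) / (A.a₂ t + 2 * t * A.b₂ t) = φ at *
    linear_combination i1 - (A.a₃ t + 2 * t * A.b₃ t) * r1 - twinL A C t * Θ.re * h.cap_rel ht
      + (twinL A C t * (A.a₃ t + 2 * t * A.b₃ t) - C.c₂ t) * hφ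
  · apply mul_left_cancel₀ hA2
    generalize ((A.a₃ t + 2 * t * A.b₃ t) * Θ.re - Θ.im) / (A.a₂ t + 2 * t * A.b₂ t) = φ at *
    linear_combination i2 - (A.a₃ t + 2 * t * A.b₃ t) * r2 - twinQ A C t * Θ.re * h.cap_rel ht
      + (twinQ A C t * (A.a₃ t + 2 * t * A.b₃ t) - C.d₂ t) * hφ

end EndoCoeffs.IsComplex

section Relations

variable {n : ℕ} {m : (Fin n → ℝ) → Matrix (Fin n) (Fin n) ℝ} {U : Set (Fin n → ℝ)}
  {z : Fin n ⊕ Fin n → ℝ} {A : EndoCoeffs} {C : MetricCoeffs}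

/-! ### Relations between the coefficients -/

/-- A multiple of the first coordinate vector serves as y, and X is the component of the second one
orthogonal to it. For t = 0 this gives y = 0, and X is still available. -/
theorem exists_energy_eq (hm : IsMetricOn m U) {x : Fin n → ℝ} (hx : x ∈ U) (hn : 2 ≤ n) {t : ℝ}
    (ht : 0 ≤ t) : ∃ z : Fin n ⊕ Fin n → ℝ, basePt z = x ∧ energy m z = t ∧
      ∃ X, ip m (basePt z) X (fibrePt z) = 0 ∧ X ≠ 0 := by
  set e₀ : Fin n → ℝ := Pi.single ⟨0, by omega⟩ 1 with he₀
  set e₁ : Fin n → ℝ := Pi.single ⟨1, by omega⟩ 1 with he₁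
  have h0 : e₀ ≠ 0 := fun h => by simpa [he₀] using congrFun h ⟨0, by omega⟩
  have hp := hm.pos x hx e₀ h0
  refine ⟨Sum.elim x (√(2 * t / ip m x e₀ e₀) • e₀), rfl, ?_,
    e₁ - (ip m x e₁ e₀ / ip m x e₀ e₀) • e₀, ?_, fun h => ?_⟩
  · change 1 / 2 * ip m x (√(2 * t / ip m x e₀ e₀) • e₀) (√(2 * t / ip m x e₀ e₀) • e₀) = t
    rw [ip_smul_left, ip_smul_right, ← mul_assoc (√_), Real.mul_self_sqrt (by positivity)]
    field_simp
  · change ip m x _ (√(2 * t / ip m x e₀ e₀) • e₀) = 0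
    rw [ip_smul_right, ip_sub_left, ip_smul_left, div_mul_cancel₀ _ hp.ne', sub_self, mul_zero]
  · have := congrFun h ⟨1, by omega⟩
    simp [he₀, he₁] at this

theorem bilinMap_metricLift (C : MetricCoeffs) (v w : Fin n ⊕ Fin n → ℝ) :
    bilinMap (metricLift m C z) v w = metricForm m C z v w := bilin_metricLift C v w

theorem natEndo_of_ip_eq_zero (a b : ℝ → ℝ) {X : Fin n → ℝ}
    (hX : ip m (basePt z) X (fibrePt z) = 0) :
    natEndo m a b z X = a (energy m z) • X := by
  simp [natEndo, hX]

theorem natEndo_fibrePt (a b : ℝ → ℝ) :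
    natEndo m a b z (fibrePt z)
      = (a (energy m z) + 2 * energy m z * b (energy m z)) • fibrePt z := by
  simp only [natEndo, ip_fibrePt_self]; module

/-- A rank-one perturbation of a multiple of the identity: it acts by a on the complement of y and
by a + 2tb on y, and the preimage is given by the explicit inverse. -/
theorem natEndo_surjective {a b : ℝ → ℝ} (h1 : a (energy m z) ≠ 0)
    (h2 : a (energy m z) + 2 * energy m z * b (energy m z) ≠ 0) (V : Fin n → ℝ) :
    ∃ X, natEndo m a b z X = V := by
  obtain ⟨s, hs⟩ : ∃ s, s = a (energy m z) + 2 * energy m z * b (energy m z) := ⟨_, rfl⟩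
  rw [← hs] at h2
  refine ⟨(a (energy m z))⁻¹ • V - (b (energy m z) * ip m (basePt z) V (fibrePt z)
    / (a (energy m z) * s)) • fibrePt z, ?_⟩
  simp only [natEndo, ip_sub_left, ip_smul_left, ip_fibrePt_self]
  funext i
  simp only [Pi.add_apply, Pi.smul_apply, Pi.sub_apply, smul_eq_mul]
  field_simp
  rw [hs]
  ring

theorem fibrePt_ne_zero (hz : energy m z ≠ 0) : fibrePt z ≠ 0 := by
  intro h
  apply hz
  simp [energy, h, ip_zero_left]

/-- The relations implied by `J² = -1`. -/
theorem isComplex_of_sq (hm : IsMetricOn m U) {x : Fin n → ℝ} (hx : x ∈ U) (hn : 2 ≤ n)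
    (hA : A.Smooth) (hsq : ∀ z, basePt z ∈ U → endoLift m A z * endoLift m A z = -1) :
    A.IsComplex := by
  have h2 : ∀ z, basePt z ∈ U → ∀ w, endoLift m A z *ᵥ (endoLift m A z *ᵥ w) = -w :=
    fun z hz w => by
      rw [Matrix.mulVec_mulVec, hsq z hz, Matrix.neg_mulVec, Matrix.one_mulVec]
  -- Tested on X orthogonal to y, which is possible for every t ≥ 0.
  have key1 : ∀ t, 0 ≤ t → A.a₁ t * A.a₂ t = 1 + A.a₃ t ^ 2 ∧ A.a₄ t = -A.a₃ t := by
    intro t ht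
    obtain ⟨z, rfl, hz, X, hX, hX0⟩ := exists_energy_eq hm hx hn ht
    have h3 := h2 z hx (vertLift X)
    have h4 := congrArg horPart h3
    have h5 := congrArg (vertPart m z) h3
    rw [← neg_one_smul ℝ] at h4 h5
    simp only [horPart_endoLift_mulVec, vertPart_endoLift_mulVec, horPart_smul, vertPart_smul,
      horPart_vertLift, vertPart_vertLift, natEndo_zero, zero_sub, zero_add, natEndo_neg,
      natEndo_of_ip_eq_zero _ _ hX, natEndo_smul, hz, smul_zero, smul_smul] at h4 h5
    rw [← sub_eq_zero] at h4 h5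
    have h6 : (1 + A.a₃ t ^ 2 - A.a₁ t * A.a₂ t) • X = 0 := by rw [← h5]; module
    have h7 : (A.a₂ t * (A.a₄ t + A.a₃ t)) • X = 0 := by
      rw [← neg_eq_zero, ← h4]; module
    have h8 := (smul_eq_zero.1 h6).resolve_right hX0
    have h9 := (smul_eq_zero.1 h7).resolve_right hX0
    have h10 : A.a₂ t ≠ 0 := by
      intro h0
      rw [h0] at h8
      nlinarith [sq_nonneg (A.a₃ t)]
    exact ⟨by linarith, by linarith [(mul_eq_zero.1 h9).resolve_left h10]⟩
  -- Tested on y itself. The difference to `key1` is 2t times the relation for the b's, so it is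
  -- divided by 2t and extended to t = 0 by continuity.
  have key2 : ∀ t, 0 < t → (A.a₁ t + 2 * t * A.b₁ t) * (A.a₂ t + 2 * t * A.b₂ t)
      = 1 + (A.a₃ t + 2 * t * A.b₃ t) ^ 2 ∧
      A.a₄ t + 2 * t * A.b₄ t = -(A.a₃ t + 2 * t * A.b₃ t) := by
    intro t ht
    obtain ⟨z, rfl, hz, -⟩ := exists_energy_eq hm hx hn ht.le
    have hy := fibrePt_ne_zero (by rw [hz]; exact ht.ne' : energy m z ≠ 0)
    have h3 := h2 z hx (vertLift (fibrePt z))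
    have h4 := congrArg horPart h3
    have h5 := congrArg (vertPart m z) h3
    rw [← neg_one_smul ℝ] at h4 h5
    simp only [horPart_endoLift_mulVec, vertPart_endoLift_mulVec, horPart_smul, vertPart_smul,
      horPart_vertLift, vertPart_vertLift, natEndo_zero, zero_sub, zero_add, natEndo_neg,
      natEndo_fibrePt, natEndo_smul, hz, smul_zero, smul_smul] at h4 h5
    rw [← sub_eq_zero] at h4 h5
    have h6 : (1 + (A.a₃ t + 2 * t * A.b₃ t) ^ 2
        - (A.a₁ t + 2 * t * A.b₁ t) * (A.a₂ t + 2 * t * A.b₂ t)) • fibrePt z = 0 := by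
      rw [← h5]; module
    have h7 : ((A.a₂ t + 2 * t * A.b₂ t) * (A.a₄ t + 2 * t * A.b₄ t
        + (A.a₃ t + 2 * t * A.b₃ t))) • fibrePt z = 0 := by
      rw [← neg_eq_zero, ← h4]; module
    have h8 := (smul_eq_zero.1 h6).resolve_right hy
    have h9 := (smul_eq_zero.1 h7).resolve_right hy
    have h10 : A.a₂ t + 2 * t * A.b₂ t ≠ 0 := by
      intro h0
      rw [h0] at h8
      nlinarith [sq_nonneg (A.a₃ t + 2 * t * A.b₃ t)]
    exact ⟨by linarith, by linarith [(mul_eq_zero.1 h9).resolve_left h10]⟩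
  have hA' := hA
  obtain ⟨a1, a2, a3, a4, b1, b2, b3, b4⟩ := hA
  refine ⟨hA', fun t ht => (key1 t ht).2, fun t ht => ?_, fun t ht => (key1 t ht).1,
    fun t ht => ?_⟩
  · refine eq_of_eq_of_pos b4.continuousOn b3.continuousOn.neg (fun t ht => ?_) ht
    have h3 := (key2 t ht).2
    have h4 := (key1 t ht.le).2
    have h5 : 2 * t * (A.b₄ t + A.b₃ t) = 0 := by linarith
    have h6 := (mul_eq_zero.1 h5).resolve_left (by positivity)
    change A.b₄ t = -A.b₃ t
    linarith
  · have c1 := a1.continuousOn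
    have c2 := a2.continuousOn
    have c3 := a3.continuousOn
    have d1 := b1.continuousOn
    have d2 := b2.continuousOn
    have d3 := b3.continuousOn
    refine eq_of_eq_of_pos (f := fun t => A.b₁ t * A.a₂ t + A.a₁ t * A.b₂ t
      + 2 * t * (A.b₁ t * A.b₂ t)) (g := fun t => 2 * A.a₃ t * A.b₃ t + 2 * t * A.b₃ t ^ 2)
      (by fun_prop) (by fun_prop) (fun t ht => ?_) ht
    have h3 := (key2 t ht).1
    have h4 := (key1 t ht.le).1
    apply mul_left_cancel₀ (by positivity : 2 * t ≠ 0)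
    linarith

theorem complexJet_endoLift (hm : IsMetricOn m U) (hz : basePt z ∈ U) (hA : A.Smooth)
    (hsq : ∀ z, basePt z ∈ U → endoLift m A z * endoLift m A z = -1) :
    ComplexJet (endoLift m A z).mulVecLin (derivEndo (endoLift m A) z) :=
  complexJet_of_sq (differentiableAt_endoLift hm hz hA)
    ((eventually_basePt_mem hm hz).mono hsq)

theorem nordenJet_lift (hm : IsMetricOn m U) (hz : basePt z ∈ U) (hA : A.Smooth) (hC : C.Smooth)
    (hsq : ∀ z, basePt z ∈ U → endoLift m A z * endoLift m A z = -1)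
    (hdet : ∀ z, basePt z ∈ U → (metricLift m C z).det ≠ 0)
    (hGJ : ∀ z, basePt z ∈ U → (endoLift m A z)ᵀ * metricLift m C z * endoLift m A z
      = -metricLift m C z) :
    NordenJet (endoLift m A z).mulVecLin (derivEndo (endoLift m A) z)
      (bilinMap (metricLift m C z)) (derivForm (metricLift m C) z)
      (gammaMap (metricLift m C) z) :=
  nordenJet (differentiableAt_endoLift hm hz hA) (differentiableAt_metricLift hm hz hC)
    ((eventually_basePt_mem hm hz).mono hsq)
    ((eventually_basePt_mem hm hz).mono fun _ hw _ _ => metricForm_comm hm hw C _ _)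
    (hdet z hz) ((eventually_basePt_mem hm hz).mono hGJ)

/-- The relations implied by `G(JX, JY) = -G(X, Y)` and nondegeneracy. -/
theorem isNorden_of_nordenJet (hm : IsMetricOn m U) {x : Fin n → ℝ} (hx : x ∈ U) (hn : 2 ≤ n)
    (h : A.IsComplex) (hC : C.Smooth)
    (hJet : ∀ z, basePt z ∈ U → NordenJet (endoLift m A z).mulVecLin
      (derivEndo (endoLift m A) z) (bilinMap (metricLift m C z)) (derivForm (metricLift m C) z)
      (gammaMap (metricLift m C) z)) :
    C.IsNorden A := by
  have hsa : ∀ z, basePt z ∈ U → ∀ v w, metricForm m C z (endoLift m A z *ᵥ v) w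
      = metricForm m C z v (endoLift m A z *ᵥ w) := fun z hz v w => by
    have := (hJet z hz).selfAdjoint v w
    rwa [bilinMap_metricLift, bilinMap_metricLift] at this
  have key1 : ∀ t, 0 ≤ t → A.a₁ t * C.c₂ t = 2 * (A.a₃ t * C.c₃ t) - A.a₂ t * C.c₁ t := by
    intro t ht
    obtain ⟨z, rfl, hz, X, hX, hX0⟩ := exists_energy_eq hm hx hn ht
    have h3 := hsa z hx (vertLift X) (horLift m z X)
    simp only [metricForm_eq, horPart_endoLift_mulVec, vertPart_endoLift_mulVec,
      horPart_vertLift, vertPart_vertLift, horPart_horLift, vertPart_horLift, natEndo_zero,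
      zero_sub, zero_add, sub_zero, add_zero, natEndo_of_ip_eq_zero _ _ hX, hz] at h3
    simp only [natForm, ip_neg_left, ip_smul_left, ip_smul_right, hX, ip_zero_left,
      ip_zero_right, hz, h.a₄_eq t ht] at h3
    apply mul_right_cancel₀ (hm.pos _ hx X hX0).ne'
    linarith
  have key2 : ∀ t, 0 < t → (A.a₁ t + 2 * t * A.b₁ t) * (C.c₂ t + 2 * t * C.d₂ t)
      = 2 * ((A.a₃ t + 2 * t * A.b₃ t) * (C.c₃ t + 2 * t * C.d₃ t))
        - (A.a₂ t + 2 * t * A.b₂ t) * (C.c₁ t + 2 * t * C.d₁ t) := by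
    intro t ht
    obtain ⟨z, rfl, hz, -⟩ := exists_energy_eq hm hx hn ht.le
    have h3 := hsa z hx (vertLift (fibrePt z)) (horLift m z (fibrePt z))
    simp only [metricForm_eq, horPart_endoLift_mulVec, vertPart_endoLift_mulVec,
      horPart_vertLift, vertPart_vertLift, horPart_horLift, vertPart_horLift, natEndo_zero,
      zero_sub, zero_add, sub_zero, add_zero, natEndo_fibrePt, hz] at h3
    simp only [natForm, ip_neg_left, ip_smul_left, ip_smul_right, ip_fibrePt_self, ip_zero_left,
      ip_zero_right, hz, h.a₄_eq t ht.le, h.b₄_eq t ht.le] at h3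
    apply mul_right_cancel₀ (by positivity : 2 * t ≠ 0)
    linarith
  -- If c₂ = c₃ = 0, the vertical lift of X orthogonal to y would lie in the radical of G.
  have ne : ∀ t, 0 ≤ t → C.c₂ t ≠ 0 ∨ C.c₃ t ≠ 0 := by
    intro t ht
    by_contra! h0
    obtain ⟨z, rfl, hz, X, hX, hX0⟩ := exists_energy_eq hm hx hn ht
    have h3 := (hJet z hx).nondeg (vertLift X) fun w => by
      rw [bilinMap_metricLift, metricForm_comm hm hx, metricForm_vertLift]
      simp only [natForm, hz, h0.1, h0.2, hX]
      ring
    apply hX0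
    rw [← vertPart_vertLift (m := m) (z := z) X, h3]
    simpa using vertPart_smul (m := m) (z := z) 0 (0 : Fin n ⊕ Fin n → ℝ)
  refine ⟨hC, ne, key1, fun t ht => ?_⟩
  obtain ⟨a1, a2, a3, a4, b1, b2, b3, b4⟩ := h.smooth
  obtain ⟨c1, c2, c3, d1, d2, d3⟩ := hC
  replace a1 := a1.continuousOn
  replace a2 := a2.continuousOn
  replace a3 := a3.continuousOn
  replace b1 := b1.continuousOn
  replace b2 := b2.continuousOn
  replace b3 := b3.continuousOn
  replace c1 := c1.continuousOn
  replace c2 := c2.continuousOn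
  replace c3 := c3.continuousOn
  replace d1 := d1.continuousOn
  replace d2 := d2.continuousOn
  replace d3 := d3.continuousOn
  refine eq_of_eq_of_pos (f := fun t => A.b₁ t * C.c₂ t + (A.a₁ t + 2 * t * A.b₁ t) * C.d₂ t)
    (g := fun t => 2 * (A.b₃ t * C.c₃ t + (A.a₃ t + 2 * t * A.b₃ t) * C.d₃ t)
      - (A.b₂ t * C.c₁ t + (A.a₂ t + 2 * t * A.b₂ t) * C.d₁ t))
    (by fun_prop) (by fun_prop) (fun t ht => ?_) ht
  have h3 := key2 t ht
  have h4 := key1 t ht.le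
  apply mul_left_cancel₀ (by positivity : 2 * t ≠ 0)
  linarith

/-- The vertical lifts form a totally real subspace. -/
theorem exists_vertLift_add (h : A.IsComplex) (hm : IsMetricOn m U) (hz : basePt z ∈ U)
    (w : Fin n ⊕ Fin n → ℝ) : ∃ X₁ ∈ Set.range vertLift, ∃ X₂ ∈ Set.range vertLift,
      w = X₁ + (endoLift m A z).mulVecLin X₂ := by
  have ht := energy_nonneg hm hz
  obtain ⟨X, hX⟩ := natEndo_surjective (h.a₂_ne_zero ht) (h.cap₂_ne_zero ht) (-horPart w)
  refine ⟨_, ⟨vertPart m z w - natEndo m A.a₃ A.b₃ z X, rfl⟩, _, ⟨X, rfl⟩, ?_⟩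
  rw [Matrix.mulVecLin_apply]
  apply ext_parts m z
  · rw [horPart_add, horPart_endoLift_mulVec, horPart_vertLift, horPart_vertLift,
      vertPart_vertLift, natEndo_zero, hX]
    simp
  · rw [vertPart_add, vertPart_endoLift_mulVec, horPart_vertLift, vertPart_vertLift,
      vertPart_vertLift, natEndo_zero]
    simp

end Relations

section Integrability

variable {n : ℕ} {m : (Fin n → ℝ) → Matrix (Fin n) (Fin n) ℝ} {U : Set (Fin n → ℝ)}
  {z : Fin n ⊕ Fin n → ℝ} {A : EndoCoeffs}

/-! ### Integrability and constant curvature -/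

theorem curvatureVec_single (x : Fin n → ℝ) (h k i j : Fin n) :
    curvatureVec m x (Pi.single i 1) (Pi.single j 1) (Pi.single k 1) h
      = curvature m h k i j x := by
  simp [curvatureVec, Pi.single_apply]

theorem curvatureVec_smul (x V W Y : Fin n → ℝ) (r : ℝ) :
    curvatureVec m x V W (r • Y) = r • curvatureVec m x V W Y := by
  funext h
  simp only [curvatureVec, Pi.smul_apply, smul_eq_mul, Finset.mul_sum]
  exact Finset.sum_congr rfl fun k _ => Finset.sum_congr rfl fun i _ =>
    Finset.sum_congr rfl fun j _ => by ring

theorem ip_single_single (x : Fin n → ℝ) (i j : Fin n) :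
    ip m x (Pi.single i 1) (Pi.single j 1) = m x i j := by
  simp [ip, Pi.single_apply]

theorem curvatureVec_of_const (hm : IsMetricOn m U) {x : Fin n → ℝ} (hx : x ∈ U) {c : ℝ}
    (hc : ∀ h k i j, curvature m h k i j x
      = c * ((if h = i then 1 else 0) * m x k j - (if h = j then 1 else 0) * m x k i))
    (V W Y : Fin n → ℝ) :
    curvatureVec m x V W Y = (-c) • (ip m x V Y • W - ip m x W Y • V) := by
  rw [neg_smul, ← smul_neg, neg_sub]
  funext h
  simp only [curvatureVec, hc, Pi.smul_apply, Pi.sub_apply, smul_eq_mul]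
  rw [hm.ip_comm hx W Y, hm.ip_comm hx V Y]
  simp only [ip, Finset.sum_mul, mul_sub, Finset.mul_sum, sub_mul, Finset.sum_sub_distrib]
  congr 1
  · refine Finset.sum_congr rfl fun k _ => ?_
    rw [Finset.sum_eq_single h]
    · exact Finset.sum_congr rfl fun j _ => by rw [if_pos rfl]; ring
    · intro i _ hi
      simp [hi.symm]
    · simp
  · refine Finset.sum_congr rfl fun k _ => Finset.sum_congr rfl fun i _ => ?_
    rw [Finset.sum_eq_single h]
    · rw [if_pos rfl]; ring
    · intro j _ hj
      simp [hj.symm]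
    · simp

theorem wedgeY_natEndo (a b : ℝ → ℝ) (X Y : Fin n → ℝ) :
    wedgeY m z (natEndo m a b z X) (natEndo m a b z Y)
      = (a (energy m z) * (a (energy m z) + 2 * energy m z * b (energy m z)))
        • wedgeY m z X Y := by
  simp only [wedgeY, natEndo, ip_add_left, ip_smul_left, ip_fibrePt_self]
  module

theorem wedgeY_fibrePt {X : Fin n → ℝ} (hX : ip m (basePt z) X (fibrePt z) = 0) :
    wedgeY m z X (fibrePt z) = (-(2 * energy m z)) • X := by
  simp only [wedgeY, hX, ip_fibrePt_self]
  module

theorem nijJet_vertLift_eq_zero_iff (h : A.IsComplex) (hm : IsMetricOn m U) (hz : basePt z ∈ U)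
    {t : ℝ} (ht : energy m z = t) (X Y : Fin n → ℝ) :
    nijJet (endoLift m A z).mulVecLin (derivEndo (endoLift m A) z) (vertLift X) (vertLift Y) = 0
      ↔ (-der A.a₂ t * (A.a₃ t + 2 * t * A.b₃ t) + 2 * A.b₂ t * A.a₃ t - A.a₃ t * der A.a₂ t
          + A.a₂ t * (der A.a₃ t - A.b₃ t)) • wedgeY m z X Y = 0 ∧
        (2 * t * A.b₃ t * der A.a₃ t + A.a₁ t * (der A.a₂ t - A.b₂ t)) • wedgeY m z X Y
          = curvatureVec m (basePt z) (natEndo m A.a₂ A.b₂ z X) (natEndo m A.a₂ A.b₂ z Y)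
            (fibrePt z) := by
  have h0 := energy_nonneg hm hz
  rw [nijJet_vertLift hm hz h.smooth (h.a₄_eq _ h0) (h.b₄_eq _ h0), ht]
  constructor
  · intro H
    have h1 := congrArg horPart H
    have h2 := congrArg (vertPart m z) H
    rw [horPart_add, horPart_horLift, horPart_vertLift, add_zero] at h1
    rw [vertPart_add, vertPart_horLift, vertPart_vertLift, zero_add] at h2
    have h3 : vertPart m z (0 : Fin n ⊕ Fin n → ℝ) = 0 := by
      simpa using vertPart_smul (m := m) (z := z) 0 (0 : Fin n ⊕ Fin n → ℝ)
    rw [h3, sub_eq_zero] at h2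
    exact ⟨h1, h2⟩
  · rintro ⟨h1, h2⟩
    rw [h1, h2, sub_self]
    apply ext_parts m z
    · rw [horPart_add, horPart_horLift, horPart_vertLift, add_zero]; rfl
    · rw [vertPart_add, vertPart_horLift, vertPart_vertLift, zero_add]
      simpa using (vertPart_smul (m := m) (z := z) 0 (0 : Fin n ⊕ Fin n → ℝ)).symm

/-- The structure is integrable over a domain of constant curvature. -/
theorem nijJet_eq_zero_of_const (h : A.IsComplex) (hm : IsMetricOn m U) (hz : basePt z ∈ U)
    (hsq : ∀ z, basePt z ∈ U → endoLift m A z * endoLift m A z = -1) {c : ℝ}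
    (hN : A.NijenhuisEqs c)
    (hc : ∀ h k i j, curvature m h k i j (basePt z) = c * ((if h = i then 1 else 0)
      * m (basePt z) k j - (if h = j then 1 else 0) * m (basePt z) k i))
    (X Y : Fin n ⊕ Fin n → ℝ) :
    nijJet (endoLift m A z).mulVecLin (derivEndo (endoLift m A) z) X Y = 0 := by
  refine (complexJet_endoLift hm hz h.smooth hsq).nijJet_eq_zero
    (exists_vertLift_add h hm hz) ?_ X Y
  rintro _ ⟨X, rfl⟩ _ ⟨Y, rfl⟩
  rw [nijJet_vertLift_eq_zero_iff h hm hz rfl]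
  obtain ⟨n1, n2⟩ := hN _ (energy_nonneg hm hz)
  refine ⟨by rw [n2, zero_smul], ?_⟩
  have h1 := wedgeY_natEndo (m := m) (z := z) A.a₂ A.b₂ X Y
  rw [curvatureVec_of_const hm hz hc]
  change _ = (-c) • wedgeY m z _ _
  rw [h1, smul_smul]
  congr 1
  linear_combination n1

/-- The curvature of the base is determined by the coefficients if the structure is integrable. -/
theorem curvatureVec_eq (h : A.IsComplex) (hm : IsMetricOn m U) (hz : basePt z ∈ U)
    (hN : ∀ X Y, nijJet (endoLift m A z).mulVecLin (derivEndo (endoLift m A) z) X Y = 0)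
    {t : ℝ} (ht : energy m z = t) (V W : Fin n → ℝ) :
    curvatureVec m (basePt z) V W (fibrePt z)
      = ((2 * t * A.b₃ t * der A.a₃ t + A.a₁ t * (der A.a₂ t - A.b₂ t))
        / (A.a₂ t * (A.a₂ t + 2 * t * A.b₂ t))) • wedgeY m z V W := by
  have h0 : 0 ≤ t := ht ▸ energy_nonneg hm hz
  have h2 := h.a₂_ne_zero h0
  have h3 := h.cap₂_ne_zero h0
  rw [← ht] at h2 h3
  obtain ⟨X, rfl⟩ := natEndo_surjective (m := m) h2 h3 V
  obtain ⟨Y, rfl⟩ := natEndo_surjective (m := m) h2 h3 W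
  rw [ht] at h2 h3
  have h1 := ((nijJet_vertLift_eq_zero_iff h hm hz ht X Y).1 (hN _ _)).2
  rw [← h1, wedgeY_natEndo, ht, smul_smul, div_mul_cancel₀ _ (mul_ne_zero h2 h3)]

end Integrability

/-! ### From charts to the manifold: integrability of J -/

section Global

variable {n : ℕ} {M : Type*} [TopologicalSpace M] [ChartedSpace (EuclideanSpace ℝ (Fin n)) M]
  [IsManifold 𝓘(ℝ, EuclideanSpace ℝ (Fin n)) ∞ M] {g : SmoothMetric n M} {A : EndoCoeffs}

theorem isIntegrable_iff_nijJet : IsIntegrable g A ↔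
    ∀ e ∈ atlas (EuclideanSpace ℝ (Fin n)) M, ∀ z ∈ inducedDomain e, ∀ X Y,
      nijJet (chartJ g A e z).mulVecLin (derivEndo (chartJ g A e) z) X Y = 0 :=
  forall₄_congr fun _ _ _ _ => nijenhuis_eq_zero_iff

/-- Integrability of the natural almost complex structure. -/
theorem isIntegrable_iff [Nonempty M] (hn : 2 ≤ n) (h : A.IsComplex)
    (hJ : IsAlmostComplex g A) :
    IsIntegrable g A ↔ ∃ c, HasConstantCurvature g c ∧ A.NijenhuisEqs c := by
  rw [isIntegrable_iff_nijJet]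
  constructor
  · intro H
    set κ : ℝ → ℝ := fun t => (2 * t * A.b₃ t * der A.a₃ t + A.a₁ t * (der A.a₂ t - A.b₂ t))
        / (A.a₂ t * (A.a₂ t + 2 * t * A.b₂ t)) with hκ
    have hR : ∀ e ∈ atlas (EuclideanSpace ℝ (Fin n)) M, ∀ z ∈ inducedDomain e, ∀ V W,
        curvatureVec (chartMetric g e) (basePt z) V W (fibrePt z)
          = κ (energy (chartMetric g e) z) • wedgeY (chartMetric g e) z V W :=
      fun e he z hz V W => curvatureVec_eq h (isMetricOn_chartMetric g he) hz (H e he z hz) rfl V W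
    obtain ⟨p⟩ := ‹Nonempty M›
    set e := chartAt (EuclideanSpace ℝ (Fin n)) p with he_def
    have he : e ∈ atlas (EuclideanSpace ℝ (Fin n)) M := chart_mem_atlas _ p
    have hm := isMetricOn_chartMetric g he
    set x : Fin n → ℝ := WithLp.ofLp (e p) with hx_def
    have hx : x ∈ chartDomain e := by
      change WithLp.toLp 2 x ∈ e.target
      rw [hx_def, WithLp.toLp_ofLp]
      exact mem_chart_target _ p
    -- Rescaling y to energy 1 multiplies both the curvature vector and `wedgeY` by the same factor,
    -- so κ cannot depend on t. A single chart suffices, because κ is built from the coefficients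
    -- alone.
    have hconst : ∀ t, 0 < t → κ t = κ 1 := by
      intro t ht
      obtain ⟨z, hzx, hzt, X, hX, hX0⟩ := exists_energy_eq hm hx hn ht.le
      have hz : z ∈ inducedDomain e := by change basePt z ∈ chartDomain e; rw [hzx]; exact hx
      have h1 := hR e he z hz X (fibrePt z)
      set z' : Fin n ⊕ Fin n → ℝ := Sum.elim (basePt z) ((√t)⁻¹ • fibrePt z) with hz'
      have hr : 0 < √t := Real.sqrt_pos.2 ht
      have hz1 : energy (chartMetric g e) z' = 1 := by
        change 1 / 2 * ip _ (basePt z) ((√t)⁻¹ • fibrePt z) ((√t)⁻¹ • fibrePt z) = 1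
        rw [ip_smul_left, ip_smul_right, ip_fibrePt_self, hzt]
        have : √t * √t = t := Real.mul_self_sqrt ht.le
        field_simp
        nlinarith
      have h2 := hR e he z' hz X (fibrePt z)
      have h3 : wedgeY (chartMetric g e) z' X (fibrePt z)
          = (√t)⁻¹ • wedgeY (chartMetric g e) z X (fibrePt z) := by
        change ip _ (basePt z) X ((√t)⁻¹ • fibrePt z) • fibrePt z
          - ip _ (basePt z) (fibrePt z) ((√t)⁻¹ • fibrePt z) • X = _
        simp only [wedgeY, ip_smul_right]
        module
      change curvatureVec _ (basePt z) _ _ ((√t)⁻¹ • fibrePt z) = _ at h2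
      rw [curvatureVec_smul, h1, h3, hz1, hzt, wedgeY_fibrePt hX, hzt] at h2
      have h4 : ((√t)⁻¹ * (2 * t) * (κ t - κ 1)) • X = 0 := by
        rw [← sub_eq_zero] at h2
        rw [← neg_eq_zero, ← h2]
        module
      have h5 := (smul_eq_zero.1 h4).resolve_right hX0
      have h6 := (mul_eq_zero.1 h5).resolve_left (by positivity)
      linarith
    -- The sign comes from `wedgeY` being the negative of g(W, y)V - g(V, y)W.
    refine ⟨-κ 1, ?_, ?_⟩
    · intro e he x hx h k i j
      have hm := isMetricOn_chartMetric g he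
      -- Taking the k-th coordinate vector for y gives the components of the curvature; its energy
      -- is positive, so κ may be replaced by its constant value.
      have h1 := hR e he (Sum.elim x (Pi.single k 1)) hx (Pi.single i 1) (Pi.single j 1)
      have h2 : 0 < energy (chartMetric g e) (Sum.elim x (Pi.single k 1)) :=
        mul_pos (by norm_num) (hm.pos x hx _ fun h0 => by simpa [fibrePt] using congrFun h0 k)
      rw [hconst _ h2] at h1
      have h3 : curvatureVec (chartMetric g e) x (Pi.single i 1) (Pi.single j 1)
          (Pi.single k 1) h = (κ 1 • (ip (chartMetric g e) x (Pi.single i 1) (Pi.single k 1)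
            • (Pi.single j 1 : Fin n → ℝ) - ip (chartMetric g e) x (Pi.single j 1)
              (Pi.single k 1) • (Pi.single i 1 : Fin n → ℝ))) h := congrFun h1 h
      rw [curvatureVec_single, ip_single_single, ip_single_single] at h3
      rw [h3, hm.symm x hx k j, hm.symm x hx k i]
      simp only [Pi.smul_apply, Pi.sub_apply, smul_eq_mul, Pi.single_apply]
      ring
    · have hpos : ∀ t, 0 < t →
          2 * t * A.b₃ t * der A.a₃ t + A.a₁ t * (der A.a₂ t - A.b₂ t)
            + -κ 1 * A.a₂ t * (A.a₂ t + 2 * t * A.b₂ t) = 0 ∧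
          -der A.a₂ t * (A.a₃ t + 2 * t * A.b₃ t) + 2 * A.b₂ t * A.a₃ t - A.a₃ t * der A.a₂ t
            + A.a₂ t * (der A.a₃ t - A.b₃ t) = 0 := by
        intro t ht
        constructor
        · rw [← hconst t ht, hκ]
          have h2 := h.a₂_ne_zero ht.le
          have h3 := h.cap₂_ne_zero ht.le
          have h4 : ∀ a b : ℝ, a ≠ 0 → b ≠ 0 → ∀ r, r + -(r / (a * b)) * a * b = 0 := by
            intro a b ha hb r; field_simp; ring
          exact h4 _ _ h2 h3 _
        · obtain ⟨z, hzx, hzt, X, hX, hX0⟩ := exists_energy_eq hm hx hn ht.le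
          have hz : z ∈ inducedDomain e := by change basePt z ∈ chartDomain e; rw [hzx]; exact hx
          have h1 := ((nijJet_vertLift_eq_zero_iff h hm hz hzt X (fibrePt z)).1
            (H e he z hz _ _)).1
          rw [wedgeY_fibrePt hX, hzt, smul_smul] at h1
          have h2 := (smul_eq_zero.1 h1).resolve_right hX0
          exact (mul_eq_zero.1 h2).resolve_right (by simpa using ht.ne')
      obtain ⟨a1, a2, a3, a4, b1, b2, b3, b4⟩ := h.smooth
      have c2 := a2.der.continuousOn
      have c3 := a3.der.continuousOn
      replace a1 := a1.continuousOn
      replace a2 := a2.continuousOn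
      replace a3 := a3.continuousOn
      replace b2 := b2.continuousOn
      replace b3 := b3.continuousOn
      exact fun t ht => ⟨eq_of_eq_of_pos (g := fun _ => 0) (by fun_prop) (by fun_prop)
          (fun t ht => (hpos t ht).1) ht,
        eq_of_eq_of_pos (g := fun _ => 0) (by fun_prop) (by fun_prop)
          (fun t ht => (hpos t ht).2) ht⟩
  · rintro ⟨c, hc, hN⟩ e he z hz
    exact nijJet_eq_zero_of_const h (isMetricOn_chartMetric g he) hz (hJ e he) hN (hc e he _ hz)

end Global

section Conformal

variable {n : ℕ} {m : (Fin n → ℝ) → Matrix (Fin n) (Fin n) ℝ} {U : Set (Fin n → ℝ)}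
  {z : Fin n ⊕ Fin n → ℝ} {A : EndoCoeffs} {C : MetricCoeffs}

/-! ### The conformally anti-Kähler condition -/

/-- The 1-form `X^V ↦ p g(X, y)`, `X^H ↦ φ g(X, y)`. -/
def natLinForm (m : (Fin n → ℝ) → Matrix (Fin n) (Fin n) ℝ) (z : Fin n ⊕ Fin n → ℝ) (p φ : ℝ) :
    (Fin n ⊕ Fin n → ℝ) →ₗ[ℝ] ℝ where
  toFun w := p * ip m (basePt z) (vertPart m z w) (fibrePt z)
    + φ * ip m (basePt z) (horPart w) (fibrePt z)
  map_add' v w := by simp only [vertPart_add, horPart_add, ip_add_left]; ring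
  map_smul' r w := by
    simp only [vertPart_smul, horPart_smul, ip_smul_left, RingHom.id_apply, smul_eq_mul]; ring

theorem ip_natEndo_fibrePt (a b : ℝ → ℝ) (X : Fin n → ℝ) :
    ip m (basePt z) (natEndo m a b z X) (fibrePt z)
      = (a (energy m z) + 2 * energy m z * b (energy m z)) * ip m (basePt z) X (fibrePt z) := by
  simp only [natEndo, ip_add_left, ip_smul_left, ip_fibrePt_self]; ring

theorem bilinMap_vertLift (C : MetricCoeffs) (Y Z : Fin n → ℝ) :
    bilinMap (metricLift m C z) (vertLift Y) (vertLift Z) = natForm m C.c₂ C.d₂ z Y Z := by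
  rw [bilinMap_metricLift, metricForm_vertLift, vertPart_vertLift, horPart_vertLift]
  simp [natForm, ip_zero_right, ip_zero_left]

theorem bilinMap_vertLift_J (hm : IsMetricOn m U) (hz : basePt z ∈ U) (A : EndoCoeffs)
    (C : MetricCoeffs) (Y Z : Fin n → ℝ) :
    bilinMap (metricLift m C z) (vertLift Y) ((endoLift m A z).mulVecLin (vertLift Z))
      = natForm m (twinL A C) (twinQ A C) z Y Z := by
  rw [bilinMap_metricLift, metricForm_comm hm hz, metricForm_vertLift, Matrix.mulVecLin_apply,
    vertPart_endoLift_mulVec, horPart_endoLift_mulVec, horPart_vertLift, vertPart_vertLift,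
    natEndo_zero, natEndo_zero, zero_add, zero_sub, natForm_comm hm hz (twinL A C),
    natForm_twin hm hz, natForm_comm hm hz C.c₃ C.d₃ Y, ← neg_one_smul ℝ, natForm_smul_left]
  ring

/-- The symmetric parts of the Tachibana operator vanish if it is of pure trace. -/
theorem tachS_eq_zero (hm : IsMetricOn m U) (hz : basePt z ∈ U) (hA : A.Smooth) (hC : C.Smooth)
    {t : ℝ} (ht : energy m z = t) (ht0 : t ≠ 0) {X : Fin n → ℝ}
    (hX : ip m (basePt z) X (fibrePt z) = 0) (hX0 : X ≠ 0) {θ : (Fin n ⊕ Fin n → ℝ) →ₗ[ℝ] ℝ}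
    (hθ : ∀ X Y Z, tachibanaJet (endoLift m A z).mulVecLin (derivEndo (endoLift m A) z)
        (bilinMap (metricLift m C z)) (derivForm (metricLift m C) z) X Y Z
      = bilinMap (metricLift m C z) Y Z * θ X
        + bilinMap (metricLift m C z) Y ((endoLift m A z).mulVecLin Z)
          * θ ((endoLift m A z).mulVecLin X)) :
    tachVertS A C t = 0 ∧ tachHorS A C t = 0 := by
  have hX' : ip m (basePt z) (fibrePt z) X = 0 := by rw [hm.ip_comm hz, hX]
  have hp := (hm.pos _ hz X hX0).ne'
  -- With X orthogonal to y, both G(y^V, X^V) and G(y^V, J X^V) vanish, and of the Tachibana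
  -- operator only the symmetric coefficient times 2t g(X, X) remains.
  have h1 := hθ (vertLift X) (vertLift (fibrePt z)) (vertLift X)
  have h2 := hθ (horLift m z X) (vertLift (fibrePt z)) (vertLift X)
  rw [bilinMap_vertLift, bilinMap_vertLift_J hm hz] at h1 h2
  rw [tachibanaJet_vertLift hm hz hA hC ht] at h1
  rw [tachibanaJet_horLift hm hz hA hC ht] at h2
  simp only [natForm, hX, hX', ip_fibrePt_self, ht, mul_zero, zero_mul, add_zero, zero_add,
    mul_eq_zero, hp, ht0, or_false, OfNat.ofNat_ne_zero] at h1 h2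
  exact ⟨h1, h2⟩

/-- The Tachibana operator is of pure trace if the symmetric parts vanish. -/
theorem exists_tachibanaJet_eq (hm : IsMetricOn m U) (hz : basePt z ∈ U) (h : A.IsComplex)
    (hC : C.IsNorden A) {c : ℝ} (hc : A.NijenhuisEqs c)
    (hS : ∀ t, 0 ≤ t → tachVertS A C t = 0 ∧ tachHorS A C t = 0)
    (hJet : NordenJet (endoLift m A z).mulVecLin
      (derivEndo (endoLift m A) z) (bilinMap (metricLift m C z)) (derivForm (metricLift m C) z)
      (gammaMap (metricLift m C) z))
    (hN : ∀ X Y, nijJet (endoLift m A z).mulVecLin (derivEndo (endoLift m A) z) X Y = 0) :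
    ∃ θ : (Fin n ⊕ Fin n → ℝ) →ₗ[ℝ] ℝ, ∀ X Y Z,
      tachibanaJet (endoLift m A z).mulVecLin (derivEndo (endoLift m A) z)
        (bilinMap (metricLift m C z)) (derivForm (metricLift m C) z) X Y Z
      = bilinMap (metricLift m C z) Y Z * θ X
        + bilinMap (metricLift m C z) Y ((endoLift m A z).mulVecLin Z)
          * θ ((endoLift m A z).mulVecLin X) := by
  have ht := energy_nonneg hm hz
  obtain ⟨p, φ, p', φ', hp', hφ', e1, e2, e3, e4⟩ := h.exists_tachibana_form hC hc hS ht
  obtain ⟨s1, s2⟩ := hS _ ht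
  -- The same numbers p and φ work in all directions X, and it is enough to check vertical Y, Z
  -- since N = 0.
  refine ⟨natLinForm m z p φ, hJet.tachibanaJet_eq_of_mem hN _ (exists_vertLift_add h hm hz) ?_⟩
  rintro X _ ⟨Y, rfl⟩ _ ⟨Z, rfl⟩
  rw [← horLift_add_vertLift m z X, NordenJet.tachibanaJet_add_left,
    tachibanaJet_vertLift hm hz h.smooth hC.smooth rfl,
    tachibanaJet_horLift hm hz h.smooth hC.smooth rfl, bilinMap_vertLift,
    bilinMap_vertLift_J hm hz, s1, s2, e1, e2, e3, e4, Matrix.mulVecLin_apply]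
  simp only [natLinForm, LinearMap.coe_mk, AddHom.coe_mk, horPart_endoLift_mulVec,
    vertPart_endoLift_mulVec, vertPart_add, horPart_add, vertPart_horLift, vertPart_vertLift,
    horPart_horLift, horPart_vertLift, add_zero, zero_add, ip_add_left, ip_sub_left,
    ip_natEndo_fibrePt, h.a₄_eq _ ht, h.b₄_eq _ ht, natForm, hp', hφ']
  ring

end Conformal

/-! ### The conformally anti-Kähler condition in all charts -/

section Global

variable {n : ℕ} {M : Type*} [TopologicalSpace M] [ChartedSpace (EuclideanSpace ℝ (Fin n)) M]
  [IsManifold 𝓘(ℝ, EuclideanSpace ℝ (Fin n)) ∞ M] {g : SmoothMetric n M} {A : EndoCoeffs}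
  {C : MetricCoeffs}

theorem isConformallyAntiKahler_iff (hn : n ≠ 0) (hA : A.Smooth) (hC : C.Smooth)
    (hJ : IsAlmostComplex g A) (hG : IsSemiRiemannian g C) (hGJ : IsAntiHermitian g A C) :
    IsConformallyAntiKahler g A C ↔
      ∀ e ∈ atlas (EuclideanSpace ℝ (Fin n)) M, ∀ z ∈ inducedDomain e,
        ∃ θ : (Fin n ⊕ Fin n → ℝ) →ₗ[ℝ] ℝ, ∀ X Y Z,
          2 * formJet (chartJ g A e z).mulVecLin (derivEndo (chartJ g A e) z)
            (bilinMap (chartG g C e z)) (gammaMap (chartG g C e) z) X Y Z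
          = bilinMap (chartG g C e z) X ((chartJ g A e z).mulVecLin Y)
              * θ ((chartJ g A e z).mulVecLin Z)
            + bilinMap (chartG g C e z) X ((chartJ g A e z).mulVecLin Z)
              * θ ((chartJ g A e z).mulVecLin Y)
            + bilinMap (chartG g C e z) X Y * θ Z + bilinMap (chartG g C e z) X Z * θ Y :=
  forall₄_congr fun e he z hz => conformal_iff (by simp; ring) hn
    (nordenJet_lift (isMetricOn_chartMetric g he) hz hA hC (hJ e he) (hG e he) (hGJ e he))
    (hG e he z hz) (hJ e he z hz)

end Global

end NaturalLift

end

/-! ### The theorem -/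

theorem mainTheorem3 (n : ℕ) (hn : 2 ≤ n) (M : Type*) [TopologicalSpace M]
    [ChartedSpace (EuclideanSpace ℝ (Fin n)) M]
    [IsManifold 𝓘(ℝ, EuclideanSpace ℝ (Fin n)) ∞ M] [Nonempty M]
    (g : NaturalLift.SmoothMetric n M)
    (A : NaturalLift.EndoCoeffs) (hA : A.Smooth)
    (C : NaturalLift.MetricCoeffs) (hC : C.Smooth)
    (hJ : NaturalLift.IsAlmostComplex g A)
    (hG : NaturalLift.IsSemiRiemannian g C)
    (hGJ : NaturalLift.IsAntiHermitian g A C) :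
    (NaturalLift.IsIntegrable g A ↔
      ∃ c : ℝ, NaturalLift.HasConstantCurvature g c ∧ NaturalLift.IntegrabForm A c) ∧
    (NaturalLift.IsConformallyAntiKahler g A C ↔
      ∃ c : ℝ, NaturalLift.HasConstantCurvature g c ∧ NaturalLift.IntegrabForm A c ∧
        NaturalLift.ConformalForm A C c) := by
  obtain ⟨q⟩ := ‹Nonempty M›
  have he := chart_mem_atlas (EuclideanSpace ℝ (Fin n)) q
  have hm := NaturalLift.isMetricOn_chartMetric g he
  have hx : WithLp.ofLp (chartAt (EuclideanSpace ℝ (Fin n)) q q)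
      ∈ NaturalLift.chartDomain (chartAt (EuclideanSpace ℝ (Fin n)) q) := by
    change WithLp.toLp 2 (WithLp.ofLp (chartAt (EuclideanSpace ℝ (Fin n)) q q))
      ∈ (chartAt (EuclideanSpace ℝ (Fin n)) q).target
    rw [WithLp.toLp_ofLp]
    exact mem_chart_target _ q
  -- The coefficients do not depend on the point of M, so one chart yields all algebraic relations.
  have hcA : A.IsComplex := NaturalLift.isComplex_of_sq hm hx hn hA (hJ _ he)
  have hcC : C.IsNorden A := NaturalLift.isNorden_of_nordenJet hm hx hn hcA hC fun z hz =>
    NaturalLift.nordenJet_lift hm hz hA hC (hJ _ he) (hG _ he) (hGJ _ he)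
  have : Nonempty M := ⟨q⟩
  refine ⟨?_, ?_⟩
  · rw [NaturalLift.isIntegrable_iff hn hcA hJ]
    exact exists_congr fun c => and_congr_right fun _ => (hcA.integrabForm_iff c).symm
  rw [NaturalLift.isConformallyAntiKahler_iff (by omega) hA hC hJ hG hGJ]
  constructor
  · intro H
    have hint : NaturalLift.IsIntegrable g A := by
      rw [NaturalLift.isIntegrable_iff_nijJet]
      intro e he z hz
      obtain ⟨θ, hθ⟩ := H e he z hz
      exact (NaturalLift.nordenJet_lift (NaturalLift.isMetricOn_chartMetric g he) hz hA hC
        (hJ e he) (hG e he) (hGJ e he)).nijJet_eq_zero_of_formJet θ hθ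
    obtain ⟨c, hc, hN⟩ := (NaturalLift.isIntegrable_iff hn hcA hJ).1 hint
    refine ⟨c, hc, (hcA.integrabForm_iff c).2 hN, (hcC.conformalForm_iff hcA hN).2 ?_⟩
    -- The test vector y has to be nonzero here; the value at t = 0 follows by continuity.
    have hpos : ∀ t, 0 < t → NaturalLift.tachVertS A C t = 0 ∧ NaturalLift.tachHorS A C t = 0 := by
      intro t ht
      obtain ⟨z, hzx, hzt, X, hX, hX0⟩ := NaturalLift.exists_energy_eq hm hx hn ht.le
      have hz : NaturalLift.basePt z
          ∈ NaturalLift.chartDomain (chartAt (EuclideanSpace ℝ (Fin n)) q) := hzx ▸ hx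
      obtain ⟨θ, hθ⟩ := H _ he z hz
      exact NaturalLift.tachS_eq_zero hm hz hA hC hzt ht.ne' hX hX0
        (((NaturalLift.nordenJet_lift hm hz hA hC (hJ _ he) (hG _ he)
          (hGJ _ he)).formJet_iff_tachibanaJet θ).1 hθ)
    exact fun t ht =>
      ⟨NaturalLift.eq_of_eq_of_pos (g := fun _ => 0)
        (NaturalLift.smoothCoeff_tachVertS hA hC).continuousOn continuousOn_const
        (fun t ht => (hpos t ht).1) ht,
      NaturalLift.eq_of_eq_of_pos (g := fun _ => 0)
        (NaturalLift.smoothCoeff_tachHorS hA hC).continuousOn continuousOn_const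
        (fun t ht => (hpos t ht).2) ht⟩
  · rintro ⟨c, hc, hI, hF⟩ e he z hz
    have hN := (hcA.integrabForm_iff c).1 hI
    have hm := NaturalLift.isMetricOn_chartMetric g he
    have hJet := NaturalLift.nordenJet_lift hm hz hA hC (hJ e he) (hG e he) (hGJ e he)
    obtain ⟨θ, hθ⟩ := NaturalLift.exists_tachibanaJet_eq hm hz hcA hcC hN
      ((hcC.conformalForm_iff hcA hN).1 hF) hJet
      (NaturalLift.nijJet_eq_zero_of_const hcA hm hz (hJ e he) hN (hc e he _ hz))
    exact ⟨θ, (hJet.formJet_iff_tachibanaJet θ).2 hθ⟩
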